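/- Let $N\ge 2$ and let $\Omega\subset\mathbb R^N$ be a bounded Lipschitz domain (open, connected, nonempty, bounded, with boundary locally the graph of a Lipschitz function and $\Omega$ lying locally on one side of it). Put $\Omega^c=\mathbb R^N\setminus\overline\Omega$. For $s\in(0,1)$ let $$c_{N,s}=\Big(\int_{\mathbb R^N}\frac{1-\cos\zeta_1}{|\zeta|^{N+2s}}\,d\zeta\Big)^{-1},$$ and let $H^s_{\Omega,0}$ be the space of measurable functions $u:\mathbb R^N\to\mathbb R$ with $$\int_\Omega u^2\,dx<\infty\quad\text{and}\quad\iint_{\mathbb R^{2N}\setminus(\Omega^c)^2}\frac{|u(x)-u(y)|^2}{|x-y|^{N+2s}}\,dx\,dy<\infty.$$ An eigenfunction of the fractional Neumann Laplacian of order $s$ in $\Omega$ with eigenvalue $\mu\in\mathbb R$ is a function $u\in H^s_{\Omega,0}$, not a.e. zero in $\Omega$, such that $$\frac{c_{N,s}}2\iint_{\mathbb R^{2N}\setminus(\Omega^c)^2}\frac{(u(x)-u(y))(v(x)-v(y))}{|x-y|^{N+2s}}\,dx\,dy=\mu\int_\Omega uv\,dx\qquad\text{for all }v\in H^s_{\Omega,0}.$$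 An eigenfunction of the local Neumann Laplacian in $\Omega$ with eigenvalue $\mu\in\mathbb R$ is a function $u\in H^1(\Omega)$, $u\ne0$, such that $$\int_\Omega\nabla u\cdot\nabla v\,dx=\mu\int_\Omega uv\,dx\qquad\text{for all }v\in H^1(\Omega).$$ Let $\mu_0^{(s)}\le\mu_1^{(s)}\le\cdots$ for $s\in(0,1)$, and $\mu_0^{(1)}\le\mu_1^{(1)}\le\cdots$, denote the corresponding eigenvalues in nondecreasing order, repeated according to multiplicity; that is, $\mu_n^{(s)}$ (respectively $\mu_n^{(1)}$) is the least $t$ for which there are $n+1$ eigenfunctions, orthonormal in $L^2(\Omega)$, with eigenvalues at most $t$. Then for every $n\in\{0,1,2,\dots\}$, $$\lim_{s\to1^-}\mu_n^{(s)}=\mu_n^{(1)}.$$ Moreover, if for every $s\in(0,1)$ an eigenfunction $u_n^{(s)}$ corresponding to $\mu_n^{(s)}$ with $\|u_n^{(s)}\|_{L^2(\Omega)}=1$ is given, then there exist an increasing sequence $(s_k)\subset(0,1)$ with $s_k\to1$ and an eigenfunction $u_n^{(1)}$ of the local Neumann Laplacian in $\Omega$ corresponding to $\mu_n^{(1)}$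 such that $$\|u_n^{(s_k)}-u_n^{(1)}\|_{L^2(\Omega)}\to0\qquad\text{as }k\to\infty.$$ -/

import Mathlib

open MeasureTheory Filter Topology Set
open scoped ENNReal NNReal ContDiff RealInnerProductSpace

noncomputable section

namespace NeumannStability

/-- `ℝ^N` with its Euclidean norm and Lebesgue measure. -/
abbrev Eucl (N : ℕ) : Type := EuclideanSpace ℝ (Fin N)

variable {N : ℕ}

/-- Bounded Lipschitz domain: a bounded, open, connected, nonempty set which near each of its
boundary points is, in suitable orthonormal coordinates, the strict epigraph of a Lipschitz
function. Here `e` is the vertical direction and `x - ⟪e, x⟫ e` is the horizontal part of `x`. -/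
structure IsBoundedLipschitzDomain (Ω : Set (Eucl N)) : Prop where
  isOpen : IsOpen Ω
  isConnected : IsConnected Ω
  isBounded : Bornology.IsBounded Ω
  lipschitz_boundary : ∀ p ∈ frontier Ω, ∃ (e : Eucl N) (γ : Eucl N → ℝ) (K : ℝ≥0),
    ‖e‖ = 1 ∧ LipschitzWith K γ ∧
      ∀ᶠ x in 𝓝 p, (x ∈ Ω ↔ γ (x - (⟪e, x⟫ : ℝ) • e) < (⟪e, x⟫ : ℝ))

/-! ### The fractional Neumann problem -/

/-- The normalization constant of the fractional Laplacian on `ℝ^N`, i.e. the one for which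
`(-Δ)^s` has Fourier symbol `|ξ|^(2s)`:
`c_{N,s} = (∫_{ℝ^N} (1 - cos ζ₁) / |ζ|^(N + 2s) dζ)⁻¹`. -/
def fracConst (N : ℕ) [NeZero N] (s : ℝ) : ℝ :=
  (∫ ζ : Eucl N, (1 - Real.cos (ζ 0)) / ‖ζ‖ ^ ((N : ℝ) + 2 * s))⁻¹

/-- The set `ℝ^{2N} ∖ (Ω^c)²`, where `Ω^c = ℝ^N ∖ closure Ω`. -/
def interactionSet (Ω : Set (Eucl N)) : Set (Eucl N × Eucl N) :=
  ((closure Ω)ᶜ ×ˢ (closure Ω)ᶜ)ᶜ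

/-- The squared seminorm `[u]²` of `H^s_{Ω,0}`, with values in `[0, ∞]`. -/
def gagliardoSq (Ω : Set (Eucl N)) (s : ℝ) (u : Eucl N → ℝ) : ℝ≥0∞ :=
  ∫⁻ p in interactionSet Ω,
    ENNReal.ofReal ((u p.1 - u p.2) ^ 2 / ‖p.1 - p.2‖ ^ ((N : ℝ) + 2 * s))

/-- Membership in the space `H^s_{Ω,0}` of functions on `ℝ^N`. -/
structure MemHs (Ω : Set (Eucl N)) (s : ℝ) (u : Eucl N → ℝ) : Prop where
  aemeasurable : AEMeasurable u volume
  memLp : MemLp u 2 (volume.restrict Ω)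
  gagliardo_lt_top : gagliardoSq Ω s u < (⊤ : ℝ≥0∞)

/-- The bilinear form
`(c_{N,s}/2) ∬_{ℝ^{2N} ∖ (Ω^c)²} (u(x) - u(y)) (v(x) - v(y)) / |x - y|^(N+2s) dx dy`. -/
def fracForm [NeZero N] (Ω : Set (Eucl N)) (s : ℝ) (u v : Eucl N → ℝ) : ℝ :=
  fracConst N s / 2 * ∫ p in interactionSet Ω,
    (u p.1 - u p.2) * (v p.1 - v p.2) / ‖p.1 - p.2‖ ^ ((N : ℝ) + 2 * s)

/-- `u` is a (weak) eigenfunction, with eigenvalue `lam`, of `(-Δ)^s` in `Ω` with the nonlocal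
Neumann condition outside `Ω`. -/
structure IsFracEigenfunction [NeZero N] (Ω : Set (Eucl N)) (s lam : ℝ) (u : Eucl N → ℝ) :
    Prop where
  memHs : MemHs Ω s u
  ne_zero : ¬ u =ᵐ[volume.restrict Ω] 0
  weak_eq : ∀ v : Eucl N → ℝ, MemHs Ω s v → fracForm Ω s u v = lam * ∫ x in Ω, u x * v x

/-! ### The local Neumann problem -/

/-- `u ∈ H¹(Ω)` with weak gradient `g ∈ L²(Ω; ℝ^N)`. -/
structure HasH1Gradient (Ω : Set (Eucl N)) (u : Eucl N → ℝ) (g : Eucl N → Eucl N) : Prop where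
  memLp : MemLp u 2 (volume.restrict Ω)
  memLp_grad : MemLp g 2 (volume.restrict Ω)
  weak_grad : ∀ φ : Eucl N → ℝ, ContDiff ℝ (∞ : ℕ∞ω) φ → HasCompactSupport φ → tsupport φ ⊆ Ω →
    ∀ e : Eucl N, ∫ x in Ω, u x * fderiv ℝ φ x e = -∫ x in Ω, (⟪g x, e⟫ : ℝ) * φ x

/-- `u` is a (weak) eigenfunction, with eigenvalue `lam`, of the Neumann Laplacian in `Ω`. -/
structure IsLocalEigenfunction (Ω : Set (Eucl N)) (lam : ℝ) (u : Eucl N → ℝ) : Prop where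
  ne_zero : ¬ u =ᵐ[volume.restrict Ω] 0
  weak_eq : ∃ g : Eucl N → Eucl N, HasH1Gradient Ω u g ∧
    ∀ (v : Eucl N → ℝ) (h : Eucl N → Eucl N), HasH1Gradient Ω v h →
      ∫ x in Ω, (⟪g x, h x⟫ : ℝ) = lam * ∫ x in Ω, u x * v x

/-! ### Enumeration of the eigenvalues -/

/-- Given the relation `IsEig lam u` ("`u` is an eigenfunction with eigenvalue `lam`"), the `n`-th
eigenvalue (`n = 0, 1, 2, …`) in nondecreasing order, repeated according to multiplicity: the least
`t` for which there are `n + 1` eigenfunctions, orthonormal in `L²(Ω)`, with eigenvalues at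
most `t`. -/
def nthEigenvalue (Ω : Set (Eucl N)) (IsEig : ℝ → (Eucl N → ℝ) → Prop) (n : ℕ) : ℝ :=
  sInf {t : ℝ | ∃ (lam : Fin (n + 1) → ℝ) (u : Fin (n + 1) → Eucl N → ℝ),
    (∀ i, lam i ≤ t ∧ IsEig (lam i) (u i)) ∧
      ∀ i j, ∫ x in Ω, u i x * u j x = if i = j then 1 else 0}

/-- The eigenvalue `μ_n^{(s)}` of the fractional Neumann Laplacian, `s ∈ (0,1)`. -/
def fracEigenvalue [NeZero N] (Ω : Set (Eucl N)) (s : ℝ) (n : ℕ) : ℝ :=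
  nthEigenvalue Ω (IsFracEigenfunction Ω s) n

/-- The eigenvalue `μ_n^{(1)}` of the local Neumann Laplacian. -/
def localEigenvalue (Ω : Set (Eucl N)) (n : ℕ) : ℝ :=
  nthEigenvalue Ω (IsLocalEigenfunction Ω) n

end NeumannStability

end

/-! The mechanism is concentration. Write σ for the area of the unit sphere. Then c_{N,s}/2 behaves
like 2N(1-s)/σ as s → 1, so the measures (c_{N,s}/2) |z|^2 |z|^{-N-2s} dz give mass tending to N to
every ball about the origin. They are isotropic, while third moments near 0 and the kernel away from
0 disappear. A squared increment (v(x+z) - v(x))^2 is therefore tested to |∇v(x)|^2, and the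
nonlocal energy of a smooth function tends to its Dirichlet energy on Ω
(`tendsto_energy_of_contDiff`). The exterior does not matter: an interior point sees only nearby
points, and the boundary is null.

Upper bound for the eigenvalues. Local eigenfunctions are approximated in H¹ by smooth functions on
the whole space (`exists_contDiff_tendsto_H1`). A strict inequality between two quadratic forms on a
finite-dimensional space survives small changes of the coefficients, so the fractional Rayleigh
quotient is at most T on that space for s near 1. The min-max principle
(`exists_orthonormal_eigenvectors`) then gives orthonormal fractional eigenfunctions with
eigenvalues at most T.

Lower bound. Orthonormal fractional eigenfunctions with bounded eigenvalues have (1-s)[u]² bounded.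
Comparing increments across dyadic scales along interior cones shows that averages over small cones
approximate u in L² uniformly in s, which gives compactness (`exists_L2_convergent_subseq`). Testing
increments against smooth vector fields and dualizing gives lower semicontinuity of the energy
(`exists_H1Gradient_of_tendsto`). Applied to u_k + t v for every real t, this inequality is affine
in t in the limit, and this forces the weak local equation (`isLocalEigenfunction_of_tendsto`).

Orthonormality passes to L² limits, so families of eigenfunctions are carried in both directions,
and the two infima are compared directly. The min-max principle is needed only for s < 1: the local
eigenfunctions themselves are obtained as limits of fractional ones. -/

open MeasureTheory Filter Topology Set
open scoped ENNReal NNReal ContDiff RealInnerProductSpace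

noncomputable section

namespace NeumannStability

/-! ### Abstract Hilbert space lemmas -/

section Abstract

variable {X H₁ H₂ : Type*} [AddCommGroup X] [Module ℝ X]
  [NormedAddCommGroup H₁] [InnerProductSpace ℝ H₁] [CompleteSpace H₁]
  [NormedAddCommGroup H₂] [InnerProductSpace ℝ H₂]

/-- Existence of a minimizer of the Rayleigh quotient `‖D x‖² / ‖R x‖²` under the closed linear
constraint `R x ∈ K`. -/
theorem exists_rayleigh_minimizer (D : X →ₗ[ℝ] H₁) (R : X →ₗ[ℝ] H₂)
    (hcomp : ∀ (u : ℕ → X) (C : ℝ), (∀ k, ‖D (u k)‖ ≤ C) → (∀ k, ‖R (u k)‖ ≤ C) →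
      ∃ φ : ℕ → ℕ, StrictMono φ ∧ ∃ r, Tendsto (fun k => R (u (φ k))) atTop (𝓝 r))
    (hclosed : ∀ (u : ℕ → X) (d : H₁) (r : H₂), Tendsto (fun k => D (u k)) atTop (𝓝 d) →
      Tendsto (fun k => R (u k)) atTop (𝓝 r) → ∃ x, D x = d ∧ R x = r)
    (K : Submodule ℝ H₂) (hK : IsClosed (K : Set H₂)) (y : X) (hy : R y ∈ K) (hy0 : R y ≠ 0) :
    ∃ u, R u ∈ K ∧ ‖R u‖ = 1 ∧ ∀ x, R x ∈ K → ‖D u‖ ^ 2 * ‖R x‖ ^ 2 ≤ ‖D x‖ ^ 2 := by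
  set S : Set ℝ := {t | ∃ x, R x ∈ K ∧ ‖R x‖ = 1 ∧ ‖D x‖ ^ 2 = t} with hS
  have hSne : S.Nonempty := by
    refine ⟨_, ‖R y‖⁻¹ • y, ?_, ?_, rfl⟩
    · simpa using K.smul_mem _ hy
    · simp [norm_smul, hy0]
  have hSbdd : BddBelow S := ⟨0, by rintro _ ⟨x, -, -, rfl⟩; positivity⟩
  set lam := sInf S with hlam
  have hlow : ∀ x, R x ∈ K → lam * ‖R x‖ ^ 2 ≤ ‖D x‖ ^ 2 := by
    intro x hx
    by_cases h0 : R x = 0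
    · simp [h0]
    have hpos : 0 < ‖R x‖ := norm_pos_iff.mpr h0
    have : lam ≤ ‖D (‖R x‖⁻¹ • x)‖ ^ 2 := by
      refine csInf_le hSbdd ⟨_, ?_, ?_, rfl⟩
      · simpa using K.smul_mem _ hx
      · simp [norm_smul, h0]
    rw [map_smul, norm_smul, norm_inv, norm_norm, mul_pow, inv_pow] at this
    calc lam * ‖R x‖ ^ 2 ≤ ((‖R x‖ ^ 2)⁻¹ * ‖D x‖ ^ 2) * ‖R x‖ ^ 2 := by gcongr
      _ = ‖D x‖ ^ 2 := by field_simp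
  obtain ⟨t, -, ht, htS⟩ := exists_seq_tendsto_sInf hSne hSbdd
  choose u huK hu1 hut using htS
  have hbd : ∃ C, ∀ k, ‖D (u k)‖ ^ 2 ≤ C := by
    obtain ⟨C, hC⟩ := ht.bddAbove_range
    exact ⟨C, fun k => (hut k).trans_le (hC ⟨k, rfl⟩)⟩
  obtain ⟨C, hC⟩ := hbd
  -- C bounds the squares ‖D u‖², and a ≤ a² + 1 turns this into a bound on the norms; C ≥ 0 covers
  -- ‖R u‖ = 1.
  obtain ⟨φ, hφ, r, hr⟩ := hcomp u (C + 1)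
    (fun k => by nlinarith [hC k, norm_nonneg (D (u k)), sq_nonneg (‖D (u k)‖ - 1)])
    (fun k => by rw [hu1]; nlinarith [hC k, sq_nonneg (‖D (u k)‖)])
  have htφ : Tendsto (fun k => ‖D (u (φ k))‖ ^ 2) atTop (𝓝 lam) := by
    have := ht.comp hφ.tendsto_atTop
    exact this.congr fun k => (hut _).symm
  -- The space X carries no topology, so convergence is obtained in H₁. By the parallelogram law
  -- ‖D(u-v)‖² equals 2‖D u‖² + 2‖D v‖² - ‖D(u+v)‖², and the last term is at least lam ‖R(u+v)‖²,
  -- which tends to 4 lam because R converges strongly to a unit vector.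
  have hcau : CauchySeq (fun k => D (u (φ k))) := by
    rw [cauchySeq_iff_tendsto_dist_atTop_0]
    have h1 : Tendsto (fun p : ℕ × ℕ => 2 * ‖D (u (φ p.1))‖ ^ 2 + 2 * ‖D (u (φ p.2))‖ ^ 2
        - lam * ‖R (u (φ p.1)) + R (u (φ p.2))‖ ^ 2) atTop (𝓝 0) := by
      rw [← prod_atTop_atTop_eq]
      have a1 := htφ.comp (tendsto_fst (f := (atTop : Filter ℕ)) (g := (atTop : Filter ℕ)))
      have a2 := htφ.comp (tendsto_snd (f := (atTop : Filter ℕ)) (g := (atTop : Filter ℕ)))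
      have b1 := hr.comp (tendsto_fst (f := (atTop : Filter ℕ)) (g := (atTop : Filter ℕ)))
      have b2 := hr.comp (tendsto_snd (f := (atTop : Filter ℕ)) (g := (atTop : Filter ℕ)))
      have hr1 : ‖r‖ = 1 := tendsto_nhds_unique hr.norm (by simp [hu1])
      have := ((a1.const_mul 2).add (a2.const_mul 2)).sub (((b1.add b2).norm.pow 2).const_mul lam)
      have hz : 2 * lam + 2 * lam - lam * ‖r + r‖ ^ 2 = 0 := by
        rw [← two_smul ℝ r, norm_smul, hr1]; norm_num; ring
      rwa [hz] at this
    have h2 : Tendsto (fun p : ℕ × ℕ => ‖D (u (φ p.1)) - D (u (φ p.2))‖ ^ 2) atTop (𝓝 0) := by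
      refine squeeze_zero (fun _ => by positivity) (fun p => ?_) h1
      have hp := parallelogram_law_with_norm ℝ (D (u (φ p.1))) (D (u (φ p.2)))
      have hl := hlow (u (φ p.1) + u (φ p.2)) (by
        rw [map_add]; exact K.add_mem (huK _) (huK _))
      rw [map_add, map_add] at hl
      nlinarith
    have h3 := h2.sqrt
    simpa [dist_eq_norm, Real.sqrt_sq] using h3
  obtain ⟨d, hd⟩ := cauchySeq_tendsto_of_complete hcau
  obtain ⟨x, hxd, hxr⟩ := hclosed _ d r hd hr
  refine ⟨x, ?_, ?_, fun z hz => ?_⟩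
  · rw [hxr]; exact hK.mem_of_tendsto hr (Eventually.of_forall fun k => huK _)
  · rw [hxr]; exact tendsto_nhds_unique hr.norm (by simp [hu1])
  · have : ‖D x‖ ^ 2 = lam := by rw [hxd]; exact tendsto_nhds_unique (hd.norm.pow 2) htφ
    rw [this]; exact hlow z hz

/-- If `a t² + 2 b t ≥ 0` for all real `t`, then `b = 0`. -/
theorem eq_zero_of_forall_quadratic_nonneg {a b : ℝ} (h : ∀ t : ℝ, 0 ≤ a * t ^ 2 + 2 * b * t) :
    b = 0 := by
  -- At this t the expression is b²/(|a|+1)² times a - 2(|a|+1), and the second factor is negative.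
  have h1 := h (-b / (|a| + 1))
  have hp : 0 < |a| + 1 := by positivity
  have h2 : a * (-b / (|a| + 1)) ^ 2 + 2 * b * (-b / (|a| + 1))
      = (b ^ 2 / (|a| + 1) ^ 2) * (a - 2 * (|a| + 1)) := by field_simp; ring
  rw [h2] at h1
  by_contra hb
  have h3 : 0 < b ^ 2 / (|a| + 1) ^ 2 := by positivity
  nlinarith [le_abs_self a, abs_nonneg a]

/-- Min-max principle: if the Rayleigh quotient is at most `lam` on an `m`-dimensional space then
there are `m` orthonormal eigenvectors with eigenvalues at most `lam`. -/
theorem exists_orthonormal_eigenvectors (D : X →ₗ[ℝ] H₁) (R : X →ₗ[ℝ] H₂)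
    (hcomp : ∀ (u : ℕ → X) (C : ℝ), (∀ k, ‖D (u k)‖ ≤ C) → (∀ k, ‖R (u k)‖ ≤ C) →
      ∃ φ : ℕ → ℕ, StrictMono φ ∧ ∃ r, Tendsto (fun k => R (u (φ k))) atTop (𝓝 r))
    (hclosed : ∀ (u : ℕ → X) (d : H₁) (r : H₂), Tendsto (fun k => D (u k)) atTop (𝓝 d) →
      Tendsto (fun k => R (u k)) atTop (𝓝 r) → ∃ x, D x = d ∧ R x = r)
    {n : ℕ} (v : Fin n → X) (lam : ℝ)
    (hv : ∀ c : Fin n → ℝ, ‖D (∑ i, c i • v i)‖ ^ 2 ≤ lam * ‖R (∑ i, c i • v i)‖ ^ 2)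
    (hR : LinearIndependent ℝ (fun i => R (v i))) (m : ℕ) (hm : m ≤ n) :
    ∃ (μ : Fin m → ℝ) (w : Fin m → X),
      (∀ i, μ i ≤ lam ∧ ∀ x, (⟪D (w i), D x⟫ : ℝ) = μ i * ⟪R (w i), R x⟫) ∧
      ∀ i j, (⟪R (w i), R (w j)⟫ : ℝ) = if i = j then 1 else 0 := by
  induction m with
  | zero => exact ⟨Fin.elim0, Fin.elim0, fun i => i.elim0, fun i => i.elim0⟩
  | succ m ih =>
    obtain ⟨μ, w, hw, hort⟩ := ih (by omega)
    set K : Submodule ℝ H₂ := (Submodule.span ℝ (range fun i => R (w i)))ᗮ with hK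
    have hKmem : ∀ h : H₂, h ∈ K ↔ ∀ i, (⟪R (w i), h⟫ : ℝ) = 0 := by
      intro h
      rw [hK, Submodule.mem_orthogonal]
      constructor
      · intro H i; exact H _ (Submodule.subset_span ⟨i, rfl⟩)
      · intro H u hu
        induction hu using Submodule.span_induction with
        | mem x hx => obtain ⟨i, rfl⟩ := hx; exact H i
        | zero => simp
        | add x y _ _ hx hy => rw [inner_add_left, hx, hy, add_zero]
        | smul a x _ hx => rw [inner_smul_left, hx, mul_zero]
    -- Orthogonality to the m vectors already found imposes m linear conditions on n > m
    -- coefficients. The resulting trial vector keeps the next Rayleigh minimum below lam.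
    obtain ⟨c, hc0, hc⟩ : ∃ c : Fin n → ℝ, c ≠ 0 ∧ R (∑ i, c i • v i) ∈ K := by
      let T : (Fin n → ℝ) →ₗ[ℝ] (Fin m → ℝ) :=
        { toFun := fun c i => ⟪R (w i), R (∑ j, c j • v j)⟫
          map_add' := fun a b => by
            ext i; simp [add_smul, Finset.sum_add_distrib, inner_add_right]
          map_smul' := fun a b => by
            ext i
            simp only [Pi.smul_apply, smul_eq_mul, mul_smul, ← Finset.smul_sum, map_smul,
              inner_smul_right, RingHom.id_apply] }
      obtain ⟨c, hc, hc0⟩ := (Submodule.ne_bot_iff _).mp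
        (LinearMap.ker_ne_bot_of_finrank_lt (f := T) (by simpa using hm))
      exact ⟨c, hc0, (hKmem _).mpr fun i => congrFun (LinearMap.mem_ker.mp hc) i⟩
    have hRc : R (∑ i, c i • v i) ≠ 0 := by
      intro h
      apply hc0
      rw [map_sum] at h
      simp only [map_smul] at h
      ext i
      exact Fintype.linearIndependent_iff.mp hR c h i
    obtain ⟨u, huK, hu1, hmin⟩ := exists_rayleigh_minimizer D R hcomp hclosed K
      (Submodule.isClosed_orthogonal _) _ hc hRc
    have hule : ‖D u‖ ^ 2 ≤ lam := by
      have h1 := (hmin _ hc).trans (hv c)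
      exact le_of_mul_le_mul_right h1 (by positivity)
    have hweakK : ∀ x, R x ∈ K → (⟪D u, D x⟫ : ℝ) = ‖D u‖ ^ 2 * ⟪R u, R x⟫ := by
      intro x hx
      have := eq_zero_of_forall_quadratic_nonneg
        (a := ‖D x‖ ^ 2 - ‖D u‖ ^ 2 * ‖R x‖ ^ 2)
        (b := ⟪D u, D x⟫ - ‖D u‖ ^ 2 * ⟪R u, R x⟫) (fun t => by
          have h := hmin (u + t • x) (by
            rw [map_add, map_smul]; exact K.add_mem huK (K.smul_mem _ hx))
          rw [map_add, map_smul, map_add, map_smul, norm_add_sq_real, norm_add_sq_real,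
            inner_smul_right, inner_smul_right, norm_smul, norm_smul, hu1, mul_pow, mul_pow,
            Real.norm_eq_abs, sq_abs] at h
          nlinarith)
      linarith
    have huw : ∀ i, (⟪R (w i), R u⟫ : ℝ) = 0 := (hKmem _).mp huK
    -- The constrained equation extends to all x by subtracting the components along the earlier w
    -- i. They contribute nothing: R u is orthogonal to R (w i), hence D u is orthogonal to D (w i)
    -- by the equation for w i.
    have hweak : ∀ x, (⟪D u, D x⟫ : ℝ) = ‖D u‖ ^ 2 * ⟪R u, R x⟫ := by
      intro x
      have hx' := hweakK (x - ∑ i, (⟪R (w i), R x⟫ : ℝ) • w i) (by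
        rw [hKmem]; intro i
        rw [map_sub, map_sum, inner_sub_right, inner_sum]
        simp [inner_smul_right, hort])
      have hDw : ∀ i, (⟪D u, D (w i)⟫ : ℝ) = 0 := fun i => by
        rw [real_inner_comm, (hw i).2, huw, mul_zero]
      have hRw : ∀ i, (⟪R u, R (w i)⟫ : ℝ) = 0 := fun i => by rw [real_inner_comm, huw]
      simpa [map_sub, map_sum, inner_sub_right, inner_sum, inner_smul_right, hDw, hRw] using hx'
    refine ⟨Fin.snoc μ (‖D u‖ ^ 2), Fin.snoc w u, ?_, ?_⟩
    · intro i
      refine Fin.lastCases ?_ (fun i => ?_) i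
      · simpa using ⟨hule, hweak⟩
      · simpa using hw i
    · intro i j
      refine Fin.lastCases ?_ (fun i => ?_) i
      · refine Fin.lastCases ?_ (fun j => ?_) j
        · simp [hu1]
        · simp only [Fin.snoc_last, Fin.snoc_castSucc]
          rw [real_inner_comm, huw, if_neg (Fin.castSucc_lt_last j).ne']
      · refine Fin.lastCases ?_ (fun j => ?_) j
        · simp only [Fin.snoc_last, Fin.snoc_castSucc]
          rw [huw, if_neg (Fin.castSucc_lt_last i).ne]
        · simpa using hort i j

/-- A Riesz-type representation: a linear functional `ℓ` with `2 ℓ x - ‖ι x‖² ≤ M` is represented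
by a vector of squared norm at most `M`. -/
theorem exists_riesz_of_quadratic_bound (ι : X →ₗ[ℝ] H₁) (ℓ : X →ₗ[ℝ] ℝ) (M : ℝ)
    (h : ∀ x, 2 * ℓ x - ‖ι x‖ ^ 2 ≤ M) :
    ∃ g : H₁, ‖g‖ ^ 2 ≤ M ∧ ∀ x, ℓ x = ⟪g, ι x⟫ := by
  have hM : 0 ≤ M := by simpa using h 0
  have hb : ∀ x, |ℓ x| ≤ √M * ‖ι x‖ := by
    intro x
    -- Scaling x makes the hypothesis a nonnegative quadratic polynomial in t; its discriminant
    -- gives |ℓ x| ≤ √M ‖ι x‖.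
    have key : ∀ t : ℝ, 0 ≤ ‖ι x‖ ^ 2 * (t * t) + (-2 * ℓ x) * t + M := by
      intro t
      have := h (t • x)
      rw [map_smul, map_smul, norm_smul, mul_pow, Real.norm_eq_abs, sq_abs, smul_eq_mul] at this
      nlinarith
    have hd := discrim_le_zero key
    rw [discrim] at hd
    rw [← Real.sqrt_sq (norm_nonneg (ι x)), ← Real.sqrt_mul hM]
    apply Real.abs_le_sqrt
    nlinarith
  have hker : LinearMap.ker ι ≤ LinearMap.ker ℓ := by
    intro x hx
    have := hb x
    rw [LinearMap.mem_ker] at hx ⊢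
    rw [hx, norm_zero, mul_zero] at this
    exact abs_eq_zero.mp (le_antisymm this (abs_nonneg _))
  obtain ⟨f, hf⟩ : ∃ f : LinearMap.range ι →ₗ[ℝ] ℝ, ∀ x, f ⟨ι x, x, rfl⟩ = ℓ x := by
    refine ⟨(Submodule.liftQ _ ℓ hker).comp ι.quotKerEquivRange.symm.toLinearMap, fun x => ?_⟩
    have : ι.quotKerEquivRange.symm ⟨ι x, x, rfl⟩ = Submodule.Quotient.mk x := by
      rw [LinearEquiv.symm_apply_eq]; rfl
    simp [this]
  have hfb : ∀ y, ‖f y‖ ≤ √M * ‖y‖ := by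
    rintro ⟨_, x, rfl⟩
    rw [hf]; exact hb x
  -- The range of ι need not be closed, so the functional is first extended to H₁ with the same norm
  -- (Hahn–Banach) and only then represented.
  obtain ⟨G, hG, hGn⟩ := _root_.exists_extension_norm_eq _ (f.mkContinuous _ hfb)
  refine ⟨(InnerProductSpace.toDual ℝ H₁).symm G, ?_, fun x => ?_⟩
  · rw [LinearIsometryEquiv.norm_map, hGn]
    have := f.mkContinuous_norm_le (Real.sqrt_nonneg M) hfb
    calc _ ≤ √M ^ 2 := by gcongr
      _ = M := Real.sq_sqrt hM
  · rw [InnerProductSpace.toDual_symm_apply]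
    rw [← hf x]
    exact (hG ⟨ι x, x, rfl⟩).symm

/-- Uniform positivity of a matrix is stable under entrywise convergence. -/
theorem eventually_quadForm_ge {ι κ : Type*} [Fintype ι] {l : Filter κ} {A : κ → ι → ι → ℝ}
    {B : ι → ι → ℝ} {η : ℝ} (hη : 0 < η) (hA : ∀ i j, Tendsto (fun k => A k i j) l (𝓝 (B i j)))
    (hB : ∀ c : ι → ℝ, η * ∑ i, c i ^ 2 ≤ ∑ i, ∑ j, c i * c j * B i j) :
    ∀ᶠ k in l, ∀ c : ι → ℝ, η / 2 * ∑ i, c i ^ 2 ≤ ∑ i, ∑ j, c i * c j * A k i j := by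
  have h1 : Tendsto (fun k => ∑ i, ∑ j, |A k i j - B i j|) l (𝓝 0) := by
    have : Tendsto (fun k => ∑ i, ∑ j, |A k i j - B i j|) l (𝓝 (∑ i : ι, ∑ j : ι, |B i j - B i j|)) :=
      tendsto_finsetSum _ fun i _ => tendsto_finsetSum _ fun j _ => ((hA i j).sub_const _).abs
    simpa using this
  filter_upwards [h1.eventually (gt_mem_nhds (half_pos hη))] with k hk c
  have h2 : |∑ i, ∑ j, c i * c j * (A k i j - B i j)|
      ≤ (∑ i, c i ^ 2) * ∑ i, ∑ j, |A k i j - B i j| := by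
    rw [Finset.mul_sum]
    refine (Finset.abs_sum_le_sum_abs _ _).trans (Finset.sum_le_sum fun i _ => ?_)
    rw [Finset.mul_sum]
    refine (Finset.abs_sum_le_sum_abs _ _).trans (Finset.sum_le_sum fun j _ => ?_)
    rw [abs_mul, abs_mul]
    gcongr
    have hi := Finset.single_le_sum (f := fun i => c i ^ 2) (fun i _ => sq_nonneg _)
      (Finset.mem_univ i)
    have hj := Finset.single_le_sum (f := fun i => c i ^ 2) (fun i _ => sq_nonneg _)
      (Finset.mem_univ j)
    rw [← sq_abs] at hi hj
    nlinarith [sq_nonneg (|c i| - |c j|)]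
  have h3 : ∑ i, ∑ j, c i * c j * A k i j = ∑ i, ∑ j, c i * c j * B i j
      + ∑ i, ∑ j, c i * c j * (A k i j - B i j) := by
    simp only [← Finset.sum_add_distrib]
    exact Finset.sum_congr rfl fun i _ => Finset.sum_congr rfl fun j _ => by ring
  have h4 : 0 ≤ ∑ i, c i ^ 2 := Finset.sum_nonneg fun i _ => sq_nonneg _
  rw [h3]
  nlinarith [hB c, neg_abs_le (∑ i, ∑ j, c i * c j * (A k i j - B i j)),
    mul_le_mul_of_nonneg_left hk.le h4]

end Abstract

/-! ### The singular kernel -/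

section Kernel

variable {N : ℕ}

/-- The kernel `|z|^{-(N+2s)}`. -/
def kern (s : ℝ) (z : Eucl N) : ℝ := (‖z‖ ^ ((N : ℝ) + 2 * s))⁻¹

/-- The surface measure of the unit sphere. -/
def sphereArea (N : ℕ) : ℝ := N * volume.real (Metric.ball (0 : Eucl N) 1)

theorem kern_nonneg (s : ℝ) (z : Eucl N) : 0 ≤ kern s z := by unfold kern; positivity

@[fun_prop]
theorem measurable_kern (s : ℝ) : Measurable (kern (N := N) s) := by unfold kern; fun_prop

theorem sphereArea_pos [NeZero N] : 0 < sphereArea N := by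
  have hN : 0 < N := Nat.pos_of_ne_zero (NeZero.ne N)
  have : 0 < volume.real (Metric.ball (0 : Eucl N) 1) :=
    ENNReal.toReal_pos (Metric.measure_ball_pos _ _ one_pos).ne' measure_ball_lt_top.ne
  unfold sphereArea
  positivity

/-! ### Radial integrals of powers of the norm -/

theorem pow_pred_mul_rpow [NeZero N] {y q : ℝ} (hy : 0 < y) :
    y ^ (N - 1) * y ^ (q - N) = y ^ (q - 1) := by
  have hN : 1 ≤ N := Nat.one_le_iff_ne_zero.mpr (NeZero.ne N)
  rw [← Real.rpow_natCast, ← Real.rpow_add hy]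
  congr 1
  push_cast [hN]
  ring

theorem integrableOn_ball_norm_rpow [NeZero N] {p : ℝ} (hp : 0 < p) (δ : ℝ) :
    IntegrableOn (fun z : Eucl N => ‖z‖ ^ (p - N)) (Metric.ball 0 δ) := by
  rw [integrableOn_fun_norm_addHaar volume (f := fun y => y ^ (p - N))]
  have h := (intervalIntegral.intervalIntegrable_rpow' (a := 0) (b := δ)
    (show -1 < p - 1 by linarith)).1
  refine (h.mono_set Ioo_subset_Ioc_self).congr_fun (fun y hy => ?_) measurableSet_Ioo
  simp only [finrank_euclideanSpace, Fintype.card_fin, smul_eq_mul]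
  exact (pow_pred_mul_rpow hy.1).symm

theorem setIntegral_ball_norm_rpow [NeZero N] {p δ : ℝ} (hp : 0 < p) (hδ : 0 < δ) :
    ∫ z in Metric.ball (0 : Eucl N) δ, ‖z‖ ^ (p - N) = sphereArea N * (δ ^ p / p) := by
  have h := integral_fun_norm_addHaar (volume : Measure (Eucl N))
    (indicator (Iio δ) fun y : ℝ => y ^ (p - N))
  have h1 : (fun z : Eucl N => indicator (Iio δ) (fun y : ℝ => y ^ (p - N)) ‖z‖)
      = indicator (Metric.ball 0 δ) fun z => ‖z‖ ^ (p - N) := by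
    ext z; simp [indicator]
  rw [h1, integral_indicator measurableSet_ball] at h
  rw [h, sphereArea]
  have h2 : ∫ y in Ioi (0 : ℝ), y ^ (Module.finrank ℝ (Eucl N) - 1) •
      indicator (Iio δ) (fun y : ℝ => y ^ (p - N)) y = δ ^ p / p := by
    have : ∀ y ∈ Ioi (0 : ℝ), y ^ (Module.finrank ℝ (Eucl N) - 1) •
      indicator (Iio δ) (fun y : ℝ => y ^ (p - N)) y = indicator (Iio δ) (fun y => y ^ (p - 1)) y := by
      intro y hy
      by_cases hyδ : y < δ
      · simp [indicator, hyδ, pow_pred_mul_rpow (mem_Ioi.mp hy)]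
      · simp [indicator, hyδ]
    rw [setIntegral_congr_fun measurableSet_Ioi this, setIntegral_indicator measurableSet_Iio,
      Ioi_inter_Iio, ← integral_Ioc_eq_integral_Ioo, ← intervalIntegral.integral_of_le hδ.le,
      integral_rpow (Or.inl (by linarith))]
    simp [Real.zero_rpow hp.ne']
  rw [h2]
  simp [nsmul_eq_mul, mul_assoc]

theorem integrableOn_compl_ball_norm_rpow [NeZero N] {p δ : ℝ} (hp : 0 < p) (hδ : 0 < δ) :
    IntegrableOn (fun z : Eucl N => ‖z‖ ^ (-p - N)) (Metric.ball 0 δ)ᶜ := by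
  have h1 : (fun z : Eucl N => indicator (Ici δ) (fun y : ℝ => y ^ (-p - N)) ‖z‖)
      = indicator (Metric.ball 0 δ)ᶜ fun z => ‖z‖ ^ (-p - N) := by
    ext z; simp [indicator]
  rw [← integrable_indicator_iff measurableSet_ball.compl, ← h1,
    integrable_fun_norm_addHaar volume (f := indicator (Ici δ) fun y : ℝ => y ^ (-p - N))]
  have : ∀ y ∈ Ioi (0 : ℝ), indicator (Ici δ) (fun y => y ^ (-p - 1)) y =
      y ^ (Module.finrank ℝ (Eucl N) - 1) • indicator (Ici δ) (fun y : ℝ => y ^ (-p - N)) y := by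
    intro y hy
    by_cases hyδ : δ ≤ y
    · simp [indicator, hyδ, pow_pred_mul_rpow (mem_Ioi.mp hy)]
    · simp [indicator, hyδ]
  refine IntegrableOn.congr_fun ?_ this measurableSet_Ioi
  have := (integrableOn_Ioi_rpow_of_lt (show -p - 1 < -1 by linarith) hδ)
  rw [← integrableOn_Ici_iff_integrableOn_Ioi] at this
  exact (this.integrable_indicator measurableSet_Ici).integrableOn

theorem setIntegral_compl_ball_norm_rpow [NeZero N] {p δ : ℝ} (hp : 0 < p) (hδ : 0 < δ) :
    ∫ z in (Metric.ball (0 : Eucl N) δ)ᶜ, ‖z‖ ^ (-p - N) = sphereArea N * (δ ^ (-p) / p) := by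
  have h := integral_fun_norm_addHaar (volume : Measure (Eucl N))
    (indicator (Ici δ) fun y : ℝ => y ^ (-p - N))
  have h1 : (fun z : Eucl N => indicator (Ici δ) (fun y : ℝ => y ^ (-p - N)) ‖z‖)
      = indicator (Metric.ball 0 δ)ᶜ fun z => ‖z‖ ^ (-p - N) := by
    ext z; simp [indicator]
  rw [h1, integral_indicator measurableSet_ball.compl] at h
  rw [h, sphereArea]
  have h2 : ∫ y in Ioi (0 : ℝ), y ^ (Module.finrank ℝ (Eucl N) - 1) •
      indicator (Ici δ) (fun y : ℝ => y ^ (-p - N)) y = δ ^ (-p) / p := by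
    have : ∀ y ∈ Ioi (0 : ℝ), y ^ (Module.finrank ℝ (Eucl N) - 1) •
      indicator (Ici δ) (fun y : ℝ => y ^ (-p - N)) y
        = indicator (Ici δ) (fun y => y ^ (-p - 1)) y := by
      intro y hy
      by_cases hyδ : δ ≤ y
      · simp [indicator, hyδ, pow_pred_mul_rpow (mem_Ioi.mp hy)]
      · simp [indicator, hyδ]
    rw [setIntegral_congr_fun measurableSet_Ioi this, setIntegral_indicator measurableSet_Ici,
      inter_eq_self_of_subset_right (show Ici δ ⊆ Ioi (0 : ℝ) from fun y hy => hδ.trans_le hy),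
      integral_Ici_eq_integral_Ioi, integral_Ioi_rpow_of_lt (by linarith) hδ]
    rw [sub_add_cancel, neg_div_neg_eq]
  rw [h2]
  simp [nsmul_eq_mul, mul_assoc]

theorem pow_mul_kern {k : ℕ} (s : ℝ) {z : Eucl N} (hz : z ≠ 0) :
    ‖z‖ ^ k * kern s z = ‖z‖ ^ ((k - 2 * s) - N) := by
  have hz' : 0 < ‖z‖ := norm_pos_iff.mpr hz
  rw [kern, ← Real.rpow_neg hz'.le, ← Real.rpow_natCast, ← Real.rpow_add hz']
  congr 1; ring

theorem kern_eq_rpow {s : ℝ} {z : Eucl N} : kern s z = ‖z‖ ^ (-(2 * s) - N) := by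
  rw [kern, ← Real.rpow_neg (norm_nonneg _)]
  congr 1; ring

theorem ae_ne_zero [NeZero N] : ∀ᵐ z : Eucl N, z ≠ 0 := by
  have : (volume : Measure (Eucl N)) {0} = 0 := measure_singleton _
  exact compl_mem_ae_iff.mpr this

theorem integrableOn_ball_pow_mul_kern [NeZero N] {k : ℕ} {s : ℝ} (hk : 2 * s < k) (δ : ℝ) :
    IntegrableOn (fun z : Eucl N => ‖z‖ ^ k * kern s z) (Metric.ball 0 δ) := by
  refine (integrableOn_ball_norm_rpow (p := k - 2 * s) (by linarith) δ).congr ?_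
  filter_upwards [ae_restrict_of_ae ae_ne_zero] with z hz using (pow_mul_kern s hz).symm

theorem setIntegral_ball_pow_mul_kern [NeZero N] {k : ℕ} {s δ : ℝ} (hk : 2 * s < k) (hδ : 0 < δ) :
    ∫ z in Metric.ball (0 : Eucl N) δ, ‖z‖ ^ k * kern s z
      = sphereArea N * (δ ^ (k - 2 * s) / (k - 2 * s)) := by
  rw [← setIntegral_ball_norm_rpow (by linarith) hδ]
  refine integral_congr_ae ?_
  filter_upwards [ae_restrict_of_ae ae_ne_zero] with z hz using pow_mul_kern s hz

theorem integrableOn_compl_ball_kern [NeZero N] {s δ : ℝ} (hs : 0 < s) (hδ : 0 < δ) :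
    IntegrableOn (fun z : Eucl N => kern s z) (Metric.ball 0 δ)ᶜ := by
  simp only [kern_eq_rpow]
  exact integrableOn_compl_ball_norm_rpow (by linarith) hδ

theorem setIntegral_compl_ball_kern [NeZero N] {s δ : ℝ} (hs : 0 < s) (hδ : 0 < δ) :
    ∫ z in (Metric.ball (0 : Eucl N) δ)ᶜ, kern s z
      = sphereArea N * (δ ^ (-(2 * s)) / (2 * s)) := by
  simp only [kern_eq_rpow]
  exact setIntegral_compl_ball_norm_rpow (by linarith) hδ

theorem integrableOn_ball_mul_kern [NeZero N] {k : ℕ} {s δ C : ℝ} (hk : 2 * s < k)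
    {f : Eucl N → ℝ} (hf : AEStronglyMeasurable f (volume.restrict (Metric.ball 0 δ)))
    (hfC : ∀ z ∈ Metric.ball (0 : Eucl N) δ, |f z| ≤ C * ‖z‖ ^ k) :
    IntegrableOn (fun z : Eucl N => f z * kern s z) (Metric.ball 0 δ) := by
  refine ((integrableOn_ball_pow_mul_kern hk δ).const_mul C).mono'
    (hf.mul (measurable_kern s).aestronglyMeasurable) ?_
  filter_upwards [ae_restrict_mem measurableSet_ball] with z hz
  rw [Real.norm_eq_abs, abs_mul, abs_of_nonneg (kern_nonneg s z), ← mul_assoc]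
  exact mul_le_mul_of_nonneg_right (hfC z hz) (kern_nonneg s z)

theorem abs_setIntegral_ball_mul_kern_le [NeZero N] {k : ℕ} {s δ C : ℝ} (hk : 2 * s < k)
    (hδ : 0 < δ) {f : Eucl N → ℝ}
    (hfC : ∀ z ∈ Metric.ball (0 : Eucl N) δ, |f z| ≤ C * ‖z‖ ^ k) :
    |∫ z in Metric.ball (0 : Eucl N) δ, f z * kern s z|
      ≤ C * (sphereArea N * (δ ^ (k - 2 * s) / (k - 2 * s))) := by
  rw [← setIntegral_ball_pow_mul_kern hk hδ, ← integral_const_mul, ← Real.norm_eq_abs]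
  refine norm_integral_le_of_norm_le ((integrableOn_ball_pow_mul_kern hk δ).const_mul C) ?_
  filter_upwards [ae_restrict_mem measurableSet_ball] with z hz
  rw [Real.norm_eq_abs, abs_mul, abs_of_nonneg (kern_nonneg s z), ← mul_assoc]
  exact mul_le_mul_of_nonneg_right (hfC z hz) (kern_nonneg s z)

theorem integrableOn_compl_ball_mul_kern [NeZero N] {s δ C : ℝ} (hs : 0 < s) (hδ : 0 < δ)
    {f : Eucl N → ℝ} (hf : AEStronglyMeasurable f (volume.restrict (Metric.ball 0 δ)ᶜ))
    (hfC : ∀ z, |f z| ≤ C) :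
    IntegrableOn (fun z : Eucl N => f z * kern s z) (Metric.ball 0 δ)ᶜ := by
  refine ((integrableOn_compl_ball_kern hs hδ).const_mul C).mono'
    (hf.mul (measurable_kern s).aestronglyMeasurable) (Eventually.of_forall fun z => ?_)
  rw [Real.norm_eq_abs, abs_mul, abs_of_nonneg (kern_nonneg s z)]
  exact mul_le_mul_of_nonneg_right (hfC z) (kern_nonneg s z)

theorem abs_setIntegral_compl_ball_mul_kern_le [NeZero N] {s δ C : ℝ} (hs : 0 < s) (hδ : 0 < δ)
    {f : Eucl N → ℝ} (hfC : ∀ z, |f z| ≤ C) :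
    |∫ z in (Metric.ball (0 : Eucl N) δ)ᶜ, f z * kern s z|
      ≤ C * (sphereArea N * (δ ^ (-(2 * s)) / (2 * s))) := by
  rw [← setIntegral_compl_ball_kern hs hδ, ← integral_const_mul, ← Real.norm_eq_abs]
  refine norm_integral_le_of_norm_le ((integrableOn_compl_ball_kern hs hδ).const_mul C)
    (Eventually.of_forall fun z => ?_)
  rw [Real.norm_eq_abs, abs_mul, abs_of_nonneg (kern_nonneg s z)]
  exact mul_le_mul_of_nonneg_right (hfC z) (kern_nonneg s z)

/-! Second moments. -/

/-- The reflection in the hyperplane orthogonal to a - b exchanges a and b and preserves the ball,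
the kernel and Lebesgue measure. -/
theorem setIntegral_ball_inner_sq_congr {a b : Eucl N} (hab : ‖a‖ = ‖b‖) (s δ : ℝ) :
    ∫ z in Metric.ball (0 : Eucl N) δ, (⟪a, z⟫ : ℝ) ^ 2 * kern s z
      = ∫ z in Metric.ball (0 : Eucl N) δ, (⟪b, z⟫ : ℝ) ^ 2 * kern s z := by
  set ρ := (ℝ ∙ (a - b))ᗮ.reflection with hρ
  have hρa : ρ a = b := Submodule.reflection_sub hab
  have hmp : MeasurePreserving ρ (volume : Measure (Eucl N)) volume := ρ.measurePreserving
  have := hmp.setIntegral_preimage_emb ρ.toMeasurableEquiv.measurableEmbedding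
    (fun z => (⟪b, z⟫ : ℝ) ^ 2 * kern s z) (Metric.ball 0 δ)
  rw [← this]
  have hpre : ρ ⁻¹' Metric.ball 0 δ = Metric.ball 0 δ := by
    ext z; simp
  rw [hpre]
  congr 1
  ext z
  rw [← hρa, LinearIsometryEquiv.inner_map_map]
  simp [kern]

theorem abs_inner_sq_le (a z : Eucl N) : |(⟪a, z⟫ : ℝ) ^ 2| ≤ ‖a‖ ^ 2 * ‖z‖ ^ 2 := by
  rw [abs_pow, ← mul_pow]
  gcongr
  exact abs_real_inner_le_norm a z

/-- By symmetry all unit directions have the same second moment, and over the N coordinate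
directions these moments add up to the radial integral of |z|² times the kernel. -/
theorem setIntegral_ball_inner_sq_mul_kern [NeZero N] {s δ : ℝ} (hs : s < 1) (hδ : 0 < δ)
    (a : Eucl N) :
    ∫ z in Metric.ball (0 : Eucl N) δ, (⟪a, z⟫ : ℝ) ^ 2 * kern s z
      = ‖a‖ ^ 2 * (sphereArea N / N * (δ ^ (2 - 2 * s) / (2 - 2 * s))) := by
  have hk : 2 * s < (2 : ℕ) := by push_cast; linarith
  have hNpos : (0 : ℝ) < N := by exact_mod_cast Nat.pos_of_ne_zero (NeZero.ne N)
  set e : Fin N → Eucl N := fun i => EuclideanSpace.single i 1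
  set q : Eucl N → ℝ := fun a => ∫ z in Metric.ball (0 : Eucl N) δ, (⟪a, z⟫ : ℝ) ^ 2 * kern s z
    with hq
  have hsum : ∑ i, q (e i) = sphereArea N * (δ ^ (2 - 2 * s) / (2 - 2 * s)) := by
    have h2 := setIntegral_ball_pow_mul_kern (N := N) hk hδ
    push_cast at h2
    rw [← h2, hq]
    simp only
    rw [← integral_finsetSum]
    · congr 1
      ext z
      rw [← Finset.sum_mul, EuclideanSpace.norm_sq_eq]
      simp [e, EuclideanSpace.inner_single_left]
    · intro i _
      exact integrableOn_ball_mul_kern hk (by fun_prop) fun z _ => abs_inner_sq_le _ z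
  have hqe : ∀ b : Eucl N, ‖b‖ = 1 → q b = sphereArea N / N * (δ ^ (2 - 2 * s) / (2 - 2 * s)) := by
    intro b hb
    have : ∀ i, q (e i) = q b := fun i =>
      setIntegral_ball_inner_sq_congr (by simp [e, hb]) s δ
    simp only [this, Finset.sum_const, Finset.card_univ, Fintype.card_fin, nsmul_eq_mul] at hsum
    field_simp
    field_simp at hsum
    linarith
  by_cases ha : a = 0
  · simp [ha]
  have ha' : ‖a‖ ≠ 0 := norm_ne_zero_iff.mpr ha
  rw [← hqe (‖a‖⁻¹ • a) (by simp [norm_smul, ha']), hq]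
  simp only
  rw [← integral_const_mul]
  congr 1; ext z
  rw [inner_smul_left]
  simp only [map_inv₀, conj_trivial]
  field_simp

/-! ### The normalizing constant and its asymptotics as s → 1 -/

theorem fracConst_inv_eq [NeZero N] (s : ℝ) :
    (fracConst N s)⁻¹ = ∫ z : Eucl N, (1 - Real.cos (z 0)) * kern s z := by
  rw [fracConst, inv_inv]
  rfl

theorem abs_apply_le_norm (z : Eucl N) (i : Fin N) : |z i| ≤ ‖z‖ := by
  simpa using PiLp.norm_apply_le z i

theorem integrable_one_sub_cos_mul_kern [NeZero N] {s : ℝ} (hs0 : 0 < s) (hs : s < 1) :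
    Integrable (fun z : Eucl N => (1 - Real.cos (z 0)) * kern s z) := by
  rw [← integrableOn_univ, ← union_compl_self (Metric.ball (0 : Eucl N) 1)]
  refine IntegrableOn.union ?_ ?_
  · refine integrableOn_ball_mul_kern (k := 2) (C := 1) (by push_cast; linarith)
      (by fun_prop) fun z _ => ?_
    have h1 := Real.one_sub_sq_div_two_le_cos (x := z 0)
    have h2 := Real.cos_le_one (z 0)
    rw [abs_of_nonneg (by linarith)]
    have h3 : (z 0) ^ 2 ≤ ‖z‖ ^ 2 := sq_le_sq' (by linarith [neg_le_of_abs_le (abs_apply_le_norm z 0)])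
      ((le_abs_self _).trans (abs_apply_le_norm z 0))
    nlinarith [sq_nonneg (z 0)]
  · refine integrableOn_compl_ball_mul_kern (C := 2) hs0 one_pos
      (by fun_prop) fun z => ?_
    rw [abs_le]
    constructor <;> linarith [Real.cos_le_one (z 0), Real.neg_one_le_cos (z 0)]

/-- On the unit ball 1 - cos ζ₁ is ζ₁²/2 up to a fourth-order error, and half the second moment is
the singular term. The fourth-order error contributes at most one sphere area and the complement of
the ball at most two, uniformly for s ≥ 1/2. -/
theorem abs_fracConst_inv_sub_le [NeZero N] {s : ℝ} (hs0 : 1 / 2 ≤ s) (hs : s < 1) :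
    |(fracConst N s)⁻¹ - sphereArea N / (4 * N * (1 - s))| ≤ 3 * sphereArea N := by
  have hs0' : 0 < s := by linarith
  have hσ := sphereArea_pos (N := N)
  have hNpos : (0 : ℝ) < N := by exact_mod_cast Nat.pos_of_ne_zero (NeZero.ne N)
  set e : Eucl N := EuclideanSpace.single 0 1 with he
  have hez : ∀ z : Eucl N, (⟪e, z⟫ : ℝ) = z 0 := fun z => by
    simp [he, EuclideanSpace.inner_single_left]
  have hint := integrable_one_sub_cos_mul_kern (N := N) hs0' hs
  have hmain := setIntegral_ball_inner_sq_mul_kern (N := N) hs one_pos e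
  have hei : IntegrableOn (fun z : Eucl N => (⟪e, z⟫ : ℝ) ^ 2 * kern s z) (Metric.ball 0 1) :=
    integrableOn_ball_mul_kern (k := 2) (by push_cast; linarith) (by fun_prop)
      fun z _ => abs_inner_sq_le _ z
  have hsplit := integral_add_compl (μ := volume) (s := Metric.ball (0 : Eucl N) 1)
    measurableSet_ball hint
  have h4 : |∫ z in Metric.ball (0 : Eucl N) 1, (1 - Real.cos (z 0) - (z 0) ^ 2 / 2) * kern s z|
      ≤ 1 * (sphereArea N * (1 ^ (((4 : ℕ) : ℝ) - 2 * s) / (((4 : ℕ) : ℝ) - 2 * s))) := by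
    refine abs_setIntegral_ball_mul_kern_le (by push_cast; linarith) one_pos fun z hz => ?_
    have hz1 : |z 0| ≤ 1 := (abs_apply_le_norm z 0).trans (by simpa using (mem_ball_zero_iff.mp hz).le)
    have := Real.cos_bound hz1
    rw [show 1 - Real.cos (z 0) - (z 0) ^ 2 / 2 = -(Real.cos (z 0) - (1 - (z 0) ^ 2 / 2)) by ring,
      abs_neg]
    have h5 : |z 0| ^ 4 ≤ ‖z‖ ^ 4 := by gcongr; exact abs_apply_le_norm z 0
    nlinarith [pow_nonneg (norm_nonneg z) 4]
  have h2 : |∫ z in (Metric.ball (0 : Eucl N) 1)ᶜ, (1 - Real.cos (z 0)) * kern s z|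
      ≤ 2 * (sphereArea N * (1 ^ (-(2 * s)) / (2 * s))) := by
    refine abs_setIntegral_compl_ball_mul_kern_le hs0' one_pos fun z => ?_
    rw [abs_le]
    constructor <;> linarith [Real.cos_le_one (z 0), Real.neg_one_le_cos (z 0)]
  have h3 : ∫ z in Metric.ball (0 : Eucl N) 1, (1 - Real.cos (z 0)) * kern s z
      = (∫ z in Metric.ball (0 : Eucl N) 1, (1 - Real.cos (z 0) - (z 0) ^ 2 / 2) * kern s z)
        + 1 / 2 * ∫ z in Metric.ball (0 : Eucl N) 1, (⟪e, z⟫ : ℝ) ^ 2 * kern s z := by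
    have : (fun z : Eucl N => (1 - Real.cos (z 0) - (z 0) ^ 2 / 2) * kern s z)
        = fun z => (1 - Real.cos (z 0)) * kern s z - 1 / 2 * ((⟪e, z⟫ : ℝ) ^ 2 * kern s z) := by
      ext z; rw [hez]; ring
    rw [this, integral_sub hint.integrableOn (hei.const_mul _), integral_const_mul]
    ring
  rw [fracConst_inv_eq, ← hsplit, h3, hmain]
  have hnorm : ‖e‖ = 1 := by simp [he]
  rw [hnorm]
  simp only [Real.one_rpow, one_pow, one_mul] at *
  have h6 : 1 / 2 * (sphereArea N / N * (1 / (2 - 2 * s))) = sphereArea N / (4 * N * (1 - s)) := by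
    have : 1 - s ≠ 0 := by linarith
    rw [show 2 - 2 * s = 2 * (1 - s) by ring]
    field_simp; norm_num
  rw [h6]
  have h7 : sphereArea N * (1 / (((4 : ℕ) : ℝ) - 2 * s)) ≤ sphereArea N := by
    apply mul_le_of_le_one_right hσ.le
    rw [div_le_one (by push_cast; linarith)]; push_cast; linarith
  have h8 : 2 * (sphereArea N * (1 / (2 * s))) ≤ 2 * sphereArea N := by
    gcongr
    apply mul_le_of_le_one_right hσ.le
    rw [div_le_one (by linarith)]; linarith
  calc _ = |(∫ z in Metric.ball (0 : Eucl N) 1, (1 - Real.cos (z 0) - (z 0) ^ 2 / 2) * kern s z)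
        + ∫ z in (Metric.ball (0 : Eucl N) 1)ᶜ, (1 - Real.cos (z 0)) * kern s z| := by
        congr 1; ring
    _ ≤ _ := abs_add_le _ _
    _ ≤ 3 * sphereArea N := by linarith

theorem tendsto_one_sub_nhdsLT : Tendsto (fun s : ℝ => 1 - s) (𝓝[<] 1) (𝓝 0) := by
  have : Tendsto (fun s : ℝ => 1 - s) (𝓝 1) (𝓝 (1 - 1)) := tendsto_id.const_sub 1
  simpa using this.mono_left nhdsWithin_le_nhds

theorem eventually_mem_Ioo_half : ∀ᶠ s : ℝ in 𝓝[<] 1, s ∈ Ioo (1 / 2 : ℝ) 1 :=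
  Ioo_mem_nhdsLT (by norm_num)

/-- `c_{N,s} / (1 - s) → 4 N / |S^{N-1}|` as `s → 1`. -/
theorem tendsto_fracConst_div [NeZero N] :
    Tendsto (fun s : ℝ => fracConst N s / (1 - s)) (𝓝[<] 1) (𝓝 (4 * N / sphereArea N)) := by
  have hσ := sphereArea_pos (N := N)
  have hNpos : (0 : ℝ) < N := by exact_mod_cast Nat.pos_of_ne_zero (NeZero.ne N)
  have h1 : Tendsto (fun s : ℝ => (1 - s) * (fracConst N s)⁻¹) (𝓝[<] 1)
      (𝓝 (sphereArea N / (4 * N))) := by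
    rw [tendsto_iff_dist_tendsto_zero]
    have h2 : Tendsto (fun s : ℝ => (1 - s) * (3 * sphereArea N)) (𝓝[<] 1) (𝓝 0) := by
      simpa using tendsto_one_sub_nhdsLT.mul_const (3 * sphereArea N)
    refine squeeze_zero' (Eventually.of_forall fun _ => dist_nonneg) ?_ h2
    filter_upwards [eventually_mem_Ioo_half] with s hs
    have hs1 : 0 < 1 - s := by linarith [hs.2]
    have := abs_fracConst_inv_sub_le (N := N) hs.1.le hs.2
    calc dist ((1 - s) * (fracConst N s)⁻¹) (sphereArea N / (4 * N))
        = (1 - s) * |(fracConst N s)⁻¹ - sphereArea N / (4 * N * (1 - s))| := by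
          rw [Real.dist_eq, ← abs_of_pos hs1, ← abs_mul, abs_of_pos hs1]
          congr 1
          field_simp
      _ ≤ _ := by gcongr
  have h3 := h1.inv₀ (by positivity)
  rw [inv_div] at h3
  refine h3.congr fun s => ?_
  rw [mul_inv, inv_inv, div_eq_mul_inv, mul_comm]

theorem tendsto_fracConst [NeZero N] :
    Tendsto (fun s : ℝ => fracConst N s) (𝓝[<] 1) (𝓝 0) := by
  have := (tendsto_fracConst_div (N := N)).mul tendsto_one_sub_nhdsLT
  rw [mul_zero] at this
  refine this.congr' ?_
  filter_upwards [self_mem_nhdsWithin] with s hs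
  have : 1 - s ≠ 0 := by have : s < 1 := hs; linarith
  field_simp

/-- Any constant below the limit of c_{N,s}/(1-s) works; half of it is used. This converts a bound
on the normalized energy into the bound on (1-s)[u]² needed for compactness. -/
theorem exists_fracConst_lower_bound [NeZero N] :
    ∃ c > 0, ∀ᶠ s : ℝ in 𝓝[<] 1, c * (1 - s) ≤ fracConst N s := by
  have hσ := sphereArea_pos (N := N)
  have hNpos : (0 : ℝ) < N := by exact_mod_cast Nat.pos_of_ne_zero (NeZero.ne N)
  have hpos : 0 < 4 * N / sphereArea N := by positivity
  refine ⟨4 * N / sphereArea N / 2, by positivity, ?_⟩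
  filter_upwards [(tendsto_fracConst_div (N := N)).eventually (lt_mem_nhds (half_lt_self hpos)),
    self_mem_nhdsWithin] with s h1 hs
  have : 0 < 1 - s := by have : s < 1 := hs; linarith
  rw [lt_div_iff₀ this] at h1
  exact h1.le

/-- The factor 1/(2-2s) of the radial integral exactly offsets the vanishing of c_{N,s}, so the
limit does not depend on δ. The next two quantities have no such singular factor and therefore tend
to 0; together the three limits express concentration at the origin. -/
theorem tendsto_second_moment [NeZero N] {δ : ℝ} (hδ : 0 < δ) :
    Tendsto (fun s : ℝ => fracConst N s / 2 * (sphereArea N * (δ ^ (2 - 2 * s) / (2 - 2 * s))))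
      (𝓝[<] 1) (𝓝 N) := by
  have hσ := sphereArea_pos (N := N)
  have h1 : Tendsto (fun s : ℝ => δ ^ (2 - 2 * s)) (𝓝[<] 1) (𝓝 1) := by
    have h2 : Tendsto (fun s : ℝ => 2 - 2 * s) (𝓝[<] 1) (𝓝 0) := by
      have := tendsto_one_sub_nhdsLT.const_mul 2
      simp only [mul_zero] at this
      exact this.congr fun s => by ring
    simpa using (tendsto_const_nhds (x := δ)).rpow h2 (Or.inl hδ.ne')
  have h2 := ((tendsto_fracConst_div (N := N)).mul h1).const_mul (sphereArea N / 4)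
  have h3 : sphereArea N / 4 * (4 * N / sphereArea N * 1) = N := by field_simp
  rw [h3] at h2
  refine h2.congr' ?_
  filter_upwards [self_mem_nhdsWithin] with s hs
  have : 1 - s ≠ 0 := by have : s < 1 := hs; linarith
  rw [show 2 - 2 * s = 2 * (1 - s) by ring]
  field_simp
  ring

theorem tendsto_third_moment [NeZero N] {δ : ℝ} (hδ : 0 < δ) :
    Tendsto (fun s : ℝ => fracConst N s / 2 *
      (sphereArea N * (δ ^ (((3 : ℕ) : ℝ) - 2 * s) / (((3 : ℕ) : ℝ) - 2 * s))))
      (𝓝[<] 1) (𝓝 0) := by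
  have h1 : ContinuousAt (fun s : ℝ => sphereArea N *
      (δ ^ (((3 : ℕ) : ℝ) - 2 * s) / (((3 : ℕ) : ℝ) - 2 * s))) 1 := by
    refine ContinuousAt.mul continuousAt_const (ContinuousAt.div ?_ (by fun_prop) (by norm_num))
    exact ContinuousAt.rpow (by fun_prop) (by fun_prop) (Or.inl hδ.ne')
  have := ((tendsto_fracConst (N := N)).div_const 2).mul (h1.mono_left nhdsWithin_le_nhds)
  simpa using this

theorem tendsto_kernel_tail [NeZero N] {δ : ℝ} (hδ : 0 < δ) :
    Tendsto (fun s : ℝ => fracConst N s / 2 * (sphereArea N * (δ ^ (-(2 * s)) / (2 * s))))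
      (𝓝[<] 1) (𝓝 0) := by
  have h1 : ContinuousAt (fun s : ℝ => sphereArea N * (δ ^ (-(2 * s)) / (2 * s))) 1 := by
    refine ContinuousAt.mul continuousAt_const (ContinuousAt.div ?_ (by fun_prop) (by norm_num))
    exact ContinuousAt.rpow (by fun_prop) (by fun_prop) (Or.inl hδ.ne')
  have := ((tendsto_fracConst (N := N)).div_const 2).mul (h1.mono_left nhdsWithin_le_nhds)
  simpa using this

theorem eventually_fracConst_pos [NeZero N] : ∀ᶠ s : ℝ in 𝓝[<] 1, 0 < fracConst N s := by
  obtain ⟨c, hc, h⟩ := exists_fracConst_lower_bound (N := N)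
  filter_upwards [h, self_mem_nhdsWithin] with s hs h1
  have : 0 < 1 - s := by have : s < 1 := h1; linarith
  exact lt_of_lt_of_le (by positivity) hs

theorem tendsto_setIntegral_ball_inner_sq [NeZero N] {δ : ℝ} (hδ : 0 < δ) (a : Eucl N) :
    Tendsto (fun s : ℝ => fracConst N s / 2 *
      ∫ z in Metric.ball (0 : Eucl N) δ, (⟪a, z⟫ : ℝ) ^ 2 * kern s z) (𝓝[<] 1) (𝓝 (‖a‖ ^ 2)) := by
  have hNpos : (0 : ℝ) < N := by exact_mod_cast Nat.pos_of_ne_zero (NeZero.ne N)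
  have h := (tendsto_second_moment (N := N) hδ).const_mul (‖a‖ ^ 2 / N)
  have h1 : ‖a‖ ^ 2 / N * (N : ℝ) = ‖a‖ ^ 2 := by field_simp
  rw [h1] at h
  refine h.congr' ?_
  filter_upwards [self_mem_nhdsWithin] with s hs
  rw [setIntegral_ball_inner_sq_mul_kern hs hδ]
  field_simp

/-- The kernel `c_{N,s} |z|^{-N-2s} / 2`, localized near the origin, tests a quadratic form by its
trace in the limit `s → 1`. -/
theorem tendsto_setIntegral_ball_quadratic [NeZero N] {δ : ℝ} (hδ : 0 < δ)
    (A : Fin N → Fin N → ℝ) :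
    Tendsto (fun s : ℝ => fracConst N s / 2 *
      ∫ z in Metric.ball (0 : Eucl N) δ, (∑ i, ∑ j, A i j * (z i * z j)) * kern s z)
      (𝓝[<] 1) (𝓝 (∑ i, A i i)) := by
  set e : Fin N → Eucl N := fun i => EuclideanSpace.single i 1 with he
  have hez : ∀ i (z : Eucl N), (⟪e i, z⟫ : ℝ) = z i := fun i z => by
    simp [he, EuclideanSpace.inner_single_left]
  -- Polarization: z_i z_j is a quarter of (z_i + z_j)² - (z_i - z_j)², so squares of linear forms
  -- suffice.
  have h1 : ∀ i j, Tendsto (fun s : ℝ => A i j * ((fracConst N s / 2 *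
      ∫ z in Metric.ball (0 : Eucl N) δ, (⟪e i + e j, z⟫ : ℝ) ^ 2 * kern s z) - (fracConst N s / 2 *
      ∫ z in Metric.ball (0 : Eucl N) δ, (⟪e i - e j, z⟫ : ℝ) ^ 2 * kern s z)) / 4)
      (𝓝[<] 1) (𝓝 (A i j * ((‖e i + e j‖ ^ 2 - ‖e i - e j‖ ^ 2)) / 4)) := fun i j =>
    (((tendsto_setIntegral_ball_inner_sq hδ _).sub
      (tendsto_setIntegral_ball_inner_sq hδ _)).const_mul _).div_const _
  have h2 := tendsto_finsetSum Finset.univ fun i _ => tendsto_finsetSum Finset.univ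
    fun j _ => h1 i j
  have h3 : ∑ i, ∑ j, A i j * ((‖e i + e j‖ ^ 2 - ‖e i - e j‖ ^ 2)) / 4 = ∑ i, A i i := by
    refine Finset.sum_congr rfl fun i _ => ?_
    have : ∀ j, A i j * ((‖e i + e j‖ ^ 2 - ‖e i - e j‖ ^ 2)) / 4 = if i = j then A i j else 0 := by
      intro j
      rw [norm_add_sq_real, norm_sub_sq_real, hez]
      by_cases hij : i = j
      · simp [he, hij]; ring
      · simp [he, hij]
    simp [this]
  rw [h3] at h2
  refine h2.congr' ?_
  filter_upwards [self_mem_nhdsWithin] with s hs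
  have hk : 2 * s < (2 : ℕ) := by have : s < 1 := hs; push_cast; linarith
  have hi : ∀ a : Eucl N, IntegrableOn (fun z : Eucl N => (⟪a, z⟫ : ℝ) ^ 2 * kern s z)
      (Metric.ball 0 δ) := fun a =>
    integrableOn_ball_mul_kern hk (by fun_prop) fun z _ => abs_inner_sq_le _ z
  have h4 : (fun z : Eucl N => (∑ i, ∑ j, A i j * (z i * z j)) * kern s z) = fun z =>
      ∑ i, ∑ j, (A i j / 4) * ((⟪e i + e j, z⟫ : ℝ) ^ 2 * kern s z
        - (⟪e i - e j, z⟫ : ℝ) ^ 2 * kern s z) := by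
    ext z
    simp only [Finset.sum_mul]
    refine Finset.sum_congr rfl fun i _ => Finset.sum_congr rfl fun j _ => ?_
    rw [inner_add_left, inner_sub_left, hez, hez]
    ring
  have hij : ∀ i j, IntegrableOn (fun z : Eucl N => (A i j / 4) * ((⟪e i + e j, z⟫ : ℝ) ^ 2 * kern s z
        - (⟪e i - e j, z⟫ : ℝ) ^ 2 * kern s z)) (Metric.ball 0 δ) := fun i j =>
    ((hi _).sub (hi _)).const_mul _
  rw [h4, integral_finsetSum _ fun i _ => integrable_finsetSum _ fun j _ => hij i j, Finset.mul_sum]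
  refine Finset.sum_congr rfl fun i _ => ?_
  rw [integral_finsetSum _ fun j _ => hij i j, Finset.mul_sum]
  refine Finset.sum_congr rfl fun j _ => ?_
  rw [integral_const_mul, integral_sub (hi _) (hi _)]
  ring

theorem integrable_mul_kern [NeZero N] {s C : ℝ} (hs0 : 0 < s) (hs : s < 1) {g : Eucl N → ℝ}
    (hg : AEStronglyMeasurable g volume) (hgC : ∀ z, |g z| ≤ C) (hgC2 : ∀ z, |g z| ≤ C * ‖z‖ ^ 2) :
    Integrable (fun z => g z * kern s z) := by
  rw [← integrableOn_univ, ← union_compl_self (Metric.ball (0 : Eucl N) 1)]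
  exact (integrableOn_ball_mul_kern (k := 2) (by push_cast; linarith) hg.restrict
    fun z _ => hgC2 z).union (integrableOn_compl_ball_mul_kern hs0 one_pos hg.restrict hgC)

/-- The quadratic bound is used inside the unit ball and the uniform bound outside. The right side
is explicit because its product with c_{N,s}/2 stays bounded as s → 1, which supplies the dominating
constant later. -/
theorem abs_integral_mul_kern_le [NeZero N] {s C : ℝ} (hs0 : 0 < s) (hs : s < 1) {g : Eucl N → ℝ}
    (hg : AEStronglyMeasurable g volume) (hgC : ∀ z, |g z| ≤ C) (hgC2 : ∀ z, |g z| ≤ C * ‖z‖ ^ 2) :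
    |∫ z, g z * kern s z| ≤ C * (sphereArea N * (1 ^ (2 - 2 * s) / (2 - 2 * s)))
      + C * (sphereArea N * (1 ^ (-(2 * s)) / (2 * s))) := by
  rw [← integral_add_compl (s := Metric.ball (0 : Eucl N) 1) measurableSet_ball
    (integrable_mul_kern hs0 hs hg hgC hgC2)]
  refine (abs_add_le _ _).trans (add_le_add ?_ ?_)
  · have := abs_setIntegral_ball_mul_kern_le (N := N) (k := 2) (s := s) (δ := 1) (C := C)
      (by push_cast; linarith) one_pos (f := g) fun z _ => hgC2 z
    exact_mod_cast this
  · exact abs_setIntegral_compl_ball_mul_kern_le hs0 one_pos hgC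

/-- A bounded function which is `⟪a, z⟫² + o(|z|²)` at the origin is tested by the normalized kernel
to `|a|²` in the limit `s → 1`. -/
theorem tendsto_integral_mul_kern [NeZero N] {g : Eucl N → ℝ} {C : ℝ} (a : Eucl N)
    (hg : AEStronglyMeasurable g volume) (hgC : ∀ z, |g z| ≤ C) (hgC2 : ∀ z, |g z| ≤ C * ‖z‖ ^ 2)
    (ho : ∀ ε > 0, ∃ δ > 0, ∀ z ∈ Metric.ball (0 : Eucl N) δ, |g z - (⟪a, z⟫ : ℝ) ^ 2| ≤ ε * ‖z‖ ^ 2) :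
    Tendsto (fun s : ℝ => fracConst N s / 2 * ∫ z, g z * kern s z) (𝓝[<] 1) (𝓝 (‖a‖ ^ 2)) := by
  have hNpos : (0 : ℝ) < N := by exact_mod_cast Nat.pos_of_ne_zero (NeZero.ne N)
  rw [Metric.tendsto_nhds]
  intro ε hε
  -- The normalized second moment on the ball is eventually below 2N, so this tolerance costs at
  -- most ε/2; the tail and the exact quadratic term take ε/4 each.
  obtain ⟨δ, hδ, hgδ⟩ := ho (ε / (4 * N)) (by positivity)
  have hm := tendsto_second_moment (N := N) hδ
  have ht := (tendsto_kernel_tail (N := N) hδ).const_mul C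
  rw [mul_zero] at ht
  have hq := tendsto_setIntegral_ball_inner_sq (N := N) hδ a
  filter_upwards [hm.eventually (gt_mem_nhds (show (N : ℝ) < 2 * N by linarith)),
    ht.eventually (gt_mem_nhds (show (0 : ℝ) < ε / 4 by positivity)),
    (Metric.tendsto_nhds.mp hq) (ε / 4) (by positivity), eventually_mem_Ioo_half,
    eventually_fracConst_pos (N := N)] with s h1 h2 h3 hs hc
  have hs0 : 0 < s := by linarith [hs.1]
  have hint := integrable_mul_kern hs0 hs.2 hg hgC hgC2
  have hia : IntegrableOn (fun z : Eucl N => (⟪a, z⟫ : ℝ) ^ 2 * kern s z) (Metric.ball 0 δ) :=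
    integrableOn_ball_mul_kern (k := 2) (by push_cast; linarith [hs.2]) (by fun_prop)
      fun z _ => abs_inner_sq_le _ z
  have h4 := abs_setIntegral_ball_mul_kern_le (N := N) (k := 2) (s := s) (C := ε / (4 * N))
    (by push_cast; linarith [hs.2]) hδ (f := fun z => g z - (⟪a, z⟫ : ℝ) ^ 2) hgδ
  have h5 := abs_setIntegral_compl_ball_mul_kern_le hs0 hδ hgC
  have h6 : ∫ z in Metric.ball (0 : Eucl N) δ, (g z - (⟪a, z⟫ : ℝ) ^ 2) * kern s z
      = (∫ z in Metric.ball (0 : Eucl N) δ, g z * kern s z)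
        - ∫ z in Metric.ball (0 : Eucl N) δ, (⟪a, z⟫ : ℝ) ^ 2 * kern s z := by
    rw [← integral_sub hint.integrableOn hia]
    congr 1; ext z; ring
  rw [h6] at h4
  push_cast at h4
  rw [← integral_add_compl (s := Metric.ball (0 : Eucl N) δ) measurableSet_ball hint]
  rw [Real.dist_eq] at h3 ⊢
  set I1 := ∫ z in Metric.ball (0 : Eucl N) δ, g z * kern s z
  set I2 := ∫ z in (Metric.ball (0 : Eucl N) δ)ᶜ, g z * kern s z
  set I3 := ∫ z in Metric.ball (0 : Eucl N) δ, (⟪a, z⟫ : ℝ) ^ 2 * kern s z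
  have hc2 : 0 < fracConst N s / 2 := by positivity
  have h7 : fracConst N s / 2 * |I1 - I3| ≤ ε / 2 := by
    calc _ ≤ fracConst N s / 2 * (ε / (4 * N) * (sphereArea N * (δ ^ (2 - 2 * s) / (2 - 2 * s)))) := by
          gcongr
      _ = ε / (4 * N) * (fracConst N s / 2 * (sphereArea N * (δ ^ (2 - 2 * s) / (2 - 2 * s)))) := by
          ring
      _ ≤ ε / (4 * N) * (2 * N) := by gcongr
      _ = ε / 2 := by field_simp; norm_num
  have h8 : fracConst N s / 2 * |I2| < ε / 4 := by
    calc _ ≤ fracConst N s / 2 * (C * (sphereArea N * (δ ^ (-(2 * s)) / (2 * s)))) := by gcongr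
      _ < _ := by linarith
  calc |fracConst N s / 2 * (I1 + I2) - ‖a‖ ^ 2|
      = |fracConst N s / 2 * (I1 - I3) + fracConst N s / 2 * I2
        + (fracConst N s / 2 * I3 - ‖a‖ ^ 2)| := by congr 1; ring
    _ ≤ |fracConst N s / 2 * (I1 - I3)| + |fracConst N s / 2 * I2|
        + |fracConst N s / 2 * I3 - ‖a‖ ^ 2| := abs_add_three _ _ _
    _ < ε := by rw [abs_mul, abs_mul, abs_of_pos hc2]; linarith

end Kernel

/-! ### Geometry of Lipschitz domains -/

section Geometry

variable {N : ℕ}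

/-- From the points of `Ω ∩ S` one can move inside `Ω` along the truncated cone of directions in
the ball of radius `κ` about the unit vector `e`. -/
structure HasInnerCone (Ω S : Set (Eucl N)) (e : Eucl N) (κ r : ℝ) : Prop where
  norm_eq : ‖e‖ = 1
  pos : 0 < κ
  le : κ ≤ 1 / 4
  rpos : 0 < r
  mem : ∀ x ∈ Ω, x ∈ S → ∀ t ∈ Ioo 0 r, ∀ w ∈ Metric.closedBall e κ, x + t • w ∈ Ω

theorem norm_sub_inner_smul_le {e : Eucl N} (he : ‖e‖ = 1) (w : Eucl N) :
    ‖w - (⟪e, w⟫ : ℝ) • e‖ ≤ ‖w - e‖ := by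
  have h1 : ‖w - (⟪e, w⟫ : ℝ) • e‖ ^ 2 = ‖w‖ ^ 2 - (⟪e, w⟫ : ℝ) ^ 2 := by
    rw [norm_sub_sq_real, inner_smul_right, norm_smul, he, real_inner_comm, Real.norm_eq_abs,
      mul_one, sq_abs]
    ring
  have h2 : ‖w - e‖ ^ 2 = ‖w‖ ^ 2 - 2 * (⟪e, w⟫ : ℝ) + 1 := by
    rw [norm_sub_sq_real, he, real_inner_comm]; ring
  refine le_of_sq_le_sq ?_ (norm_nonneg _)
  rw [h1, h2]
  nlinarith [sq_nonneg ((⟪e, w⟫ : ℝ) - 1)]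

theorem exists_innerCone_of_mem [NeZero N] {Ω : Set (Eucl N)} (hΩ : IsOpen Ω) {p : Eucl N}
    (hp : p ∈ Ω) : ∃ e κ r ρ, 0 < ρ ∧ HasInnerCone Ω (Metric.closedBall p ρ) e κ r := by
  obtain ⟨ρ, hρ, hball⟩ := Metric.isOpen_iff.mp hΩ p hp
  refine ⟨EuclideanSpace.single 0 1, 1 / 4, ρ / 4, ρ / 4, by positivity, by simp, by norm_num,
    le_rfl, by positivity, fun x _ hxS t ht w hw => hball ?_⟩
  have hw' : ‖w‖ ≤ 2 := by
    have h1 : ‖w - EuclideanSpace.single 0 1‖ ≤ 1 / 4 := by simpa [dist_eq_norm] using hw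
    have := norm_le_norm_add_norm_sub' w (EuclideanSpace.single 0 1)
    rw [show ‖(EuclideanSpace.single 0 1 : Eucl N)‖ = 1 by simp] at this
    linarith
  have hx : dist x p ≤ ρ / 4 := hxS
  rw [Metric.mem_ball]
  calc dist (x + t • w) p ≤ dist (x + t • w) x + dist x p := dist_triangle _ _ _
    _ ≤ t * 2 + ρ / 4 := by
        rw [dist_self_add_left, norm_smul, Real.norm_eq_abs, abs_of_pos ht.1]
        gcongr
        exact ht.1.le
    _ < ρ := by linarith [ht.2]

theorem exists_innerCone_of_mem_frontier {Ω : Set (Eucl N)}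
    (hΩ : IsBoundedLipschitzDomain Ω) {p : Eucl N} (hp : p ∈ frontier Ω) :
    ∃ e κ r ρ, 0 < ρ ∧ HasInnerCone Ω (Metric.closedBall p ρ) e κ r := by
  obtain ⟨e, γ, K, he, hγ, hloc⟩ := hΩ.lipschitz_boundary p hp
  obtain ⟨ρ, hρ, hball⟩ := Metric.eventually_nhds_iff_ball.mp hloc
  have hK : (0 : ℝ) ≤ K := K.2
  -- With this opening a move by t w shifts the horizontal part by at most t/(4(K+1)), so the graph
  -- rises by at most t/4, while the height grows by at least 3t/4. Since ‖w‖ ≤ 2, the radii ρ/4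
  -- keep the moved point in the ball where the graph description holds.
  refine ⟨e, 1 / (4 * (K + 1)), ρ / 4, ρ / 4, by positivity, he, by positivity, ?_, by positivity,
    fun x hx hxS t ht w hw => ?_⟩
  · rw [div_le_div_iff₀ (by positivity) (by positivity)]; linarith
  have hκ : ‖w - e‖ ≤ 1 / (4 * (K + 1)) := by simpa [dist_eq_norm] using hw
  have hκ4 : 1 / (4 * ((K : ℝ) + 1)) ≤ 1 / 4 := by
    rw [div_le_div_iff₀ (by positivity) (by positivity)]; linarith
  have hw' : ‖w‖ ≤ 2 := by
    have := norm_le_norm_add_norm_sub' w e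
    rw [he] at this
    linarith
  have hxd : dist x p ≤ ρ / 4 := hxS
  have hxt : x + t • w ∈ Metric.ball p ρ := by
    rw [Metric.mem_ball]
    calc dist (x + t • w) p ≤ dist (x + t • w) x + dist x p := dist_triangle _ _ _
      _ ≤ t * 2 + ρ / 4 := by
          rw [dist_self_add_left, norm_smul, Real.norm_eq_abs, abs_of_pos ht.1]
          gcongr
          exact ht.1.le
      _ < ρ := by linarith [ht.2]
  rw [hball _ hxt]
  have hx1 := (hball x (by rw [Metric.mem_ball]; linarith)).mp hx
  have hlip := hγ.dist_le_mul (x + t • w - (⟪e, x + t • w⟫ : ℝ) • e) (x - (⟪e, x⟫ : ℝ) • e)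
  have hdiff : x + t • w - (⟪e, x + t • w⟫ : ℝ) • e - (x - (⟪e, x⟫ : ℝ) • e)
      = t • (w - (⟪e, w⟫ : ℝ) • e) := by
    rw [inner_add_right, inner_smul_right]
    module
  rw [Real.dist_eq, dist_eq_norm, hdiff, norm_smul, Real.norm_eq_abs, abs_of_pos ht.1] at hlip
  have h1 : (K : ℝ) * (t * ‖w - (⟪e, w⟫ : ℝ) • e‖) ≤ t * (1 / 4) := by
    have h2 : (K : ℝ) * ‖w - (⟪e, w⟫ : ℝ) • e‖ ≤ 1 / 4 := by
      calc _ ≤ (K : ℝ) * (1 / (4 * (K + 1))) := by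
            gcongr; exact (norm_sub_inner_smul_le he w).trans hκ
        _ ≤ 1 / 4 := by
            rw [mul_one_div, div_le_div_iff₀ (by positivity) (by positivity)]; linarith
    calc _ = t * ((K : ℝ) * ‖w - (⟪e, w⟫ : ℝ) • e‖) := by ring
      _ ≤ _ := by gcongr; exact ht.1.le
  have h3 : 3 / 4 ≤ (⟪e, w⟫ : ℝ) := by
    have h4 : (⟪e, w⟫ : ℝ) = 1 + ⟪e, w - e⟫ := by
      rw [inner_sub_right, real_inner_self_eq_norm_sq, he]; ring
    have h5 := abs_le.mp (abs_real_inner_le_norm e (w - e))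
    rw [he] at h5
    linarith
  rw [inner_add_right, inner_smul_right] at *
  have h6 := (abs_le.mp hlip).2
  nlinarith [ht.1]

theorem exists_innerCone [NeZero N] {Ω : Set (Eucl N)} (hΩ : IsBoundedLipschitzDomain Ω)
    {p : Eucl N} (hp : p ∈ closure Ω) :
    ∃ e κ r ρ, 0 < ρ ∧ HasInnerCone Ω (Metric.closedBall p ρ) e κ r := by
  by_cases h : p ∈ Ω
  · exact exists_innerCone_of_mem hΩ.isOpen h
  · refine exists_innerCone_of_mem_frontier hΩ ?_
    rw [hΩ.isOpen.frontier_eq]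
    exact ⟨hp, h⟩

theorem HasInnerCone.mono {Ω S S' : Set (Eucl N)} {e : Eucl N} {κ r : ℝ}
    (h : HasInnerCone Ω S e κ r) (hS : S' ⊆ S) : HasInnerCone Ω S' e κ r :=
  ⟨h.1, h.2, h.3, h.4, fun x hx hxS => h.5 x hx (hS hxS)⟩

/-- A smooth partition of unity on a bounded Lipschitz domain each of whose members is supported
in a set satisfying a uniform inner cone condition. -/
theorem exists_conePartition [NeZero N] {Ω : Set (Eucl N)} (hΩ : IsBoundedLipschitzDomain Ω) :
    ∃ (m : ℕ) (ψ : Fin m → Eucl N → ℝ) (e : Fin m → Eucl N) (κ r : Fin m → ℝ),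
      (∀ i, ContDiff ℝ ∞ (ψ i) ∧ HasCompactSupport (ψ i) ∧ (∀ x, 0 ≤ ψ i x ∧ ψ i x ≤ 1) ∧
        HasInnerCone Ω (tsupport (ψ i)) (e i) (κ i) (r i)) ∧ ∀ x ∈ Ω, ∑ i, ψ i x = 1 := by
  choose! e κ r ρ hρ hcone using fun p (hp : p ∈ closure Ω) => exists_innerCone hΩ hp
  have hcpt : IsCompact (closure Ω) := hΩ.isBounded.isCompact_closure
  obtain ⟨t, htΩ, hcov⟩ := hcpt.elim_nhds_subcover (fun p => Metric.ball p (ρ p / 2))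
    fun p hp => Metric.ball_mem_nhds _ (half_pos (hρ p hp))
  set q : Fin t.card → Eucl N := fun i => t.equivFin.symm i with hq
  have hqt : ∀ i, q i ∈ closure Ω := fun i => htΩ _ (t.equivFin.symm i).2
  have hρq : ∀ i, 0 < ρ (q i) := fun i => hρ _ (hqt i)
  let f : ∀ i, ContDiffBump (q i) := fun i => ⟨ρ (q i) / 2, ρ (q i), half_pos (hρq i),
    half_lt_self (hρq i)⟩
  have hts : ∀ i, tsupport (fun x => f i x * ∏ j with j < i, (1 - f j x)) ⊆ tsupport (f i) :=
    fun i => tsupport_mul_subset_left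
  refine ⟨t.card, fun i x => f i x * ∏ j with j < i, (1 - f j x), fun i => e (q i),
    fun i => κ (q i), fun i => r (q i), fun i => ⟨?_, ?_, ?_, ?_⟩, ?_⟩
  · exact (f i).contDiff.mul (contDiff_prod fun j _ => contDiff_const.sub (f j).contDiff)
  · exact (f i).hasCompactSupport.mul_right
  · intro x
    have h0 : ∀ j, 0 ≤ 1 - f j x := fun j => sub_nonneg.mpr (f j).le_one
    have h1 : ∀ j, 1 - f j x ≤ 1 := fun j => sub_le_self _ (f j).nonneg
    exact ⟨mul_nonneg (f i).nonneg (Finset.prod_nonneg fun j _ => h0 j),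
      mul_le_one₀ (f i).le_one (Finset.prod_nonneg fun j _ => h0 j)
        (Finset.prod_le_one (fun j _ => h0 j) fun j _ => h1 j)⟩
  · refine (hcone _ (hqt i)).mono ((hts i).trans ?_)
    rw [(f i).tsupport_eq]
  -- The ordered products telescope: their sum is 1 minus the product of all 1 - f i, and some f i
  -- equals 1 at each point of Ω.
  · intro x hx
    have h1 := Finset.prod_one_sub_ordered Finset.univ fun i => f i x
    obtain ⟨p, hpt, hxp⟩ := mem_iUnion₂.mp (hcov (subset_closure hx))
    have h2 : ∏ i, (1 - f i x) = 0 := by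
      refine Finset.prod_eq_zero (Finset.mem_univ (t.equivFin ⟨p, hpt⟩)) ?_
      have hqp : q (t.equivFin ⟨p, hpt⟩) = p := by simp [hq]
      rw [sub_eq_zero, eq_comm]
      apply (f _).one_of_mem_closedBall
      simp only [f]
      rw [hqp]
      exact Metric.ball_subset_closedBall hxp
    rw [h2] at h1
    linarith

open scoped Pointwise in
/-- The boundary of a bounded Lipschitz domain is a null set. -/
theorem volume_frontier_eq_zero {Ω : Set (Eucl N)} (hΩ : IsBoundedLipschitzDomain Ω) :
    volume (frontier Ω) = 0 := by
  refine measure_null_of_locally_null _ fun p hp => ?_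
  obtain ⟨e, κ, r, ρ, hρ, hcone⟩ := exists_innerCone_of_mem_frontier hΩ hp
  refine ⟨frontier Ω ∩ Metric.ball p ρ, inter_mem_nhdsWithin _ (Metric.ball_mem_nhds p hρ), ?_⟩
  have hee : e ∈ Metric.ball e κ := Metric.mem_ball_self hcone.pos
  -- A boundary point is moved strictly inside: x + t e equals y + t w for a nearby y ∈ Ω and a
  -- direction w still in the open cone about e.
  have hmove : ∀ x ∈ frontier Ω ∩ Metric.ball p ρ, ∀ t ∈ Ioo 0 r, x + t • e ∈ Ω := by
    rintro x ⟨hx, hxp⟩ t ht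
    have hx' : x ∈ closure Ω := hx.1
    have hev : ∀ᶠ y in 𝓝 x, y ∈ Metric.ball p ρ ∧ t⁻¹ • (x + t • e - y) ∈ Metric.ball e κ := by
      refine Filter.Eventually.and (Metric.isOpen_ball.mem_nhds hxp) ?_
      have hc : ContinuousAt (fun y => t⁻¹ • (x + t • e - y)) x := by fun_prop
      apply hc.preimage_mem_nhds
      simp only [add_sub_cancel_left, inv_smul_smul₀ ht.1.ne']
      exact Metric.isOpen_ball.mem_nhds hee
    obtain ⟨y, hyΩ, hyp, hyc⟩ := (mem_closure_iff_frequently.mp hx').and_eventually hev |>.exists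
    have := hcone.mem y hyΩ (Metric.ball_subset_closedBall hyp) t ht _
      (Metric.ball_subset_closedBall hyc)
    rwa [smul_inv_smul₀ ht.1.ne', add_sub_cancel] at this
  have hτ : ∀ n : ℕ, 0 < r / (n + 2) ∧ r / (n + 2) < r := fun n => by
    have := hcone.rpos
    refine ⟨by positivity, div_lt_self this ?_⟩
    have : (0 : ℝ) ≤ n := n.cast_nonneg
    linarith
  -- If two translates of the boundary piece by different multiples of e met, a boundary point would
  -- be an inward shift of another one and would lie in the open set Ω. Infinitely many disjoint
  -- translates by a bounded sequence force measure zero.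
  refine Measure.addHaar_eq_zero_of_disjoint_translates volume
    (fun n : ℕ => (r / (n + 2)) • e) ?_ ?_
    (isClosed_frontier.measurableSet.inter measurableSet_ball)
  · refine (Metric.isBounded_closedBall (x := (0 : Eucl N)) (r := r)).subset ?_
    rintro _ ⟨n, rfl⟩
    rw [mem_closedBall_zero_iff, norm_smul, hcone.norm_eq, mul_one, Real.norm_eq_abs,
      abs_of_pos (hτ n).1]
    exact (hτ n).2.le
  · have key : ∀ m n : ℕ, m < n → Disjoint
        (({(r / (m + 2)) • e} : Set (Eucl N)) + frontier Ω ∩ Metric.ball p ρ)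
        (({(r / (n + 2)) • e} : Set (Eucl N)) + frontier Ω ∩ Metric.ball p ρ) := by
      intro m n hmn
      rw [Set.disjoint_left]
      rintro z hz hz'
      rw [singleton_add] at hz hz'
      obtain ⟨x, hx, rfl⟩ := hz
      obtain ⟨y, hy, hxy⟩ := hz'
      simp only at hxy
      have hlt : r / (n + 2) < r / (m + 2) := by
        have := hcone.rpos
        have : (m : ℝ) < n := by exact_mod_cast hmn
        gcongr
      have hyx : y = x + (r / (m + 2) - r / (n + 2)) • e := by
        rw [sub_smul, ← add_sub_assoc, eq_sub_iff_add_eq, add_comm y, hxy, add_comm]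
      have h1 := hmove x hx (r / (m + 2) - r / (n + 2)) ⟨by linarith, by linarith [(hτ m).2, (hτ n).1]⟩
      rw [← hyx] at h1
      have h2 := hy.1
      rw [hΩ.isOpen.frontier_eq] at h2
      exact h2.2 h1
    intro m n hmn
    rcases lt_or_gt_of_ne hmn with h | h
    · exact key m n h
    · exact (key n m h).symm

end Geometry

/-! ### Increments -/

section Increments

variable {N : ℕ}

/-- The squared `L²` norm of the increment `u(x + z) - u(x)` over the `x ∈ Ω` with `x + z ∈ Ω`. -/
def incr (Ω : Set (Eucl N)) (u : Eucl N → ℝ) (z : Eucl N) : ℝ≥0∞ :=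
  ∫⁻ x in Ω ∩ (fun x => x + z) ⁻¹' Ω, ENNReal.ofReal ((u (x + z) - u x) ^ 2)

theorem gagliardoSq_congr {Ω : Set (Eucl N)} {s : ℝ} {u v : Eucl N → ℝ} (h : u =ᵐ[volume] v) :
    gagliardoSq Ω s u = gagliardoSq Ω s v := by
  refine lintegral_congr_ae (ae_restrict_of_ae ?_)
  have h1 : ∀ᵐ p : Eucl N × Eucl N, u p.1 = v p.1 := Measure.quasiMeasurePreserving_fst.ae h
  have h2 : ∀ᵐ p : Eucl N × Eucl N, u p.2 = v p.2 := Measure.quasiMeasurePreserving_snd.ae h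
  filter_upwards [h1, h2] with p hp1 hp2
  rw [hp1, hp2]

theorem incr_congr {Ω : Set (Eucl N)} {u v : Eucl N → ℝ} (h : u =ᵐ[volume] v) (z : Eucl N) :
    incr Ω u z = incr Ω v z := by
  refine lintegral_congr_ae (ae_restrict_of_ae ?_)
  have h1 : ∀ᵐ x : Eucl N, u (x + z) = v (x + z) :=
    (measurePreserving_add_right volume z).quasiMeasurePreserving.ae h
  filter_upwards [h, h1] with x hx hx1
  rw [hx, hx1]

theorem prod_subset_interactionSet (Ω : Set (Eucl N)) : Ω ×ˢ Ω ⊆ interactionSet Ω := by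
  rintro p ⟨hp1, -⟩ ⟨h1, -⟩
  exact h1 (subset_closure hp1)

/-- The substitution y = x + z turns the left side into the Gagliardo integral over Ω × Ω, a part of
the interaction set. -/
theorem lintegral_kern_mul_incr_le {Ω : Set (Eucl N)} (hΩ : IsOpen Ω) (s : ℝ) {u : Eucl N → ℝ}
    (hu : AEMeasurable u volume) :
    ∫⁻ z, ENNReal.ofReal (kern s z) * incr Ω u z ≤ gagliardoSq Ω s u := by
  wlog hm : Measurable u generalizing u
  · have := this hu.measurable_mk.aemeasurable hu.measurable_mk
    rw [gagliardoSq_congr hu.ae_eq_mk]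
    simpa only [incr_congr hu.ae_eq_mk] using this
  set G : Eucl N × Eucl N → ℝ≥0∞ := fun p =>
    ENNReal.ofReal ((u p.1 - u p.2) ^ 2 / ‖p.1 - p.2‖ ^ ((N : ℝ) + 2 * s)) with hG
  have hGm : Measurable G := by
    have h1 : Measurable fun p : Eucl N × Eucl N => u p.1 := hm.comp measurable_fst
    have h2 : Measurable fun p : Eucl N × Eucl N => u p.2 := hm.comp measurable_snd
    simp only [hG]
    fun_prop
  have hΩm := hΩ.measurableSet
  have hGi : Measurable (indicator (Ω ×ˢ Ω) G) := hGm.indicator (hΩm.prod hΩm)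
  calc ∫⁻ z, ENNReal.ofReal (kern s z) * incr Ω u z
      = ∫⁻ z, ∫⁻ x, indicator (Ω ×ˢ Ω) G (x, x + z) := by
        refine lintegral_congr fun z => ?_
        have hDm : MeasurableSet (Ω ∩ (fun x => x + z) ⁻¹' Ω) :=
          hΩm.inter ((measurable_add_const z) hΩm)
        rw [incr, ← lintegral_indicator hDm,
          ← lintegral_const_mul' _ _ ENNReal.ofReal_ne_top]
        refine lintegral_congr fun x => ?_
        by_cases hx : x ∈ Ω ∩ (fun x => x + z) ⁻¹' Ω
        · have hx' : (x, x + z) ∈ Ω ×ˢ Ω := ⟨hx.1, hx.2⟩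
          rw [indicator_of_mem hx, indicator_of_mem hx', ← ENNReal.ofReal_mul (kern_nonneg s z), hG]
          simp only [sub_add_cancel_left, norm_neg, kern]
          congr 1
          rw [div_eq_inv_mul]
          ring
        · have hx' : (x, x + z) ∉ Ω ×ˢ Ω := fun h => hx ⟨h.1, h.2⟩
          rw [indicator_of_notMem hx, indicator_of_notMem hx', mul_zero]
    _ = ∫⁻ x, ∫⁻ z, indicator (Ω ×ˢ Ω) G (x, x + z) := by
        refine lintegral_lintegral_swap (Measurable.aemeasurable ?_)
        exact hGi.comp (by fun_prop : Measurable fun p : Eucl N × Eucl N => (p.2, p.2 + p.1))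
    _ = ∫⁻ x, ∫⁻ y, indicator (Ω ×ˢ Ω) G (x, y) := by
        refine lintegral_congr fun x => ?_
        exact lintegral_add_left_eq_self (fun y => indicator (Ω ×ˢ Ω) G (x, y)) x
    _ = ∫⁻ p, indicator (Ω ×ˢ Ω) G p := (lintegral_prod _ hGi.aemeasurable).symm
    _ = ∫⁻ p in Ω ×ˢ Ω, G p := lintegral_indicator (hΩm.prod hΩm) _
    _ ≤ gagliardoSq Ω s u := lintegral_mono_set (prod_subset_interactionSet Ω)

theorem sq_sub_le_telescope (f : ℕ → ℝ) (m : ℕ) :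
    (f m - f 0) ^ 2 ≤ m * ∑ i ∈ Finset.range m, (f (i + 1) - f i) ^ 2 := by
  rw [← Finset.sum_range_sub]
  simpa using sq_sum_le_card_mul_sum_sq (s := Finset.range m) (f := fun i => f (i + 1) - f i)

/-- Along a cone, increments at scale `1` are controlled by increments at scale `1 / m`. -/
theorem HasInnerCone.lintegral_increment_le {Ω S : Set (Eucl N)} {e : Eucl N} {κ r : ℝ}
    (h : HasInnerCone Ω S e κ r) (hΩ : IsOpen Ω) (hS : MeasurableSet S) {u : Eucl N → ℝ}
    (hu : Measurable u) {t : ℝ} (ht : t ∈ Ioo 0 r) {w : Eucl N} (hw : w ∈ Metric.closedBall e κ)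
    {m : ℕ} (hm : 0 < m) :
    ∫⁻ x in Ω ∩ S, ENNReal.ofReal ((u (x + t • w) - u x) ^ 2)
      ≤ (m : ℝ≥0∞) ^ 2 * incr Ω u ((m : ℝ)⁻¹ • t • w) := by
  have hΩm := hΩ.measurableSet
  have hm' : (0 : ℝ) < m := by exact_mod_cast hm
  set z := (m : ℝ)⁻¹ • t • w with hz
  set D := Ω ∩ (fun x => x + z) ⁻¹' Ω with hD
  have hDm : MeasurableSet D := hΩm.inter ((measurable_add_const z) hΩm)
  have hin : ∀ x ∈ Ω ∩ S, ∀ i ≤ m, x + (i : ℝ) • z ∈ Ω := by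
    intro x hx i hi
    rcases Nat.eq_zero_or_pos i with rfl | hi0
    · simpa using hx.1
    have : (i : ℝ) • z = (i * (m : ℝ)⁻¹ * t) • w := by rw [hz, smul_smul, smul_smul, mul_assoc]
    rw [this]
    have hi0' : (0 : ℝ) < i := by exact_mod_cast hi0
    refine h.mem x hx.1 hx.2 _ ⟨by have := ht.1; positivity, lt_of_le_of_lt ?_ ht.2⟩ w hw
    refine mul_le_of_le_one_left ht.1.le ?_
    rw [← div_eq_mul_inv, div_le_one hm']
    exact_mod_cast hi
  set g : Eucl N → ℝ≥0∞ := indicator D fun y => ENNReal.ofReal ((u (y + z) - u y) ^ 2) with hg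
  have hgm : Measurable g := by
    refine Measurable.indicator ?_ hDm
    have : Measurable fun y => u (y + z) := hu.comp (measurable_add_const z)
    fun_prop
  -- The increment is split into m steps of length z, all inside Ω. Cauchy–Schwarz costs one factor
  -- m, and the sum of m translated copies of the same integral costs the other.
  calc ∫⁻ x in Ω ∩ S, ENNReal.ofReal ((u (x + t • w) - u x) ^ 2)
      ≤ ∫⁻ x in Ω ∩ S, (m : ℝ≥0∞) * ∑ i ∈ Finset.range m, g (x + (i : ℝ) • z) := by
        refine setLIntegral_mono' (hΩm.inter hS) fun x hx => ?_
        have h1 := sq_sub_le_telescope (fun i => u (x + (i : ℝ) • z)) m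
        have h2 : x + (m : ℝ) • z = x + t • w := by
          rw [hz, smul_smul, mul_inv_cancel₀ hm'.ne', one_smul]
        simp only [h2, Nat.cast_zero, zero_smul, add_zero] at h1
        refine (ENNReal.ofReal_le_ofReal h1).trans ?_
        rw [ENNReal.ofReal_mul hm'.le, ENNReal.ofReal_natCast,
          ENNReal.ofReal_sum_of_nonneg fun i _ => sq_nonneg _]
        gcongr with i hi
        have hi' := Finset.mem_range.mp hi
        have h3 : x + ((i + 1 : ℕ) : ℝ) • z = x + (i : ℝ) • z + z := by
          push_cast; rw [add_smul, one_smul, add_assoc]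
        have hmem : x + (i : ℝ) • z ∈ D := ⟨hin x hx i hi'.le, by
          rw [mem_preimage, ← h3]; exact hin x hx (i + 1) hi'⟩
        rw [hg, indicator_of_mem hmem, h3]
    _ ≤ ∫⁻ x, (m : ℝ≥0∞) * ∑ i ∈ Finset.range m, g (x + (i : ℝ) • z) :=
        setLIntegral_le_lintegral _ _
    _ = m * ∑ i ∈ Finset.range m, ∫⁻ x, g (x + (i : ℝ) • z) := by
        rw [lintegral_const_mul' _ _ (ENNReal.natCast_ne_top m), lintegral_finsetSum]
        intro i _
        exact hgm.comp (measurable_add_const _)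
    _ = m * ∑ i ∈ Finset.range m, incr Ω u z := by
        congr 1
        refine Finset.sum_congr rfl fun i _ => ?_
        rw [lintegral_add_right_eq_self g, hg, lintegral_indicator hDm]
        rfl
    _ = (m : ℝ≥0∞) ^ 2 * incr Ω u z := by
        rw [Finset.sum_const, Finset.card_range, nsmul_eq_mul, sq, mul_assoc]

theorem measurable_incr {Ω : Set (Eucl N)} (hΩ : IsOpen Ω) {u : Eucl N → ℝ} (hu : Measurable u) :
    Measurable (incr Ω u) := by
  have hΩm := hΩ.measurableSet
  have h0 : incr Ω u = fun z => ∫⁻ x, indicator {p : Eucl N × Eucl N | p.1 ∈ Ω ∧ p.1 + p.2 ∈ Ω}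
      (fun p => ENNReal.ofReal ((u (p.1 + p.2) - u p.1) ^ 2)) (x, z) := by
    ext z
    have hDm : MeasurableSet (Ω ∩ (fun x => x + z) ⁻¹' Ω) :=
      hΩm.inter ((measurable_add_const z) hΩm)
    rw [incr, ← lintegral_indicator hDm]
    rfl
  rw [h0]
  refine Measurable.lintegral_prod_left' ?_
  refine Measurable.indicator ?_ ((measurable_fst hΩm).inter ((measurable_fst.add measurable_snd) hΩm))
  have h1 : Measurable fun p : Eucl N × Eucl N => u (p.1 + p.2) :=
    hu.comp (measurable_fst.add measurable_snd)
  have h2 : Measurable fun p : Eucl N × Eucl N => u p.1 := hu.comp measurable_fst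
  fun_prop

theorem lintegral_comp_smul_ball {f : Eucl N → ℝ≥0∞} {a : ℝ} (ha : 0 < a) (hf : Measurable f)
    (c : Eucl N) (ρ : ℝ) :
    ∫⁻ z in Metric.ball c ρ, f (a • z)
      = ENNReal.ofReal (a⁻¹ ^ N) * ∫⁻ z in Metric.ball (a • c) (a * ρ), f z := by
  have h1 := Measure.map_addHaar_smul (volume : Measure (Eucl N)) ha.ne'
  have hpre : (fun z : Eucl N => a • z) ⁻¹' Metric.ball (a • c) (a * ρ) = Metric.ball c ρ := by
    ext z
    simp only [mem_preimage, Metric.mem_ball, dist_smul₀, Real.norm_eq_abs, abs_of_pos ha]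
    exact mul_lt_mul_iff_right₀ ha
  rw [← hpre, ← setLIntegral_map measurableSet_ball hf (measurable_const_smul a)]
  rw [show (fun z : Eucl N => a • z) = (a • ·) from rfl, h1, Measure.restrict_smul,
    lintegral_smul_measure]
  simp [abs_of_pos ha]

theorem one_sub_two_rpow_le {x : ℝ} (hx : 0 ≤ x) : 1 - (2 : ℝ) ^ (-x) ≤ x := by
  have h1 : (2 : ℝ) ^ (-x) = Real.exp (-(x * Real.log 2)) := by
    rw [Real.rpow_def_of_pos two_pos]; ring_nf
  have h2 := Real.add_one_le_exp (-(x * Real.log 2))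
  have h3 : Real.log 2 ≤ 1 := by linarith [Real.log_two_lt_d9]
  rw [h1]
  nlinarith

/-- The averaged increment over a cone piece at scale `t`, bounded by the fractional energy with
a constant that stays bounded as `s → 1`. -/
theorem HasInnerCone.lintegral_ball_increment_le {Ω S : Set (Eucl N)} {e : Eucl N} {κ r : ℝ}
    (h : HasInnerCone Ω S e κ r) (hΩ : IsOpen Ω) (hS : MeasurableSet S) {u : Eucl N → ℝ}
    (hu : Measurable u) {t : ℝ} (ht : t ∈ Ioo 0 r) {s : ℝ} (hs : s ∈ Ioo (1 / 2 : ℝ) 1) :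
    ∫⁻ z in Metric.ball (t • e) (t * κ), ∫⁻ x in Ω ∩ S, ENNReal.ofReal ((u (x + z) - u x) ^ 2)
      ≤ ENNReal.ofReal (2 * (1 - s) * (2 * t) ^ ((N : ℝ) + 2 * s)) * gagliardoSq Ω s u := by
  have ht0 := ht.1
  have hNs : 0 < (N : ℝ) + 2 * s := by have : (0 : ℝ) ≤ N := N.cast_nonneg; linarith [hs.1]
  set J := ∫⁻ z in Metric.ball (t • e) (t * κ), ∫⁻ x in Ω ∩ S,
    ENNReal.ofReal ((u (x + z) - u x) ^ 2) with hJ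
  set a : ℕ → ℝ := fun k => ((2 ^ k : ℕ) : ℝ)⁻¹ with ha
  have hapos : ∀ k, 0 < a k := fun k => by simp only [ha]; positivity
  have haeq : ∀ k, a k = (1 / 2) ^ k := fun k => by simp [ha]
  set A : ℕ → Set (Eucl N) := fun k => Metric.ball (a k • t • e) (a k * (t * κ)) with hA
  -- At scale 2^{-k} the loss is 4^k from splitting increments and 2^{kN} from rescaling the ball,
  -- while the kernel gains 2^{k(N+2s)}. The net factor is q^{-k}.
  set q : ℝ := 2 ^ (-(2 - 2 * s)) with hq
  have hincm := measurable_incr hΩ hu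
  have hnorm : ∀ k, ∀ z ∈ A k, ‖z‖ ≤ 5 / 4 * (a k * t) ∧ 3 / 4 * (a k * t) ≤ ‖z‖ := by
    intro k z hz
    have h1 : ‖z - a k • t • e‖ < a k * (t * κ) := by
      simpa [hA, dist_eq_norm] using hz
    have h2 : ‖a k • t • e‖ = a k * t := by
      rw [norm_smul, norm_smul, h.norm_eq, Real.norm_eq_abs, Real.norm_eq_abs,
        abs_of_pos (hapos k), abs_of_pos ht0, mul_one]
    have h3 : a k * (t * κ) ≤ a k * t * (1 / 4) := by
      rw [← mul_assoc]
      exact mul_le_mul_of_nonneg_left h.le (mul_pos (hapos k) ht0).le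
    have h4 := norm_le_norm_add_norm_sub' z (a k • t • e)
    have h5 := norm_le_norm_add_norm_sub' (a k • t • e) z
    rw [norm_sub_rev] at h5
    constructor <;> linarith
  have hstep : ∀ k, J * ENNReal.ofReal (q ^ k)
      ≤ ENNReal.ofReal ((2 * t) ^ ((N : ℝ) + 2 * s))
        * ∫⁻ z in A k, ENNReal.ofReal (kern s z) * incr Ω u z := by
    intro k
    have h1 : J ≤ ∫⁻ z in Metric.ball (t • e) (t * κ), ((2 ^ k : ℕ) : ℝ≥0∞) ^ 2 *
        incr Ω u (a k • z) := by
      refine setLIntegral_mono' measurableSet_ball fun z hz => ?_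
      have hzw : z = t • (t⁻¹ • z) := by rw [smul_inv_smul₀ ht0.ne']
      rw [hzw]
      refine h.lintegral_increment_le hΩ hS hu ht ?_ (by positivity)
      rw [Metric.mem_closedBall, dist_eq_norm]
      have h2 : t⁻¹ • z - e = t⁻¹ • (z - t • e) := by rw [smul_sub, inv_smul_smul₀ ht0.ne']
      rw [h2, norm_smul, norm_inv, Real.norm_eq_abs, abs_of_pos ht0, inv_mul_le_iff₀ ht0]
      exact (by simpa [dist_eq_norm] using hz : ‖z - t • e‖ < t * κ).le
    rw [lintegral_const_mul' _ _ (by simp), lintegral_comp_smul_ball (hapos k) hincm] at h1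
    have h2 : ∫⁻ z in A k, incr Ω u z ≤ ENNReal.ofReal ((2 * (a k * t)) ^ ((N : ℝ) + 2 * s)) *
        ∫⁻ z in A k, ENNReal.ofReal (kern s z) * incr Ω u z := by
      rw [← lintegral_const_mul' _ _ ENNReal.ofReal_ne_top]
      refine setLIntegral_mono' measurableSet_ball fun z hz => ?_
      rw [← mul_assoc, ← ENNReal.ofReal_mul (by have := hapos k; positivity)]
      refine le_mul_of_one_le_left zero_le ?_
      rw [ENNReal.one_le_ofReal, kern, ← div_eq_mul_inv]
      obtain ⟨h3, h4⟩ := hnorm k z hz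
      have h5 : 0 < a k * t := mul_pos (hapos k) ht0
      have h6 : 0 < ‖z‖ := by linarith
      rw [one_le_div (by positivity)]
      exact Real.rpow_le_rpow h6.le (by linarith) hNs.le
    calc J * ENNReal.ofReal (q ^ k)
        ≤ (((2 ^ k : ℕ) : ℝ≥0∞) ^ 2 * (ENNReal.ofReal ((a k)⁻¹ ^ N) *
            (ENNReal.ofReal ((2 * (a k * t)) ^ ((N : ℝ) + 2 * s)) *
          ∫⁻ z in A k, ENNReal.ofReal (kern s z) * incr Ω u z))) * ENNReal.ofReal (q ^ k) := by
          gcongr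
          exact h1.trans (by gcongr)
      _ = ENNReal.ofReal (((2 ^ k : ℕ) : ℝ) ^ 2 * (a k)⁻¹ ^ N *
            (2 * (a k * t)) ^ ((N : ℝ) + 2 * s) * q ^ k) *
          ∫⁻ z in A k, ENNReal.ofReal (kern s z) * incr Ω u z := by
          have := hapos k
          rw [ENNReal.ofReal_mul (by positivity), ENNReal.ofReal_mul (by positivity),
            ENNReal.ofReal_mul (by positivity), ENNReal.ofReal_pow (Nat.cast_nonneg _),
            ENNReal.ofReal_natCast]
          ring
      _ = _ := by
          congr 2
          have h2t : 0 < 2 * t := by linarith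
          have e1 : 2 * (a k * t) = a k * (2 * t) := by ring
          rw [e1, Real.mul_rpow (hapos k).le h2t.le]
          have e2 : a k = 2 ^ (-(k : ℝ)) := by
            rw [haeq, Real.rpow_neg two_pos.le, Real.rpow_natCast]; simp
          have e3 : ((2 ^ k : ℕ) : ℝ) = 2 ^ (k : ℝ) := by rw [Real.rpow_natCast]; simp
          have e4 : ((2 ^ k : ℕ) : ℝ) ^ 2 * (a k)⁻¹ ^ N * (a k) ^ ((N : ℝ) + 2 * s) * q ^ k = 1 := by
            rw [e2, e3, ← Real.rpow_neg two_pos.le, neg_neg, ← Real.rpow_natCast, ← Real.rpow_natCast,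
              ← Real.rpow_natCast, hq, ← Real.rpow_mul two_pos.le, ← Real.rpow_mul two_pos.le,
              ← Real.rpow_mul two_pos.le, ← Real.rpow_mul two_pos.le, ← Real.rpow_add two_pos,
              ← Real.rpow_add two_pos, ← Real.rpow_add two_pos]
            convert Real.rpow_zero 2 using 2
            push_cast
            ring
          linear_combination (2 * t) ^ ((N : ℝ) + 2 * s) * e4
  -- The norms on A k lie between 3/4 and 5/4 of a k * t, and halving 5/4 already gives less than
  -- 3/4.
  have hdisj : Pairwise (Function.onFun Disjoint A) := by
    have key : ∀ j k, j < k → Disjoint (A j) (A k) := by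
      intro j k hjk
      rw [Set.disjoint_left]
      intro z hzj hzk
      have h1 := (hnorm j z hzj).2
      have h2 := (hnorm k z hzk).1
      have h3 : a k ≤ a j * (1 / 2) := by
        rw [haeq, haeq, ← pow_succ]
        exact pow_le_pow_of_le_one (by norm_num) (by norm_num) hjk
      nlinarith [mul_pos (hapos j) ht0, mul_pos (hapos k) ht0]
    intro j k hjk
    rcases lt_or_gt_of_ne hjk with h' | h'
    · exact key j k h'
    · exact (key k j h').symm
  have hq0 : 0 < q := by simp only [hq]; positivity
  have hq1 : q < 1 := by
    simp only [hq]
    exact Real.rpow_lt_one_of_one_lt_of_neg one_lt_two (by linarith [hs.2])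
  have hs1 : 0 < 2 * (1 - s) := by linarith [hs.2]
  -- This is the source of the factor 1 - s: the same J is bounded at every dyadic scale, and the
  -- weights q^k sum to 1/(1-q) ≥ 1/(2-2s), while the disjoint A k share a single energy.
  have hgeo : ENNReal.ofReal (2 * (1 - s))⁻¹ ≤ ∑' k : ℕ, ENNReal.ofReal (q ^ k) := by
    rw [← ENNReal.ofReal_tsum_of_nonneg (fun k => by positivity)
      (summable_geometric_of_lt_one hq0.le hq1), tsum_geometric_of_lt_one hq0.le hq1]
    apply ENNReal.ofReal_le_ofReal
    have := one_sub_two_rpow_le (x := 2 - 2 * s) (by linarith [hs.2])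
    exact inv_anti₀ (by linarith) (by rw [hq]; linarith)
  have hsum : J * ENNReal.ofReal (2 * (1 - s))⁻¹
      ≤ ENNReal.ofReal ((2 * t) ^ ((N : ℝ) + 2 * s)) * gagliardoSq Ω s u := by
    calc _ ≤ J * ∑' k : ℕ, ENNReal.ofReal (q ^ k) := by gcongr
      _ = ∑' k : ℕ, J * ENNReal.ofReal (q ^ k) := ENNReal.tsum_mul_left.symm
      _ ≤ ∑' k, ENNReal.ofReal ((2 * t) ^ ((N : ℝ) + 2 * s))
        * ∫⁻ z in A k, ENNReal.ofReal (kern s z) * incr Ω u z := ENNReal.tsum_le_tsum hstep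
      _ = ENNReal.ofReal ((2 * t) ^ ((N : ℝ) + 2 * s))
        * ∫⁻ z in ⋃ k, A k, ENNReal.ofReal (kern s z) * incr Ω u z := by
          rw [ENNReal.tsum_mul_left, lintegral_iUnion (fun k => measurableSet_ball) hdisj]
      _ ≤ _ := by
          gcongr
          exact (setLIntegral_le_lintegral _ _).trans
            (lintegral_kern_mul_incr_le hΩ s hu.aemeasurable)
  calc J = ENNReal.ofReal (2 * (1 - s)) * (J * ENNReal.ofReal (2 * (1 - s))⁻¹) := by
        rw [mul_comm J, ← mul_assoc, ← ENNReal.ofReal_mul hs1.le, mul_inv_cancel₀ hs1.ne',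
          ENNReal.ofReal_one, one_mul]
    _ ≤ ENNReal.ofReal (2 * (1 - s)) *
        (ENNReal.ofReal ((2 * t) ^ ((N : ℝ) + 2 * s)) * gagliardoSq Ω s u) := by gcongr
    _ = _ := by rw [← mul_assoc, ← ENNReal.ofReal_mul hs1.le]

end Increments

/-! ### Mollification and compactness -/

section LTwo

variable {α : Type*} [MeasurableSpace α] {μ : Measure α}

theorem eLpNorm_two_sq (f : α → ℝ) :
    eLpNorm f 2 μ ^ 2 = ∫⁻ x, ENNReal.ofReal (f x ^ 2) ∂μ := by
  rw [eLpNorm_eq_lintegral_rpow_enorm_toReal two_ne_zero ENNReal.ofNat_ne_top]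
  simp only [ENNReal.toReal_ofNat, ENNReal.rpow_ofNat]
  rw [← ENNReal.rpow_natCast, ← ENNReal.rpow_mul]
  norm_num
  refine lintegral_congr fun x => ?_
  rw [← ofReal_norm, ← ENNReal.ofReal_pow (norm_nonneg _), Real.norm_eq_abs, sq_abs]

theorem lintegral_sq_eq_ofReal_integral {f : α → ℝ} (hf : MemLp f 2 μ) :
    ∫⁻ x, ENNReal.ofReal (f x ^ 2) ∂μ = ENNReal.ofReal (∫ x, f x ^ 2 ∂μ) :=
  (ofReal_integral_eq_lintegral_ofReal hf.integrable_sq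
    (Eventually.of_forall fun _ => sq_nonneg _)).symm

/-- Jensen's inequality for the weight a, by Cauchy–Schwarz applied to the square roots of a and of
a f². -/
theorem sq_lintegral_mul_le {a f : α → ℝ≥0∞} (ha : AEMeasurable a μ) (hf : AEMeasurable f μ)
    (h1 : ∫⁻ x, a x ∂μ ≤ 1) :
    (∫⁻ x, a x * f x ∂μ) ^ 2 ≤ ∫⁻ x, a x * f x ^ 2 ∂μ := by
  have h := ENNReal.lintegral_mul_norm_pow_le ha (ha.mul (hf.pow_const 2))
    (p := 1 / 2) (q := 1 / 2) (by norm_num) (by norm_num) (by norm_num)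
  have h2 : ∀ x, a x ^ (1 / 2 : ℝ) * (a x * f x ^ 2) ^ (1 / 2 : ℝ) = a x * f x := by
    intro x
    rw [ENNReal.mul_rpow_of_nonneg _ _ (by norm_num), ← mul_assoc,
      ← ENNReal.rpow_add_of_nonneg _ _ (by norm_num) (by norm_num), ← ENNReal.rpow_natCast,
      ← ENNReal.rpow_mul]
    norm_num
  simp only [Pi.mul_apply, h2] at h
  calc (∫⁻ x, a x * f x ∂μ) ^ 2
      ≤ ((∫⁻ x, a x ∂μ) ^ (1 / 2 : ℝ) * (∫⁻ x, a x * f x ^ 2 ∂μ) ^ (1 / 2 : ℝ)) ^ 2 := by gcongr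
    _ = (∫⁻ x, a x ∂μ) * ∫⁻ x, a x * f x ^ 2 ∂μ := by
        rw [mul_pow, ← ENNReal.rpow_natCast, ← ENNReal.rpow_natCast, ← ENNReal.rpow_mul,
          ← ENNReal.rpow_mul]
        norm_num
    _ ≤ 1 * ∫⁻ x, a x * f x ^ 2 ∂μ := by gcongr
    _ = _ := one_mul _

/-- Sequential Banach–Alaoglu in the dual of a separable space, carried back through the Riesz
isometry. -/
theorem exists_weakly_convergent_subseq {H : Type*} [NormedAddCommGroup H] [InnerProductSpace ℝ H]
    [CompleteSpace H] [TopologicalSpace.SeparableSpace H] (u : ℕ → H) (C : ℝ)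
    (hu : ∀ k, ‖u k‖ ≤ C) :
    ∃ φ : ℕ → ℕ, StrictMono φ ∧ ∃ v, ∀ f, Tendsto (fun k => (⟪f, u (φ k)⟫ : ℝ)) atTop (𝓝 ⟪f, v⟫) := by
  have hseq := WeakDual.isSeqCompact_closedBall ℝ H 0 C
  obtain ⟨v, -, φ, hφ, hv⟩ := hseq
    (x := fun k => StrongDual.toWeakDual (InnerProductSpace.toDual ℝ H (u k)))
    (fun k => by
      simp only [mem_preimage, mem_closedBall_zero_iff]
      exact ((InnerProductSpace.toDual ℝ H).norm_map (u k)).trans_le (hu k))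
  refine ⟨φ, hφ, (InnerProductSpace.toDual ℝ H).symm (WeakDual.toStrongDual v), fun f => ?_⟩
  have h1 := ((WeakDual.eval_continuous f).tendsto v).comp hv
  rw [real_inner_comm, InnerProductSpace.toDual_symm_apply]
  refine h1.congr fun k => ?_
  simp only [Function.comp]
  rw [real_inner_comm]
  rfl

end LTwo

/-! ### Averages over cones and compactness uniform in s -/

section Mollification

variable {N : ℕ}

/-- The average `∫ η(z) v(x + z) dz`. -/
def mol (η v : Eucl N → ℝ) (x : Eucl N) : ℝ := ∫ z, η z * v (x + z)

theorem mol_eq_integral_sub (η v : Eucl N → ℝ) (x : Eucl N) : mol η v x = ∫ y, η (y - x) * v y := by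
  rw [mol, ← integral_add_left_eq_self (fun y => η (y - x) * v y) x]
  simp

theorem mol_congr {η v w : Eucl N → ℝ} (h : v =ᵐ[volume] w) (x : Eucl N) :
    mol η v x = mol η w x := by
  rw [mol_eq_integral_sub, mol_eq_integral_sub]
  refine integral_congr_ae ?_
  filter_upwards [h] with y hy
  rw [hy]

theorem memLp_comp_sub {η : Eucl N → ℝ} (hη : Continuous η) (hc : HasCompactSupport η) (x : Eucl N) :
    MemLp (fun y => η (y - x)) 2 volume :=
  (hη.memLp_of_hasCompactSupport hc).comp_measurePreserving (measurePreserving_sub_right volume x)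

theorem integrable_mol {η v : Eucl N → ℝ} (hη : Continuous η) (hc : HasCompactSupport η)
    (hv : MemLp v 2 volume) (x : Eucl N) : Integrable fun z => η z * v (x + z) := by
  have h1 : MemLp (fun z => v (x + z)) 2 volume :=
    hv.comp_measurePreserving (measurePreserving_add_left volume x)
  exact MemLp.integrable_mul (p := 2) (q := 2) (hη.memLp_of_hasCompactSupport hc) h1

theorem measurable_mol {η v : Eucl N → ℝ} (hη : Measurable η) (hv : Measurable v) :
    Measurable (mol η v) := by
  have : StronglyMeasurable (Function.uncurry fun x z : Eucl N => η z * v (x + z)) := by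
    have h1 : Measurable fun p : Eucl N × Eucl N => v (p.1 + p.2) :=
      hv.comp (measurable_fst.add measurable_snd)
    have h2 : Measurable fun p : Eucl N × Eucl N => η p.2 := hη.comp measurable_snd
    exact (h2.mul h1).stronglyMeasurable
  exact this.integral_prod_right.measurable

/-- Jensen's inequality for the error of an average. -/
theorem lintegral_mol_sub_sq_le {η v : Eucl N → ℝ} (hη : Continuous η) (hc : HasCompactSupport η)
    (h0 : ∀ z, 0 ≤ η z) (h1 : ∫ z, η z = 1) (hv : MemLp v 2 volume) (hvm : Measurable v)
    (A : Set (Eucl N)) :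
    ∫⁻ x in A, ENNReal.ofReal ((mol η v x - v x) ^ 2)
      ≤ ∫⁻ z, ENNReal.ofReal (η z) * ∫⁻ x in A, ENNReal.ofReal ((v (x + z) - v x) ^ 2) := by
  have hηi : Integrable η := hη.integrable_of_hasCompactSupport hc
  have h1' : ∫⁻ z, ENNReal.ofReal (η z) = 1 := by
    rw [← ofReal_integral_eq_lintegral_ofReal hηi (Eventually.of_forall h0), h1, ENNReal.ofReal_one]
  have hpm : Measurable fun p : Eucl N × Eucl N => v (p.1 + p.2) :=
    hvm.comp (measurable_fst.add measurable_snd)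
  have hp1 : Measurable fun p : Eucl N × Eucl N => v p.1 := hvm.comp measurable_fst
  have hp2 : Measurable fun p : Eucl N × Eucl N => η p.2 := hη.measurable.comp measurable_snd
  calc ∫⁻ x in A, ENNReal.ofReal ((mol η v x - v x) ^ 2)
      ≤ ∫⁻ x in A, ∫⁻ z, ENNReal.ofReal (η z) * ENNReal.ofReal ((v (x + z) - v x) ^ 2) := by
        refine lintegral_mono fun x => ?_
        have hd : mol η v x - v x = ∫ z, η z * (v (x + z) - v x) := by
          simp only [mul_sub]
          rw [integral_sub (integrable_mol hη hc hv x) (hηi.mul_const _), integral_mul_const, h1,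
            one_mul]
          rfl
        have hle : ‖mol η v x - v x‖ₑ ≤ ∫⁻ z, ENNReal.ofReal (η z) * ‖v (x + z) - v x‖ₑ := by
          rw [hd]
          refine (enorm_integral_le_lintegral_enorm _).trans (lintegral_mono fun z => ?_)
          rw [enorm_mul, Real.enorm_of_nonneg (h0 z)]
        have hsq : ∀ a : ℝ, ENNReal.ofReal (a ^ 2) = ‖a‖ₑ ^ 2 := fun a => by
          rw [← ofReal_norm, ← ENNReal.ofReal_pow (norm_nonneg _), Real.norm_eq_abs, sq_abs]
        simp only [hsq]
        have hxm : Measurable fun z => v (x + z) := hvm.comp (measurable_const_add x)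
        refine (pow_le_pow_left' hle 2).trans (sq_lintegral_mul_le ?_ ?_ h1'.le)
        · exact hη.measurable.ennreal_ofReal.aemeasurable
        · exact (hxm.sub_const _).enorm.aemeasurable
    _ = ∫⁻ z, ∫⁻ x in A, ENNReal.ofReal (η z) * ENNReal.ofReal ((v (x + z) - v x) ^ 2) := by
        refine lintegral_lintegral_swap (Measurable.aemeasurable ?_)
        simp only [Function.uncurry_def]
        fun_prop
    _ = _ := by
        refine lintegral_congr fun z => ?_
        rw [lintegral_const_mul' _ _ ENNReal.ofReal_ne_top]

/-- A bump function supported in the ball of radius `t κ` about `t e`. -/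
def coneBump (e : Eucl N) {κ t : ℝ} (hκ : 0 < κ) (ht : 0 < t) : ContDiffBump (t • e) :=
  ⟨t * κ / 2, t * κ, by positivity, half_lt_self (by positivity)⟩

theorem memLp_indicator_of_restrict {Ω : Set (Eucl N)} (hΩ : MeasurableSet Ω) {u : Eucl N → ℝ}
    (hu : MemLp u 2 (volume.restrict Ω)) : MemLp (Ω.indicator u) 2 volume :=
  (memLp_indicator_iff_restrict hΩ).mpr hu

/-- Quantitative approximation by averages over cones, uniform as `s → 1`. -/
theorem HasInnerCone.exists_mol_bound {Ω S : Set (Eucl N)} {e : Eucl N} {κ r : ℝ}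
    (h : HasInnerCone Ω S e κ r) (hΩ : IsOpen Ω) (hS : MeasurableSet S) :
    ∃ C : ℝ, 0 < C ∧ ∀ (t : ℝ) (ht : 0 < t), t < r → t ≤ 1 → ∀ s ∈ Ioo (1 / 2 : ℝ) 1,
      ∀ u : Eucl N → ℝ, Measurable u → MemLp u 2 (volume.restrict Ω) →
      ∫⁻ x in Ω ∩ S, ENNReal.ofReal
        ((mol ((coneBump e h.pos ht).normed volume) (Ω.indicator u) x - u x) ^ 2)
        ≤ ENNReal.ofReal (C * t * (1 - s)) * gagliardoSq Ω s u := by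
  have hκ := h.pos
  set V := volume.real (Metric.ball (0 : Eucl N) 1) with hV
  have hVpos : 0 < V :=
    ENNReal.toReal_pos (Metric.measure_ball_pos _ _ one_pos).ne' measure_ball_lt_top.ne
  -- The normalized bump is at most 1/((tκ/2)^N V), which meets the factor 2(1-s)(2t)^{N+2s} of the
  -- increment estimate. The powers t^N cancel, and (2t)^{2s} ≤ 4t since t ≤ 1 and 1 < 2s < 2. The
  -- surviving factor t makes the error small uniformly in s.
  refine ⟨8 * 4 ^ N / (κ ^ N * V), by positivity, fun t ht htr ht1 s hs u hum hu => ?_⟩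
  have hΩm := hΩ.measurableSet
  set f := coneBump e h.pos ht with hf
  set η := f.normed volume with hη
  have hηc : Continuous η := f.continuous_normed
  have hηcs : HasCompactSupport η := f.hasCompactSupport_normed
  have hv := memLp_indicator_of_restrict hΩm hu
  have hvm : Measurable (Ω.indicator u) := hum.indicator hΩm
  have hbound : ∀ z, η z ≤ 1 / ((t * κ / 2) ^ N * V) := by
    intro z
    have := f.normed_le_div_measure_closedBall_rIn volume z
    rw [Measure.addHaar_real_closedBall volume _ f.rIn_pos.le, finrank_euclideanSpace,
      Fintype.card_fin] at this
    exact this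
  have hsupp : ∀ z, z ∉ Metric.ball (t • e) (t * κ) → η z = 0 := by
    intro z hz
    have : z ∉ Function.support η := by
      rw [hη, f.support_normed_eq]; exact hz
    simpa using this
  -- The average at x samples only points of Ω, so the extension of u by zero is never felt.
  have hcone : ∀ z ∈ Metric.ball (t • e) (t * κ), ∀ x ∈ Ω ∩ S, x + z ∈ Ω := by
    intro z hz x hx
    have hzw : z = t • (t⁻¹ • z) := by rw [smul_inv_smul₀ ht.ne']
    rw [hzw]
    refine h.mem x hx.1 hx.2 t ⟨ht, htr⟩ _ ?_
    rw [Metric.mem_closedBall, dist_eq_norm]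
    have h2 : t⁻¹ • z - e = t⁻¹ • (z - t • e) := by rw [smul_sub, inv_smul_smul₀ ht.ne']
    rw [h2, norm_smul, norm_inv, Real.norm_eq_abs, abs_of_pos ht, inv_mul_le_iff₀ ht]
    exact (by simpa [dist_eq_norm] using hz : ‖z - t • e‖ < t * κ).le
  calc ∫⁻ x in Ω ∩ S, ENNReal.ofReal ((mol η (Ω.indicator u) x - u x) ^ 2)
      = ∫⁻ x in Ω ∩ S, ENNReal.ofReal ((mol η (Ω.indicator u) x - Ω.indicator u x) ^ 2) := by
        refine setLIntegral_congr_fun (hΩm.inter hS) fun x hx => ?_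
        simp only [indicator_of_mem hx.1]
    _ ≤ ∫⁻ z, ENNReal.ofReal (η z) * ∫⁻ x in Ω ∩ S,
          ENNReal.ofReal ((Ω.indicator u (x + z) - Ω.indicator u x) ^ 2) :=
        lintegral_mol_sub_sq_le hηc hηcs f.nonneg_normed f.integral_normed hv hvm _
    _ ≤ ∫⁻ z, (Metric.ball (t • e) (t * κ)).indicator (fun z =>
          ENNReal.ofReal (1 / ((t * κ / 2) ^ N * V)) *
          ∫⁻ x in Ω ∩ S, ENNReal.ofReal ((u (x + z) - u x) ^ 2)) z := by
        refine lintegral_mono fun z => ?_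
        by_cases hz : z ∈ Metric.ball (t • e) (t * κ)
        · rw [indicator_of_mem hz]
          gcongr ?_ * ?_
          · exact ENNReal.ofReal_le_ofReal (hbound z)
          · refine (setLIntegral_congr_fun (hΩm.inter hS) fun x hx => ?_).le
            simp only [indicator_of_mem hx.1, indicator_of_mem (hcone z hz x hx)]
        · rw [hsupp z hz]; simp
    _ = ENNReal.ofReal (1 / ((t * κ / 2) ^ N * V)) * ∫⁻ z in Metric.ball (t • e) (t * κ),
          ∫⁻ x in Ω ∩ S, ENNReal.ofReal ((u (x + z) - u x) ^ 2) := by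
        rw [lintegral_indicator measurableSet_ball, lintegral_const_mul' _ _ ENNReal.ofReal_ne_top]
    _ ≤ ENNReal.ofReal (1 / ((t * κ / 2) ^ N * V)) *
        (ENNReal.ofReal (2 * (1 - s) * (2 * t) ^ ((N : ℝ) + 2 * s)) * gagliardoSq Ω s u) := by
        gcongr
        exact h.lintegral_ball_increment_le hΩ hS hum ⟨ht, htr⟩ hs
    _ ≤ _ := by
        rw [← mul_assoc, ← ENNReal.ofReal_mul (by positivity)]
        gcongr ENNReal.ofReal ?_ * _
        have hs1 : 0 < 1 - s := by linarith [hs.2]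
        have e1 : (2 * t) ^ ((N : ℝ) + 2 * s) ≤ 2 ^ N * t ^ N * 4 * t := by
          have h2t : 0 < 2 * t := by linarith
          rw [Real.rpow_add h2t, Real.rpow_natCast, mul_pow, Real.mul_rpow two_pos.le ht.le]
          have e2 : (2 : ℝ) ^ (2 * s) ≤ 4 := by
            calc (2 : ℝ) ^ (2 * s) ≤ 2 ^ (2 : ℝ) :=
                  Real.rpow_le_rpow_of_exponent_le one_le_two (by linarith [hs.2])
              _ = 4 := by norm_num
          have e3 : t ^ (2 * s) ≤ t := by
            calc t ^ (2 * s) ≤ t ^ (1 : ℝ) :=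
                  Real.rpow_le_rpow_of_exponent_ge ht ht1 (by linarith [hs.1])
              _ = t := Real.rpow_one t
          have : 0 ≤ t ^ (2 * s) := by positivity
          calc 2 ^ N * t ^ N * (2 ^ (2 * s) * t ^ (2 * s)) ≤ 2 ^ N * t ^ N * (4 * t) := by gcongr
            _ = _ := by ring
        calc 1 / ((t * κ / 2) ^ N * V) * (2 * (1 - s) * (2 * t) ^ ((N : ℝ) + 2 * s))
            ≤ 1 / ((t * κ / 2) ^ N * V) * (2 * (1 - s) * (2 ^ N * t ^ N * 4 * t)) := by gcongr
          _ = 8 * 4 ^ N / (κ ^ N * V) * t * (1 - s) := by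
            rw [div_pow, mul_pow, show (4 : ℝ) ^ N = 2 ^ N * 2 ^ N by rw [← mul_pow]; norm_num]
            field_simp
            ring

theorem mol_eq_inner {η : Eucl N → ℝ} (hη : Continuous η) (hc : HasCompactSupport η)
    (v : Lp ℝ 2 (volume : Measure (Eucl N))) (x : Eucl N) :
    mol η v x = ⟪(memLp_comp_sub hη hc x).toLp, v⟫ := by
  rw [mol_eq_integral_sub, L2.inner_def]
  refine integral_congr_ae ?_
  filter_upwards [(memLp_comp_sub hη hc x).coeFn_toLp] with y hy
  rw [hy]
  simp [mul_comm]

theorem abs_mol_le {η : Eucl N → ℝ} (hη : Continuous η) (hc : HasCompactSupport η)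
    (v : Lp ℝ 2 (volume : Measure (Eucl N))) (x : Eucl N) :
    |mol η v x| ≤ (eLpNorm η 2 volume).toReal * ‖v‖ := by
  rw [mol_eq_inner hη hc]
  refine (abs_real_inner_le_norm _ _).trans ?_
  rw [Lp.norm_toLp]
  have : eLpNorm (fun y => η (y - x)) 2 volume = eLpNorm η 2 volume :=
    eLpNorm_comp_measurePreserving hη.aestronglyMeasurable (measurePreserving_sub_right volume x)
  rw [this]

/-- An average at x is an inner product with a fixed L² function, so weak convergence gives
pointwise convergence of the averages. They are uniformly bounded and Ω has finite measure, so
dominated convergence applies. -/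
theorem tendsto_lintegral_mol_sub_sq {η : Eucl N → ℝ} (hη : Continuous η) (hc : HasCompactSupport η)
    {Ω : Set (Eucl N)} (hΩ : volume Ω ≠ ⊤) {v : ℕ → Lp ℝ 2 (volume : Measure (Eucl N))}
    {w : Lp ℝ 2 (volume : Measure (Eucl N))} {C : ℝ} (hC : ∀ k, ‖v k‖ ≤ C)
    (hw : ∀ f, Tendsto (fun k => (⟪f, v k⟫ : ℝ)) atTop (𝓝 ⟪f, w⟫)) :
    Tendsto (fun k => ∫⁻ x in Ω, ENNReal.ofReal ((mol η (v k) x - mol η w x) ^ 2)) atTop (𝓝 0) := by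
  have hmeas : ∀ u : Lp ℝ 2 (volume : Measure (Eucl N)), Measurable (mol η u) := fun u =>
    measurable_mol hη.measurable (Lp.stronglyMeasurable u).measurable
  set B := (eLpNorm η 2 volume).toReal * C + (eLpNorm η 2 volume).toReal * ‖w‖ with hB
  have h0 : ∫⁻ x in Ω, ENNReal.ofReal (0 : ℝ) = 0 := by simp
  rw [← h0]
  refine tendsto_lintegral_of_dominated_convergence (fun _ => ENNReal.ofReal (B ^ 2)) ?_ ?_ ?_ ?_
  · intro k
    exact (((hmeas (v k)).sub (hmeas w)).pow_const 2).ennreal_ofReal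
  · intro k
    refine Eventually.of_forall fun x => ENNReal.ofReal_le_ofReal ?_
    refine sq_le_sq' ?_ ?_
    all_goals
      have h1 := abs_le.mp ((abs_mol_le hη hc (v k) x).trans
        (mul_le_mul_of_nonneg_left (hC k) ENNReal.toReal_nonneg))
      have h2 := abs_le.mp (abs_mol_le hη hc w x)
      linarith [h1.1, h1.2, h2.1, h2.2]
  · simp only [lintegral_const, Measure.restrict_apply MeasurableSet.univ, univ_inter]
    exact ENNReal.mul_ne_top ENNReal.ofReal_ne_top hΩ
  · refine Eventually.of_forall fun x => ENNReal.tendsto_ofReal ?_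
    have h1 : Tendsto (fun k => mol η (v k) x) atTop (𝓝 (mol η w x)) := by
      simp only [mol_eq_inner hη hc]
      exact hw _
    have := (h1.sub_const (mol η w x)).pow 2
    simpa using this

theorem ofReal_sq_add_four_le (a b c d : ℝ) :
    ENNReal.ofReal ((a + b + c + d) ^ 2) ≤ 4 * (ENNReal.ofReal (a ^ 2) + ENNReal.ofReal (b ^ 2)
      + ENNReal.ofReal (c ^ 2) + ENNReal.ofReal (d ^ 2)) := by
  rw [← ENNReal.ofReal_add (by positivity) (by positivity),
    ← ENNReal.ofReal_add (by positivity) (by positivity),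
    ← ENNReal.ofReal_add (by positivity) (by positivity),
    show (4 : ℝ≥0∞) = ENNReal.ofReal 4 by simp, ← ENNReal.ofReal_mul (by norm_num)]
  apply ENNReal.ofReal_le_ofReal
  nlinarith [sq_nonneg (a - b), sq_nonneg (a - c), sq_nonneg (a - d), sq_nonneg (b - c),
    sq_nonneg (b - d), sq_nonneg (c - d)]

theorem volume_ne_top {Ω : Set (Eucl N)} (hΩ : IsBoundedLipschitzDomain Ω) : volume Ω ≠ ⊤ :=
  hΩ.isBounded.measure_lt_top.ne

/-- A weakly convergent subsequence of the extensions by zero is chosen once. On each cone piece the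
averages at a fixed small scale t converge strongly and stay within C t M of the functions in
squared L² norm, uniformly in k, so the functions themselves are Cauchy. -/
theorem exists_subseq_cauchy_of_measurable [NeZero N] {Ω : Set (Eucl N)}
    (hΩ : IsBoundedLipschitzDomain Ω)
    {u : ℕ → Eucl N → ℝ} {s : ℕ → ℝ} {M : ℝ} (hs : ∀ k, s k ∈ Ioo (1 / 2 : ℝ) 1)
    (hum : ∀ k, Measurable (u k)) (hu : ∀ k, MemLp (u k) 2 (volume.restrict Ω))
    (hE : ∀ k, ENNReal.ofReal (1 - s k) * gagliardoSq Ω (s k) (u k) ≤ ENNReal.ofReal M)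
    (hn : ∀ k, eLpNorm (u k) 2 (volume.restrict Ω) ≤ ENNReal.ofReal M) :
    ∃ φ : ℕ → ℕ, StrictMono φ ∧ ∀ ε > 0, ∃ K, ∀ k ≥ K, ∀ l ≥ K,
      ∫⁻ x in Ω, ENNReal.ofReal ((u (φ k) x - u (φ l) x) ^ 2) ≤ ε := by
  have hΩo := hΩ.isOpen
  have hΩm := hΩo.measurableSet
  obtain ⟨m, ψ, e, κ, r, hψ, hsum⟩ := exists_conePartition hΩ
  have hv := fun k => memLp_indicator_of_restrict hΩm (hu k)
  set v : ℕ → Lp ℝ 2 (volume : Measure (Eucl N)) := fun k => (hv k).toLp with hvdef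
  have hvn : ∀ k, ‖v k‖ ≤ max M 0 := by
    intro k
    rw [hvdef]
    simp only [Lp.norm_toLp]
    rw [eLpNorm_indicator_eq_eLpNorm_restrict hΩm]
    refine (ENNReal.toReal_mono ENNReal.ofReal_ne_top (hn k)).trans ?_
    rw [ENNReal.toReal_ofReal']
  have : Fact ((2 : ℝ≥0∞) ≠ ⊤) := ⟨ENNReal.ofNat_ne_top⟩
  obtain ⟨φ, hφ, w, hw⟩ := exists_weakly_convergent_subseq v _ hvn
  refine ⟨φ, hφ, ?_⟩
  have hmolv : ∀ (η : Eucl N → ℝ) k x, mol η (v k) x = mol η (Ω.indicator (u k)) x := fun η k x =>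
    mol_congr (hv k).coeFn_toLp x
  have key : ∀ i, ∀ ε > 0, ∃ K, ∀ k ≥ K, ∀ l ≥ K,
      ∫⁻ x in Ω ∩ tsupport (ψ i), ENNReal.ofReal ((u (φ k) x - u (φ l) x) ^ 2) ≤ ε := by
    intro i ε hε
    have hSm : MeasurableSet (tsupport (ψ i)) := (isClosed_tsupport _).measurableSet
    obtain ⟨-, -, -, hcone⟩ := hψ i
    obtain ⟨C, hC, hmol⟩ := hcone.exists_mol_bound hΩo hSm
    -- The difference splits into four terms; squaring their sum costs a factor 4 in front of four
    -- squares.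
    have hε16 : (0 : ℝ≥0∞) < ε / 16 := ENNReal.div_pos hε.ne' (by norm_num)
    obtain ⟨t, ht0, htr, ht1, htM⟩ : ∃ t, 0 < t ∧ t < r i ∧ t ≤ 1 ∧
        ENNReal.ofReal (C * t) * ENNReal.ofReal M ≤ ε / 16 := by
      have h1 : Tendsto (fun t : ℝ => ENNReal.ofReal (C * t) * ENNReal.ofReal M) (𝓝[>] 0)
          (𝓝 0) := by
        have h2 : Tendsto (fun t : ℝ => C * t * M) (𝓝[>] 0) (𝓝 (C * 0 * M)) :=
          ((tendsto_id.const_mul C).mul_const M).mono_left nhdsWithin_le_nhds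
        have h3 := ENNReal.tendsto_ofReal h2
        simp only [mul_zero, zero_mul, ENNReal.ofReal_zero] at h3
        refine h3.congr' ?_
        filter_upwards [self_mem_nhdsWithin] with t ht
        have : (0 : ℝ) < t := ht
        rw [ENNReal.ofReal_mul (by positivity)]
      have h2 := h1.eventually (ge_mem_nhds hε16)
      have h3 : ∀ᶠ t : ℝ in 𝓝[>] 0, t ∈ Ioo 0 (min (r i) 1) :=
        Ioo_mem_nhdsGT (lt_min hcone.rpos one_pos)
      obtain ⟨t, h2, h3⟩ := (h2.and h3).exists
      exact ⟨t, h3.1, h3.2.trans_le (min_le_left _ _), (h3.2.trans_le (min_le_right _ _)).le, h2⟩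
    set η := (coneBump (e i) hcone.pos ht0).normed volume with hη
    have hηc : Continuous η := ContDiffBump.continuous_normed _
    have hηcs : HasCompactSupport η := ContDiffBump.hasCompactSupport_normed _
    have hQ : ∀ k, ∫⁻ x in Ω ∩ tsupport (ψ i), ENNReal.ofReal ((mol η (v k) x - u k x) ^ 2)
        ≤ ε / 16 := by
      intro k
      simp only [hmolv]
      refine (hmol t ht0 htr ht1 (s k) (hs k) (u k) (hum k) (hu k)).trans (le_trans ?_ htM)
      rw [ENNReal.ofReal_mul (by positivity), mul_assoc]
      gcongr
      exact hE k
    have hR := tendsto_lintegral_mol_sub_sq hηc hηcs (volume_ne_top hΩ) (fun k => hvn (φ k)) hw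
    obtain ⟨K, hK⟩ := eventually_atTop.mp (hR.eventually (ge_mem_nhds hε16))
    refine ⟨K, fun k hk l hl => ?_⟩
    have hmm : ∀ k, Measurable (mol η (v k)) := fun k =>
      measurable_mol hηc.measurable (Lp.stronglyMeasurable _).measurable
    have hmw : Measurable (mol η w) :=
      measurable_mol hηc.measurable (Lp.stronglyMeasurable _).measurable
    have m2 : Measurable fun x => ENNReal.ofReal ((mol η (v (φ l)) x - u (φ l) x) ^ 2) :=
      (((hmm _).sub (hum _)).pow_const 2).ennreal_ofReal
    have m3 : Measurable fun x => ENNReal.ofReal ((mol η (v (φ k)) x - mol η w x) ^ 2) :=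
      (((hmm _).sub hmw).pow_const 2).ennreal_ofReal
    have m4 : Measurable fun x => ENNReal.ofReal ((mol η (v (φ l)) x - mol η w x) ^ 2) :=
      (((hmm _).sub hmw).pow_const 2).ennreal_ofReal
    have hRk := (lintegral_mono_set (inter_subset_left : Ω ∩ tsupport (ψ i) ⊆ Ω)).trans (hK k hk)
    have hRl := (lintegral_mono_set (inter_subset_left : Ω ∩ tsupport (ψ i) ⊆ Ω)).trans (hK l hl)
    calc ∫⁻ x in Ω ∩ tsupport (ψ i), ENNReal.ofReal ((u (φ k) x - u (φ l) x) ^ 2)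
        ≤ ∫⁻ x in Ω ∩ tsupport (ψ i), 4 * (ENNReal.ofReal ((mol η (v (φ k)) x - u (φ k) x) ^ 2)
          + ENNReal.ofReal ((mol η (v (φ k)) x - mol η w x) ^ 2)
          + ENNReal.ofReal ((mol η (v (φ l)) x - mol η w x) ^ 2)
          + ENNReal.ofReal ((mol η (v (φ l)) x - u (φ l) x) ^ 2)) := by
          refine lintegral_mono fun x => ?_
          have := ofReal_sq_add_four_le (-(mol η (v (φ k)) x - u (φ k) x))
            (mol η (v (φ k)) x - mol η w x) (-(mol η (v (φ l)) x - mol η w x))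
            (mol η (v (φ l)) x - u (φ l) x)
          rw [neg_sq, neg_sq] at this
          refine le_trans (le_of_eq ?_) this
          congr 2
          ring
      _ = 4 * ((∫⁻ x in Ω ∩ tsupport (ψ i), ENNReal.ofReal ((mol η (v (φ k)) x - u (φ k) x) ^ 2))
          + (∫⁻ x in Ω ∩ tsupport (ψ i), ENNReal.ofReal ((mol η (v (φ k)) x - mol η w x) ^ 2))
          + (∫⁻ x in Ω ∩ tsupport (ψ i), ENNReal.ofReal ((mol η (v (φ l)) x - mol η w x) ^ 2))
          + ∫⁻ x in Ω ∩ tsupport (ψ i), ENNReal.ofReal ((mol η (v (φ l)) x - u (φ l) x) ^ 2)) := by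
          rw [lintegral_const_mul' _ _ (by norm_num), lintegral_add_right _ m2,
            lintegral_add_right _ m4, lintegral_add_right _ m3]
      _ ≤ 4 * (ε / 16 + ε / 16 + ε / 16 + ε / 16) := by
          gcongr
          · exact hQ _
          · exact hQ _
      _ = ε := by
          rw [show 4 * (ε / 16 + ε / 16 + ε / 16 + ε / 16) = 16 * (ε / 16) by ring]
          exact ENNReal.mul_div_cancel (by norm_num) (by norm_num)
  intro ε hε
  have hm : m ≠ 0 := by
    rintro rfl
    obtain ⟨x, hx⟩ := hΩ.isConnected.nonempty
    simpa using hsum x hx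
  have hεm : 0 < ε / m := ENNReal.div_pos hε.ne' (ENNReal.natCast_ne_top m)
  choose K hK using fun i => key i (ε / m) hεm
  refine ⟨Finset.univ.sup K, fun k hk l hl => ?_⟩
  have hcov : Ω ⊆ ⋃ i, Ω ∩ tsupport (ψ i) := by
    intro x hx
    by_contra hcon
    simp only [mem_iUnion, mem_inter_iff, not_exists, not_and] at hcon
    have : ∑ i, ψ i x = 0 := Finset.sum_eq_zero fun i _ => image_eq_zero_of_notMem_tsupport (hcon i hx)
    rw [hsum x hx] at this
    exact one_ne_zero this
  calc ∫⁻ x in Ω, ENNReal.ofReal ((u (φ k) x - u (φ l) x) ^ 2)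
      ≤ ∫⁻ x in ⋃ i, Ω ∩ tsupport (ψ i), ENNReal.ofReal ((u (φ k) x - u (φ l) x) ^ 2) :=
        lintegral_mono_set hcov
    _ ≤ ∑' i, ∫⁻ x in Ω ∩ tsupport (ψ i), ENNReal.ofReal ((u (φ k) x - u (φ l) x) ^ 2) :=
        lintegral_iUnion_le _ _
    _ = ∑ i, ∫⁻ x in Ω ∩ tsupport (ψ i), ENNReal.ofReal ((u (φ k) x - u (φ l) x) ^ 2) :=
        tsum_fintype _
    _ ≤ ∑ i : Fin m, ε / m := Finset.sum_le_sum fun i _ =>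
        hK i k ((Finset.le_sup (Finset.mem_univ i)).trans hk) l
          ((Finset.le_sup (Finset.mem_univ i)).trans hl)
    _ = ε := by
        rw [Finset.sum_const, Finset.card_univ, Fintype.card_fin, nsmul_eq_mul]
        exact ENNReal.mul_div_cancel (by exact_mod_cast hm) (ENNReal.natCast_ne_top m)

/-- Compactness in `L²(Ω)`, uniform as `s → 1`. -/
theorem exists_L2_convergent_subseq [NeZero N] {Ω : Set (Eucl N)} (hΩ : IsBoundedLipschitzDomain Ω)
    {u : ℕ → Eucl N → ℝ} {s : ℕ → ℝ} {M : ℝ} (hs : ∀ k, s k ∈ Ioo (1 / 2 : ℝ) 1)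
    (hum : ∀ k, AEMeasurable (u k) volume) (hu : ∀ k, MemLp (u k) 2 (volume.restrict Ω))
    (hE : ∀ k, ENNReal.ofReal (1 - s k) * gagliardoSq Ω (s k) (u k) ≤ ENNReal.ofReal M)
    (hn : ∀ k, eLpNorm (u k) 2 (volume.restrict Ω) ≤ ENNReal.ofReal M) :
    ∃ φ : ℕ → ℕ, StrictMono φ ∧ ∃ w : Lp ℝ 2 (volume.restrict Ω),
      Tendsto (fun k => (hu (φ k)).toLp (u (φ k))) atTop (𝓝 w) := by
  have hae := fun k => (hum k).ae_eq_mk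
  have haeΩ : ∀ k, u k =ᵐ[volume.restrict Ω] (hum k).mk (u k) := fun k => ae_restrict_of_ae (hae k)
  obtain ⟨φ, hφ, hcau⟩ := exists_subseq_cauchy_of_measurable hΩ
    (u := fun k => (hum k).mk (u k)) (s := s) (M := M) hs (fun k => (hum k).measurable_mk)
    (fun k => (memLp_congr_ae (haeΩ k)).mp (hu k))
    (fun k => by rw [← gagliardoSq_congr (hae k)]; exact hE k)
    (fun k => by rw [← eLpNorm_congr_ae (haeΩ k)]; exact hn k)
  refine ⟨φ, hφ, ?_⟩
  apply cauchySeq_tendsto_of_complete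
  rw [EMetric.cauchySeq_iff]
  intro ε hε
  obtain ⟨ε', hε', hεε'⟩ := exists_between hε
  obtain ⟨K, hK⟩ := hcau (ε' ^ 2) (by positivity)
  refine ⟨K, fun k hk l hl => lt_of_le_of_lt ?_ hεε'⟩
  rw [Lp.edist_toLp_toLp]
  have h1 := hK k hk l hl
  have h2 : eLpNorm (u (φ k) - u (φ l)) 2 (volume.restrict Ω) ^ 2 ≤ ε' ^ 2 := by
    rw [eLpNorm_congr_ae ((haeΩ (φ k)).sub (haeΩ (φ l))), eLpNorm_two_sq]
    exact h1
  exact (ENNReal.pow_le_pow_left_iff two_ne_zero).mp h2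

end Mollification

/-! ### The lower bound for the fractional energies -/

section LowerBound

variable {N : ℕ}

/-- Smooth vector fields with compact support in `Ω`. -/
def testFields (Ω : Set (Eucl N)) : Submodule ℝ (Eucl N → Eucl N) where
  carrier := {Φ | ContDiff ℝ ∞ Φ ∧ HasCompactSupport Φ ∧ tsupport Φ ⊆ Ω}
  add_mem' := fun {Φ Ψ} hΦ hΨ => ⟨hΦ.1.add hΨ.1, hΦ.2.1.add hΨ.2.1,
    (tsupport_add Φ Ψ).trans (union_subset hΦ.2.2 hΨ.2.2)⟩
  zero_mem' := ⟨contDiff_const, HasCompactSupport.zero, by simp [tsupport]⟩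
  smul_mem' := fun c Φ hΦ => ⟨contDiff_const.smul hΦ.1, hΦ.2.1.smul_left (f := fun _ => c),
    (tsupport_smul_subset_right (fun _ => c) Φ).trans hΦ.2.2⟩

/-- The divergence of a vector field. -/
def divergence (Φ : Eucl N → Eucl N) (x : Eucl N) : ℝ :=
  ∑ i, fderiv ℝ Φ x (EuclideanSpace.single i 1) i

/-- The increment of `v` in direction `z` tested against `⟪z, Φ⟫`, after a change of variables. -/
def testedIncr (Φ : Eucl N → Eucl N) (v : Eucl N → ℝ) (z : Eucl N) : ℝ :=
  ∫ x, v x * ⟪z, Φ (x - z) - Φ x⟫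

/-- Pointwise 2 a p - p² ≤ a². Bounding the square from below by an expression linear in a lets the
difference be moved from u to the test field. -/
theorem integral_sq_sub_ge {α : Type*} [MeasurableSpace α] {μ : Measure α} {a p : α → ℝ}
    (ha : MemLp a 2 μ) (hp : MemLp p 2 μ) {D : Set α} (hD : MeasurableSet D)
    (hpD : ∀ x ∉ D, p x = 0) :
    2 * ∫ x, a x * p x ∂μ - ∫ x, p x ^ 2 ∂μ ≤ ∫ x in D, a x ^ 2 ∂μ := by
  have hap : Integrable (fun x => a x * p x) μ := MemLp.integrable_mul (p := 2) (q := 2) ha hp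
  rw [← integral_const_mul, ← integral_sub (hap.const_mul 2) hp.integrable_sq,
    ← integral_indicator hD]
  refine integral_mono ((hap.const_mul 2).sub hp.integrable_sq) (ha.integrable_sq.indicator hD)
    fun x => ?_
  by_cases hx : x ∈ D
  · simp only [indicator_of_mem hx]; nlinarith [sq_nonneg (a x - p x)]
  · simp [indicator_of_notMem hx, hpD x hx]

/-- Young's inequality with the increment of u as a and ⟪z, Φ⟫ as p, followed by a translation in
the linear term. The condition on z keeps both points x and x + z in Ω wherever Φ is nonzero. -/
theorem ofReal_testedIncr_le_incr {Ω : Set (Eucl N)} (hΩ : IsOpen Ω) {Φ : Eucl N → Eucl N}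
    (hΦ : Continuous Φ) (hc : HasCompactSupport Φ) {z : Eucl N}
    (hz : ∀ x ∈ tsupport Φ, x ∈ Ω ∧ x + z ∈ Ω)
    {u : Eucl N → ℝ} (hu : MemLp u 2 (volume.restrict Ω)) :
    ENNReal.ofReal (2 * testedIncr Φ (Ω.indicator u) z - ∫ x, (⟪z, Φ x⟫ : ℝ) ^ 2) ≤ incr Ω u z := by
  have hΩm := hΩ.measurableSet
  set v := Ω.indicator u with hv
  have hvL : MemLp v 2 volume := memLp_indicator_of_restrict hΩm hu
  set D := Ω ∩ (fun x => x + z) ⁻¹' Ω with hD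
  have hDm : MeasurableSet D := hΩm.inter ((measurable_add_const z) hΩm)
  have hvz : MemLp (fun x => v (x + z)) 2 volume :=
    hvL.comp_measurePreserving (measurePreserving_add_right volume z)
  have hpc : Continuous fun x => (⟪z, Φ x⟫ : ℝ) := by fun_prop
  have hpcs : HasCompactSupport fun x => (⟪z, Φ x⟫ : ℝ) := hc.comp_left (inner_zero_right z)
  have hp : MemLp (fun x => (⟪z, Φ x⟫ : ℝ)) 2 volume := hpc.memLp_of_hasCompactSupport hpcs
  have hpz : MemLp (fun x => (⟪z, Φ (x - z)⟫ : ℝ)) 2 volume :=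
    hp.comp_measurePreserving (measurePreserving_sub_right volume z)
  have h1 := integral_sq_sub_ge (hvz.sub hvL) hp hDm (fun x hx => by
    have : x ∉ tsupport Φ := fun h => hx ⟨(hz x h).1, (hz x h).2⟩
    simp [image_eq_zero_of_notMem_tsupport this])
  have h2 : ∫ x, ((fun x => v (x + z)) - v) x * (⟪z, Φ x⟫ : ℝ) = testedIncr Φ v z := by
    have i1 : Integrable fun x => v (x + z) * (⟪z, Φ x⟫ : ℝ) :=
      MemLp.integrable_mul (p := 2) (q := 2) hvz hp
    have i2 : Integrable fun x => v x * (⟪z, Φ x⟫ : ℝ) :=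
      MemLp.integrable_mul (p := 2) (q := 2) hvL hp
    have i3 : Integrable fun x => v x * (⟪z, Φ (x - z)⟫ : ℝ) :=
      MemLp.integrable_mul (p := 2) (q := 2) hvL hpz
    simp only [Pi.sub_apply, sub_mul, testedIncr, inner_sub_right, mul_sub]
    rw [integral_sub i1 i2, integral_sub i3 i2]
    congr 1
    rw [← integral_add_right_eq_self (fun x => v x * (⟪z, Φ (x - z)⟫ : ℝ)) z]
    simp
  rw [h2] at h1
  refine (ENNReal.ofReal_le_ofReal h1).trans (le_of_eq ?_)
  rw [ofReal_integral_eq_lintegral_ofReal (hvz.sub hvL).integrable_sq.integrableOn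
    (Eventually.of_forall fun _ => sq_nonneg _), incr]
  refine setLIntegral_congr_fun hDm fun x hx => ?_
  simp only [Pi.sub_apply, hv, indicator_of_mem hx.1, indicator_of_mem (show x + z ∈ Ω from hx.2)]

theorem integrable_indicator_of_memLp {Ω : Set (Eucl N)} (hΩ : MeasurableSet Ω) (hfin : volume Ω ≠ ⊤)
    {u : Eucl N → ℝ} (hu : MemLp u 2 (volume.restrict Ω)) : Integrable (Ω.indicator u) := by
  have : IsFiniteMeasure (volume.restrict Ω) := ⟨by simpa using hfin.lt_top⟩
  have h1 : IntegrableOn u Ω := hu.integrable one_le_two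
  exact h1.integrable_indicator hΩ

theorem integrable_testedIncr {Φ : Eucl N → Eucl N} (hΦ : Continuous Φ)
    (hc : HasCompactSupport Φ) {v : Eucl N → ℝ} (hv : Integrable v) (z : Eucl N) :
    Integrable fun x => v x * (⟪z, Φ (x - z) - Φ x⟫ : ℝ) := by
  obtain ⟨C, hC⟩ := hc.exists_bound_of_continuous hΦ
  refine hv.mul_bdd (c := ‖z‖ * (C + C)) (by fun_prop) (Eventually.of_forall fun x => ?_)
  refine (norm_inner_le_norm _ _).trans ?_
  gcongr
  exact (norm_sub_le _ _).trans (add_le_add (hC _) (hC _))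

/-- One factor ‖z‖ comes from the inner product and one from the increment of Φ. Quadratic decay
makes this integrable against the kernel although v is only integrable, and the bound is linear in
the L¹ norm of v. -/
theorem abs_testedIncr_le {Φ : Eucl N → Eucl N} {L : ℝ≥0} (hL : LipschitzWith L Φ)
    {v : Eucl N → ℝ} (hv : Integrable v) (z : Eucl N) :
    |testedIncr Φ v z| ≤ (L * ∫ x, |v x|) * ‖z‖ ^ 2 := by
  have h1 : ∀ x, ‖v x * (⟪z, Φ (x - z) - Φ x⟫ : ℝ)‖ ≤ |v x| * (L * ‖z‖ ^ 2) := by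
    intro x
    rw [norm_mul, Real.norm_eq_abs]
    gcongr
    refine (norm_inner_le_norm _ _).trans ?_
    have := hL.dist_le_mul (x - z) x
    rw [dist_eq_norm, dist_eq_norm, sub_sub_cancel_left, norm_neg] at this
    calc ‖z‖ * ‖Φ (x - z) - Φ x‖ ≤ ‖z‖ * (L * ‖z‖) := by gcongr
      _ = L * ‖z‖ ^ 2 := by ring
  have h2 := norm_integral_le_of_norm_le (hv.abs.mul_const _) (Eventually.of_forall h1)
  rw [integral_mul_const] at h2
  calc |testedIncr Φ v z| ≤ _ := h2
    _ = _ := by ring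

theorem aestronglyMeasurable_testedIncr {Φ : Eucl N → Eucl N} (hΦ : Continuous Φ) {v : Eucl N → ℝ}
    (hv : AEStronglyMeasurable v volume) : AEStronglyMeasurable (testedIncr Φ v) volume := by
  have : AEStronglyMeasurable (fun p : Eucl N × Eucl N => v p.2 * (⟪p.1, Φ (p.2 - p.1) - Φ p.2⟫ : ℝ))
      (volume.prod volume) := by
    refine (hv.comp_snd).mul (Continuous.aestronglyMeasurable ?_)
    fun_prop
  exact this.integral_prod_right'

theorem integral_le_toReal_lintegral_ofReal {α : Type*} [MeasurableSpace α] {μ : Measure α}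
    {f : α → ℝ} (hf : Integrable f μ) : ∫ x, f x ∂μ ≤ (∫⁻ x, ENNReal.ofReal (f x) ∂μ).toReal := by
  rw [integral_eq_lintegral_pos_part_sub_lintegral_neg_part hf]
  linarith [ENNReal.toReal_nonneg (a := ∫⁻ x, ENNReal.ofReal (-f x) ∂μ)]

theorem integral_inner_sq_nonneg_le {Φ : Eucl N → Eucl N} (hΦ : Continuous Φ)
    (hc : HasCompactSupport Φ) (z : Eucl N) :
    |∫ x, (⟪z, Φ x⟫ : ℝ) ^ 2| ≤ (∫ x, ‖Φ x‖ ^ 2) * ‖z‖ ^ 2 := by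
  have hi : Integrable fun x => ‖Φ x‖ ^ 2 :=
    (hΦ.memLp_of_hasCompactSupport (p := 2) hc).norm.integrable_sq
  rw [← integral_mul_const, ← Real.norm_eq_abs]
  refine norm_integral_le_of_norm_le (hi.mul_const _) (Eventually.of_forall fun x => ?_)
  rw [Real.norm_eq_abs, mul_comm]
  exact abs_inner_sq_le z (Φ x)

theorem setIntegral_testedIncr_le_gagliardo [NeZero N] {Ω : Set (Eucl N)} (hΩ : IsOpen Ω)
    (hfin : volume Ω ≠ ⊤) {Φ : Eucl N → Eucl N} {L : ℝ≥0} (hL : LipschitzWith L Φ)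
    (hc : HasCompactSupport Φ) {δ : ℝ}
    (hz : ∀ z ∈ Metric.ball (0 : Eucl N) δ, ∀ x ∈ tsupport Φ, x ∈ Ω ∧ x + z ∈ Ω) {s : ℝ}
    (hs : s ∈ Ioo (1 / 2 : ℝ) 1) {u : Eucl N → ℝ} (hu : MemHs Ω s u) :
    ∫ z in Metric.ball (0 : Eucl N) δ,
      (2 * testedIncr Φ (Ω.indicator u) z - ∫ x, (⟪z, Φ x⟫ : ℝ) ^ 2) * kern s z
      ≤ (gagliardoSq Ω s u).toReal := by
  have hΩm := hΩ.measurableSet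
  have hv := integrable_indicator_of_memLp hΩm hfin hu.memLp
  have hQm : AEStronglyMeasurable (fun z : Eucl N => ∫ x, (⟪z, Φ x⟫ : ℝ) ^ 2) volume := by
    have h0 : AEStronglyMeasurable (fun p : Eucl N × Eucl N => (⟪p.1, Φ p.2⟫ : ℝ) ^ 2)
      (volume.prod volume) := by
      have := hL.continuous
      exact Continuous.aestronglyMeasurable (by fun_prop)
    exact h0.integral_prod_right'
  have hTm := aestronglyMeasurable_testedIncr hL.continuous hv.aestronglyMeasurable
  have hint : IntegrableOn (fun z => (2 * testedIncr Φ (Ω.indicator u) z -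
      ∫ x, (⟪z, Φ x⟫ : ℝ) ^ 2) * kern s z) (Metric.ball (0 : Eucl N) δ) := by
    refine integrableOn_ball_mul_kern (k := 2)
      (C := 2 * (L * ∫ x, |Ω.indicator u x|) + ∫ x, ‖Φ x‖ ^ 2) (by push_cast; linarith [hs.2])
      ((hTm.const_mul 2).sub hQm).restrict fun z _ => ?_
    have h1 := abs_testedIncr_le hL hv z
    have h2 := integral_inner_sq_nonneg_le hL.continuous hc z
    calc _ ≤ |2 * testedIncr Φ (Ω.indicator u) z| + |∫ x, (⟪z, Φ x⟫ : ℝ) ^ 2| := abs_sub _ _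
      _ ≤ 2 * ((L * ∫ x, |Ω.indicator u x|) * ‖z‖ ^ 2) + (∫ x, ‖Φ x‖ ^ 2) * ‖z‖ ^ 2 := by
          rw [abs_mul, abs_two]; gcongr
      _ = _ := by ring
  refine (integral_le_toReal_lintegral_ofReal hint).trans
    (ENNReal.toReal_mono hu.gagliardo_lt_top.ne ?_)
  calc _ ≤ ∫⁻ z in Metric.ball (0 : Eucl N) δ, ENNReal.ofReal (kern s z) * incr Ω u z := by
        refine setLIntegral_mono' measurableSet_ball fun z hzb => ?_
        rw [mul_comm, ENNReal.ofReal_mul (kern_nonneg s z)]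
        gcongr
        exact ofReal_testedIncr_le_incr hΩ hL.continuous hc (hz z hzb) hu.memLp
    _ ≤ ∫⁻ z, ENNReal.ofReal (kern s z) * incr Ω u z := setLIntegral_le_lintegral _ _
    _ ≤ _ := lintegral_kern_mul_incr_le hΩ s hu.aemeasurable

/-- Mean value inequality on the closed ball of radius ‖z‖ about x, where the derivative of Φ varies
by at most a multiple of ‖z‖. -/
theorem exists_taylor_bound {Φ : Eucl N → Eucl N} (hΦ : ContDiff ℝ ∞ Φ)
    (hc : HasCompactSupport Φ) :
    ∃ L : ℝ≥0, LipschitzWith L Φ ∧ ∀ x z, ‖Φ (x - z) - Φ x + fderiv ℝ Φ x z‖ ≤ L * ‖z‖ ^ 2 := by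
  obtain ⟨L₁, h₁⟩ := hΦ.lipschitzWith_of_hasCompactSupport hc (by simp)
  obtain ⟨L₂, h₂⟩ := (hΦ.fderiv_right (m := ∞) (by simp)).lipschitzWith_of_hasCompactSupport
    (hc.fderiv ℝ) (by simp)
  refine ⟨max L₁ L₂, h₁.weaken (le_max_left _ _), fun x z => ?_⟩
  have h3 : ‖Φ (x - z) - Φ x - fderiv ℝ Φ x (x - z - x)‖ ≤ (L₂ * ‖z‖) * ‖x - z - x‖ := by
    refine (convex_closedBall x ‖z‖).norm_image_sub_le_of_norm_hasFDerivWithin_le'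
      (f' := fderiv ℝ Φ) (fun y _ => (hΦ.differentiable (by simp) y).hasFDerivAt.hasFDerivWithinAt)
      (fun y hy => ?_) (Metric.mem_closedBall_self (norm_nonneg z)) (by simp)
    have := h₂.dist_le_mul y x
    rw [dist_eq_norm] at this
    refine this.trans ?_
    gcongr
    exact hy
  rw [sub_sub_cancel_left, map_neg, sub_neg_eq_add, norm_neg] at h3
  refine h3.trans ?_
  have : (L₂ : ℝ) ≤ (max L₁ L₂ : ℝ≥0) := by exact_mod_cast le_max_right L₁ L₂
  calc (L₂ : ℝ) * ‖z‖ * ‖z‖ = L₂ * ‖z‖ ^ 2 := by ring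
    _ ≤ _ := by gcongr

theorem eucl_eq_sum (z : Eucl N) : z = ∑ j, z j • (EuclideanSpace.single j 1 : Eucl N) := by
  ext i
  simp [Finset.sum_apply, Pi.single_apply]

theorem inner_eq_sum (z w : Eucl N) : (⟪z, w⟫ : ℝ) = ∑ i, z i * w i := by
  simp [PiLp.inner_apply, mul_comm]

theorem integrable_mul_fderiv_apply {Φ : Eucl N → Eucl N} (hΦ : ContDiff ℝ ∞ Φ)
    (hc : HasCompactSupport Φ) {v : Eucl N → ℝ} (hv : Integrable v) (i : Fin N) (e : Eucl N) :
    Integrable fun x => v x * fderiv ℝ Φ x e i := by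
  have hd : Continuous (fderiv ℝ Φ) := hΦ.continuous_fderiv (by simp)
  have hcont : Continuous fun x => fderiv ℝ Φ x e i := by fun_prop
  obtain ⟨C, hC⟩ := (HasCompactSupport.comp_left (hc.fderiv ℝ)
    (g := fun A : Eucl N →L[ℝ] Eucl N => A e i) (by simp)).exists_bound_of_continuous hcont
  exact hv.mul_bdd (c := C) hcont.aestronglyMeasurable (Eventually.of_forall hC)

theorem integral_mul_inner_fderiv {Φ : Eucl N → Eucl N} (hΦ : ContDiff ℝ ∞ Φ)
    (hc : HasCompactSupport Φ) {v : Eucl N → ℝ} (hv : Integrable v) (z : Eucl N) :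
    ∫ x, v x * (⟪z, fderiv ℝ Φ x z⟫ : ℝ) = ∑ i, ∑ j,
      (∫ x, v x * fderiv ℝ Φ x (EuclideanSpace.single j 1) i) * (z i * z j) := by
  have h1 : ∀ x, v x * (⟪z, fderiv ℝ Φ x z⟫ : ℝ) = ∑ i, ∑ j,
      v x * fderiv ℝ Φ x (EuclideanSpace.single j 1) i * (z i * z j) := by
    intro x
    rw [inner_eq_sum, Finset.mul_sum]
    refine Finset.sum_congr rfl fun i _ => ?_
    conv_lhs => rw [eucl_eq_sum z]
    simp only [map_sum, map_smul]
    rw [← eucl_eq_sum z]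
    simp only [WithLp.ofLp_sum, WithLp.ofLp_smul, Finset.sum_apply, Pi.smul_apply, smul_eq_mul,
      Finset.mul_sum]
    exact Finset.sum_congr rfl fun j _ => by ring
  have hi := fun i j => (integrable_mul_fderiv_apply hΦ hc hv i
    (EuclideanSpace.single j 1)).mul_const (z i * z j)
  simp only [h1]
  rw [integral_finsetSum _ fun i _ => integrable_finsetSum _ fun j _ => hi i j]
  refine Finset.sum_congr rfl fun i _ => ?_
  rw [integral_finsetSum _ fun j _ => hi i j]
  exact Finset.sum_congr rfl fun j _ => integral_mul_const _ _

theorem integral_inner_sq_eq_sum {Φ : Eucl N → Eucl N} (hΦ : Continuous Φ)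
    (hc : HasCompactSupport Φ) (z : Eucl N) :
    ∫ x, (⟪z, Φ x⟫ : ℝ) ^ 2 = ∑ i, ∑ j, (∫ x, Φ x i * Φ x j) * (z i * z j) := by
  have hΦi : ∀ i, MemLp (fun x => Φ x i) 2 volume := fun i =>
    (by fun_prop : Continuous fun x => Φ x i).memLp_of_hasCompactSupport
      (hc.comp_left (g := fun y : Eucl N => y i) (by simp))
  have hi : ∀ i j, Integrable fun x => Φ x i * Φ x j * (z i * z j) := fun i j =>
    (MemLp.integrable_mul (p := 2) (q := 2) (hΦi i) (hΦi j)).mul_const _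
  have h1 : ∀ x, (⟪z, Φ x⟫ : ℝ) ^ 2 = ∑ i, ∑ j, Φ x i * Φ x j * (z i * z j) := by
    intro x
    rw [inner_eq_sum, sq, Finset.sum_mul_sum]
    exact Finset.sum_congr rfl fun i _ => Finset.sum_congr rfl fun j _ => by ring
  simp only [h1]
  rw [integral_finsetSum _ fun i _ => integrable_finsetSum _ fun j _ => hi i j]
  refine Finset.sum_congr rfl fun i _ => ?_
  rw [integral_finsetSum _ fun j _ => hi i j]
  exact Finset.sum_congr rfl fun j _ => integral_mul_const _ _

/-- The tested increment is a quadratic form up to third order. -/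
theorem abs_testedIncr_add_le {Φ : Eucl N → Eucl N} (hΦ : ContDiff ℝ ∞ Φ)
    (hc : HasCompactSupport Φ) {L : ℝ≥0}
    (hL : ∀ x z, ‖Φ (x - z) - Φ x + fderiv ℝ Φ x z‖ ≤ L * ‖z‖ ^ 2) {v : Eucl N → ℝ}
    (hv : Integrable v) (z : Eucl N) :
    |testedIncr Φ v z + ∑ i, ∑ j,
      (∫ x, v x * fderiv ℝ Φ x (EuclideanSpace.single j 1) i) * (z i * z j)|
      ≤ (L * ∫ x, |v x|) * ‖z‖ ^ 3 := by
  have hi1 := integrable_testedIncr hΦ.continuous hc hv z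
  have hi2 : Integrable fun x => v x * (⟪z, fderiv ℝ Φ x z⟫ : ℝ) := by
    have hd : Continuous (fderiv ℝ Φ) := hΦ.continuous_fderiv (by simp)
    have hcont : Continuous fun x => (⟪z, fderiv ℝ Φ x z⟫ : ℝ) := by fun_prop
    obtain ⟨C, hC⟩ := (HasCompactSupport.comp_left (hc.fderiv ℝ)
      (g := fun A : Eucl N →L[ℝ] Eucl N => (⟪z, A z⟫ : ℝ)) (by simp)).exists_bound_of_continuous hcont
    exact hv.mul_bdd (c := C) hcont.aestronglyMeasurable (Eventually.of_forall hC)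
  rw [← integral_mul_inner_fderiv hΦ hc hv, testedIncr, ← integral_add hi1 hi2]
  have h1 : ∀ x, ‖v x * (⟪z, Φ (x - z) - Φ x⟫ : ℝ) + v x * (⟪z, fderiv ℝ Φ x z⟫ : ℝ)‖
      ≤ |v x| * (L * ‖z‖ ^ 3) := by
    intro x
    rw [← mul_add, ← inner_add_right, norm_mul, Real.norm_eq_abs]
    gcongr
    refine (norm_inner_le_norm _ _).trans ?_
    calc ‖z‖ * ‖Φ (x - z) - Φ x + fderiv ℝ Φ x z‖ ≤ ‖z‖ * (L * ‖z‖ ^ 2) := by gcongr; exact hL x z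
      _ = L * ‖z‖ ^ 3 := by ring
  have h2 := norm_integral_le_of_norm_le (hv.abs.mul_const _) (Eventually.of_forall h1)
  rw [integral_mul_const] at h2
  calc _ ≤ _ := h2
    _ = _ := by ring

theorem tendsto_integral_abs_sub {Ω : Set (Eucl N)} (hΩ : MeasurableSet Ω) (hfin : volume Ω ≠ ⊤)
    {u : ℕ → Eucl N → ℝ} {w : Eucl N → ℝ} (hu : ∀ k, MemLp (u k) 2 (volume.restrict Ω))
    (hw : MemLp w 2 (volume.restrict Ω))
    (h : Tendsto (fun k => eLpNorm (u k - w) 2 (volume.restrict Ω)) atTop (𝓝 0)) :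
    Tendsto (fun k => ∫ x, |Ω.indicator (u k) x - Ω.indicator w x|) atTop (𝓝 0) := by
  have hfm : IsFiniteMeasure (volume.restrict Ω) := ⟨by simpa using hfin.lt_top⟩
  have h1 : ∀ k, ∫ x, |Ω.indicator (u k) x - Ω.indicator w x|
      = (eLpNorm (u k - w) 1 (volume.restrict Ω)).toReal := by
    intro k
    rw [eLpNorm_one_eq_lintegral_enorm,
      ← integral_norm_eq_lintegral_enorm ((hu k).sub hw).aestronglyMeasurable,
      ← integral_indicator hΩ]
    congr 1
    ext x
    by_cases hx : x ∈ Ω <;> simp [hx]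
  simp only [h1]
  have h2 : Tendsto (fun k => eLpNorm (u k - w) 2 (volume.restrict Ω) *
      (volume.restrict Ω) univ ^ (1 / (1 : ℝ≥0∞).toReal - 1 / (2 : ℝ≥0∞).toReal)) atTop (𝓝 0) := by
    have := ENNReal.Tendsto.mul_const (b := (volume.restrict Ω) univ ^
      (1 / (1 : ℝ≥0∞).toReal - 1 / (2 : ℝ≥0∞).toReal)) h
      (Or.inr (ENNReal.rpow_ne_top_of_nonneg (by norm_num) (measure_ne_top _ _)))
    rwa [zero_mul] at this
  have h3 : Tendsto (fun k => eLpNorm (u k - w) 1 (volume.restrict Ω)) atTop (𝓝 0) :=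
    tendsto_of_tendsto_of_tendsto_of_le_of_le tendsto_const_nhds h2 (fun _ => zero_le)
      fun k => eLpNorm_le_eLpNorm_mul_rpow_measure_univ one_le_two
        ((hu k).sub hw).aestronglyMeasurable
  exact (ENNReal.tendsto_toReal ENNReal.zero_ne_top).comp h3

theorem testedIncr_sub {Φ : Eucl N → Eucl N} (hΦ : Continuous Φ) (hc : HasCompactSupport Φ)
    {v w : Eucl N → ℝ} (hv : Integrable v) (hw : Integrable w) (z : Eucl N) :
    testedIncr Φ v z - testedIncr Φ w z = testedIncr Φ (fun x => v x - w x) z := by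
  rw [testedIncr, testedIncr, testedIncr, ← integral_sub (integrable_testedIncr hΦ hc hv z)
    (integrable_testedIncr hΦ hc hw z)]
  congr 1; ext x; ring

/-- Lower bound on the energies, tested against one vector field. -/
theorem two_mul_divergence_sub_le [NeZero N] {Ω : Set (Eucl N)} (hΩ : IsOpen Ω)
    (hfin : volume Ω ≠ ⊤) {s : ℕ → ℝ} (hs : Tendsto s atTop (𝓝[<] 1))
    {u : ℕ → Eucl N → ℝ} (hu : ∀ k, MemHs Ω (s k) (u k)) {w : Eucl N → ℝ}
    (hw : MemLp w 2 (volume.restrict Ω))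
    (huw : Tendsto (fun k => eLpNorm (u k - w) 2 (volume.restrict Ω)) atTop (𝓝 0))
    {m : ℕ → ℝ} {M : ℝ} (hm : ∀ k, fracConst N (s k) / 2 * (gagliardoSq Ω (s k) (u k)).toReal ≤ m k)
    (hM : Tendsto m atTop (𝓝 M)) {Φ : Eucl N → Eucl N} (hΦ : Φ ∈ testFields Ω) :
    2 * (-∫ x in Ω, w x * divergence Φ x) - ∫ x, ‖Φ x‖ ^ 2 ≤ M := by
  obtain ⟨hΦs, hc, hsupp⟩ := hΦ
  have hΩm := hΩ.measurableSet
  obtain ⟨L, hL, hL2⟩ := exists_taylor_bound hΦs hc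
  obtain ⟨δ, hδ, hδΩ⟩ := hc.isCompact.exists_thickening_subset_open hΩ hsupp
  have hz : ∀ z ∈ Metric.ball (0 : Eucl N) δ, ∀ x ∈ tsupport Φ, x ∈ Ω ∧ x + z ∈ Ω := by
    intro z hz x hx
    refine ⟨hsupp hx, hδΩ (Metric.mem_thickening_iff.mpr ⟨x, hx, ?_⟩)⟩
    simpa using hz
  have hvk := fun k => integrable_indicator_of_memLp hΩm hfin (hu k).memLp
  have hv := integrable_indicator_of_memLp hΩm hfin hw
  -- A is the quadratic form in z that approximates the tested increments of w; its trace is the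
  -- left side of the claim.
  set A : Fin N → Fin N → ℝ := fun i j =>
    2 * (-∫ x, Ω.indicator w x * fderiv ℝ Φ x (EuclideanSpace.single j 1) i)
      - ∫ x, Φ x i * Φ x j with hA
  have hlim := (tendsto_setIntegral_ball_quadratic hδ A).comp hs
  have hA1 : ∑ i, A i i = 2 * (-∫ x in Ω, w x * divergence Φ x) - ∫ x, ‖Φ x‖ ^ 2 := by
    have e1 : ∫ x in Ω, w x * divergence Φ x
        = ∑ i, ∫ x, Ω.indicator w x * fderiv ℝ Φ x (EuclideanSpace.single i 1) i := by
      rw [← integral_indicator hΩm, ← integral_finsetSum _ fun i _ =>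
        integrable_mul_fderiv_apply hΦs hc hv i _]
      congr 1; ext x
      by_cases hx : x ∈ Ω
      · simp [hx, divergence, Finset.mul_sum]
      · simp [hx]
    have e2 : ∫ x, ‖Φ x‖ ^ 2 = ∑ i, ∫ x, Φ x i * Φ x i := by
      rw [← integral_finsetSum]
      · congr 1; ext x
        rw [EuclideanSpace.norm_sq_eq]
        exact Finset.sum_congr rfl fun i _ => by rw [Real.norm_eq_abs, sq_abs, sq]
      · intro i _
        have : MemLp (fun x => Φ x i) 2 volume :=
          (by have := hΦs.continuous; fun_prop : Continuous fun x => Φ x i).memLp_of_hasCompactSupport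
            (hc.comp_left (g := fun y : Eucl N => y i) (by simp))
        exact MemLp.integrable_mul (p := 2) (q := 2) this this
    rw [e1, e2]
    simp only [hA, Finset.sum_sub_distrib, ← Finset.mul_sum, Finset.sum_neg_distrib]
  rw [hA1] at hlim
  have hD := tendsto_integral_abs_sub hΩm hfin (fun k => (hu k).memLp) hw huw
  set dk : ℕ → ℝ := fun k => ∫ x, |Ω.indicator (u k) x - Ω.indicator w x| with hdk
  set W := ∫ x, |Ω.indicator w x| with hW
  have hm2 := (tendsto_second_moment (N := N) hδ).comp hs
  have hm3 := (tendsto_third_moment (N := N) hδ).comp hs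
  have herr := (hD.const_mul (2 * L : ℝ)).mul hm2 |>.add (hm3.const_mul (2 * (L * W)))
  have hfinal := hM.add herr
  simp only [mul_zero, zero_mul, add_zero] at hfinal
  refine le_of_tendsto_of_tendsto hlim hfinal ?_
  have hev := hs.eventually (eventually_mem_Ioo_half.and (eventually_fracConst_pos (N := N)))
  filter_upwards [hev] with k hk
  obtain ⟨hsk, hck⟩ := hk
  have h2k : 2 * s k < (2 : ℕ) := by push_cast; linarith [hsk.2]
  have h3k : 2 * s k < (3 : ℕ) := by push_cast; linarith [hsk.2]
  have hcore := setIntegral_testedIncr_le_gagliardo hΩ hfin hL hc hz hsk (hu k)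
  -- Three parts: f1 is the error of replacing u k by w, of size ‖z‖² times an L¹ distance tending
  -- to 0; f2 is the Taylor remainder, of size ‖z‖³; f3 is the quadratic form. The second and third
  -- moment limits remove f1 and f2.
  set f1 : Eucl N → ℝ := fun z => 2 * testedIncr Φ
    (fun x => Ω.indicator (u k) x - Ω.indicator w x) z with hf1
  set f2 : Eucl N → ℝ := fun z => 2 * (testedIncr Φ (Ω.indicator w) z + ∑ i, ∑ j,
    (∫ x, Ω.indicator w x * fderiv ℝ Φ x (EuclideanSpace.single j 1) i) * (z i * z j)) with hf2
  set f3 : Eucl N → ℝ := fun z => ∑ i, ∑ j, A i j * (z i * z j) with hf3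
  have hsplit : ∀ z, 2 * testedIncr Φ (Ω.indicator (u k)) z - ∫ x, (⟪z, Φ x⟫ : ℝ) ^ 2
      = f1 z + f2 z + f3 z := by
    intro z
    simp only [hf1, hf2, hf3]
    rw [← testedIncr_sub hΦs.continuous hc (hvk k) hv, integral_inner_sq_eq_sum hΦs.continuous hc]
    simp only [hA, sub_mul, Finset.sum_sub_distrib, mul_neg, neg_mul, Finset.sum_neg_distrib,
      mul_assoc, ← Finset.mul_sum]
    ring
  have b1 : ∀ z ∈ Metric.ball (0 : Eucl N) δ, |f1 z| ≤ (2 * (L * dk k)) * ‖z‖ ^ 2 := by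
    intro z _
    have := abs_testedIncr_le hL ((hvk k).sub hv) z
    simp only [hf1, abs_mul, abs_two]
    calc _ ≤ 2 * ((L * dk k) * ‖z‖ ^ 2) := by gcongr; exact this
      _ = _ := by ring
  have b2 : ∀ z ∈ Metric.ball (0 : Eucl N) δ, |f2 z| ≤ (2 * (L * W)) * ‖z‖ ^ 3 := by
    intro z _
    have := abs_testedIncr_add_le hΦs hc hL2 hv z
    simp only [hf2, abs_mul, abs_two]
    calc _ ≤ 2 * ((L * W) * ‖z‖ ^ 3) := by gcongr
      _ = _ := by ring
  have m1 : AEStronglyMeasurable f1 volume :=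
    (aestronglyMeasurable_testedIncr hΦs.continuous ((hvk k).sub hv).aestronglyMeasurable).const_mul 2
  have m2 : AEStronglyMeasurable f2 volume := by
    refine ((aestronglyMeasurable_testedIncr hΦs.continuous hv.aestronglyMeasurable).add ?_).const_mul 2
    exact Continuous.aestronglyMeasurable (by fun_prop)
  have m3 : AEStronglyMeasurable f3 volume := Continuous.aestronglyMeasurable (by fun_prop)
  have i1 := integrableOn_ball_mul_kern h2k m1.restrict b1
  have i2 := integrableOn_ball_mul_kern h3k m2.restrict b2
  have i3 : IntegrableOn (fun z => f3 z * kern (s k) z) (Metric.ball (0 : Eucl N) δ) := by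
    refine integrableOn_ball_mul_kern (C := ∑ i, ∑ j, |A i j|) h2k m3.restrict fun z _ => ?_
    simp only [hf3, Finset.sum_mul]
    refine (Finset.abs_sum_le_sum_abs _ _).trans (Finset.sum_le_sum fun i _ => ?_)
    refine (Finset.abs_sum_le_sum_abs _ _).trans (Finset.sum_le_sum fun j _ => ?_)
    rw [abs_mul, abs_mul, sq]
    gcongr
    · exact abs_apply_le_norm z i
    · exact abs_apply_le_norm z j
  have e1 := abs_setIntegral_ball_mul_kern_le h2k hδ b1
  have e2 := abs_setIntegral_ball_mul_kern_le h3k hδ b2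
  have hint : ∫ z in Metric.ball (0 : Eucl N) δ,
      (2 * testedIncr Φ (Ω.indicator (u k)) z - ∫ x, (⟪z, Φ x⟫ : ℝ) ^ 2) * kern (s k) z
      = (∫ z in Metric.ball (0 : Eucl N) δ, f1 z * kern (s k) z)
        + (∫ z in Metric.ball (0 : Eucl N) δ, f2 z * kern (s k) z)
        + ∫ z in Metric.ball (0 : Eucl N) δ, f3 z * kern (s k) z := by
    have : ∀ z, (2 * testedIncr Φ (Ω.indicator (u k)) z - ∫ x, (⟪z, Φ x⟫ : ℝ) ^ 2) * kern (s k) z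
        = f1 z * kern (s k) z + f2 z * kern (s k) z + f3 z * kern (s k) z := fun z => by
      rw [hsplit]; ring
    simp only [this]
    have i12 : IntegrableOn (fun z => f1 z * kern (s k) z + f2 z * kern (s k) z)
        (Metric.ball (0 : Eucl N) δ) := i1.add i2
    rw [integral_add i12 i3, integral_add i1 i2]
  rw [hint] at hcore
  simp only [Function.comp]
  have hc2 : 0 < fracConst N (s k) / 2 := by positivity
  have g1 := neg_le_of_abs_le e1
  have g2 := neg_le_of_abs_le e2
  have hmk := hm k
  have h7 : fracConst N (s k) / 2 * ∫ z in Metric.ball (0 : Eucl N) δ, f3 z * kern (s k) z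
      ≤ fracConst N (s k) / 2 * ((gagliardoSq Ω (s k) (u k)).toReal
        + 2 * (L * dk k) * (sphereArea N * (δ ^ (((2 : ℕ) : ℝ) - 2 * s k) / (((2 : ℕ) : ℝ) - 2 * s k)))
        + 2 * (L * W) * (sphereArea N * (δ ^ (((3 : ℕ) : ℝ) - 2 * s k) / (((3 : ℕ) : ℝ) - 2 * s k)))) := by
    gcongr
    linarith
  refine h7.trans ?_
  rw [mul_add, mul_add]
  push_cast
  refine le_trans (add_le_add (add_le_add hmk le_rfl) le_rfl) (le_of_eq ?_)
  ring

theorem memLp_testField {Ω : Set (Eucl N)} {Φ : Eucl N → Eucl N} (hΦ : Φ ∈ testFields Ω) :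
    MemLp Φ 2 (volume.restrict Ω) :=
  (hΦ.1.continuous.memLp_of_hasCompactSupport hΦ.2.1).restrict Ω

theorem integrableOn_mul_divergence {Ω : Set (Eucl N)} (hΩ : MeasurableSet Ω) (hfin : volume Ω ≠ ⊤)
    {w : Eucl N → ℝ} (hw : MemLp w 2 (volume.restrict Ω)) {Φ : Eucl N → Eucl N}
    (hΦ : Φ ∈ testFields Ω) : IntegrableOn (fun x => w x * divergence Φ x) Ω := by
  have hv := integrable_indicator_of_memLp hΩ hfin hw
  have h1 : Integrable fun x => ∑ i, Ω.indicator w x * fderiv ℝ Φ x (EuclideanSpace.single i 1) i :=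
    integrable_finsetSum _ fun i _ => integrable_mul_fderiv_apply hΦ.1 hΦ.2.1 hv i _
  refine h1.integrableOn.congr_fun (fun x hx => ?_) hΩ
  simp [hx, divergence, Finset.mul_sum]

/-- Lower semicontinuity of the energies as `s → 1`: an `L²(Ω)` limit of functions of bounded
energy lies in `H¹(Ω)`. -/
theorem exists_H1Gradient_of_tendsto [NeZero N] {Ω : Set (Eucl N)} (hΩ : IsOpen Ω)
    (hfin : volume Ω ≠ ⊤) {s : ℕ → ℝ} (hs : Tendsto s atTop (𝓝[<] 1))
    {u : ℕ → Eucl N → ℝ} (hu : ∀ k, MemHs Ω (s k) (u k)) {w : Eucl N → ℝ}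
    (hw : MemLp w 2 (volume.restrict Ω))
    (huw : Tendsto (fun k => eLpNorm (u k - w) 2 (volume.restrict Ω)) atTop (𝓝 0))
    {m : ℕ → ℝ} {M : ℝ} (hm : ∀ k, fracConst N (s k) / 2 * (gagliardoSq Ω (s k) (u k)).toReal ≤ m k)
    (hM : Tendsto m atTop (𝓝 M)) :
    ∃ g, HasH1Gradient Ω w g ∧ ∫ x in Ω, ‖g x‖ ^ 2 ≤ M := by
  have hΩm := hΩ.measurableSet
  let ι : testFields Ω →ₗ[ℝ] Lp (Eucl N) 2 (volume.restrict Ω) :=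
    { toFun := fun Φ => (memLp_testField Φ.2).toLp
      map_add' := fun Φ Ψ => rfl
      map_smul' := fun c Φ => rfl }
  have hdiff : ∀ Φ : testFields Ω, Differentiable ℝ (Φ : Eucl N → Eucl N) := fun Φ =>
    Φ.2.1.differentiable (by simp)
  let ℓ : testFields Ω →ₗ[ℝ] ℝ :=
    { toFun := fun Φ => -∫ x in Ω, w x * divergence Φ x
      map_add' := fun Φ Ψ => by
        rw [← neg_add, ← integral_add (integrableOn_mul_divergence hΩm hfin hw Φ.2)
          (integrableOn_mul_divergence hΩm hfin hw Ψ.2)]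
        congr 2
        ext x
        have h1 : fderiv ℝ ((Φ + Ψ : testFields Ω) : Eucl N → Eucl N) x
            = fderiv ℝ Φ x + fderiv ℝ Ψ x := fderiv_add (hdiff Φ x) (hdiff Ψ x)
        simp only [divergence, h1, add_apply, PiLp.add_apply,
          Finset.sum_add_distrib]
        ring
      map_smul' := fun c Φ => by
        simp only [RingHom.id_apply, smul_eq_mul]
        rw [mul_neg, ← integral_const_mul]
        congr 2
        ext x
        have h1 : fderiv ℝ ((c • Φ : testFields Ω) : Eucl N → Eucl N) x = c • fderiv ℝ Φ x :=
          fderiv_const_smul (hdiff Φ x) c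
        simp only [divergence, h1, smul_apply, PiLp.smul_apply, smul_eq_mul,
          ← Finset.mul_sum]
        ring }
  -- The bounds 2ℓ(Φ) - ‖Φ‖² ≤ M for all test fields say that the distributional gradient of w is
  -- bounded in L², so it is represented by some g with ‖g‖² ≤ M.
  obtain ⟨g, hgM, hg⟩ := exists_riesz_of_quadratic_bound ι ℓ M (fun Φ => by
    have h1 := two_mul_divergence_sub_le hΩ hfin hs hu hw huw hm hM Φ.2
    have h2 : ‖ι Φ‖ ^ 2 = ∫ x, ‖(Φ : Eucl N → Eucl N) x‖ ^ 2 := by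
      rw [← real_inner_self_eq_norm_sq, L2.inner_def]
      have h3 : ∫ x in Ω, ‖(Φ : Eucl N → Eucl N) x‖ ^ 2 = ∫ x, ‖(Φ : Eucl N → Eucl N) x‖ ^ 2 := by
        refine setIntegral_eq_integral_of_forall_compl_eq_zero fun x hx => ?_
        have : x ∉ tsupport (Φ : Eucl N → Eucl N) := fun h => hx (Φ.2.2.2 h)
        simp [image_eq_zero_of_notMem_tsupport this]
      rw [← h3]
      refine integral_congr_ae ?_
      filter_upwards [(memLp_testField Φ.2).coeFn_toLp] with x hx
      have : (ι Φ : Eucl N → Eucl N) x = (Φ : Eucl N → Eucl N) x := hx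
      rw [this, real_inner_self_eq_norm_sq]
    rw [h2]
    exact h1)
  refine ⟨g, ⟨hw, Lp.memLp g, fun φ hφ hφc hφΩ e => ?_⟩, ?_⟩
  -- The scalar weak gradient identity is the case of the field φ e, whose divergence is the
  -- derivative of φ along e.
  · have hΦmem : (fun x => φ x • e) ∈ testFields Ω :=
      ⟨hφ.smul contDiff_const, hφc.smul_right, (tsupport_smul_subset_left φ _).trans hφΩ⟩
    have h1 := hg ⟨_, hΦmem⟩
    have h2 : ∀ x, divergence (fun x => φ x • e) x = fderiv ℝ φ x e := by
      intro x
      have hd : HasFDerivAt (fun x => φ x • e) ((fderiv ℝ φ x).smulRight e) x :=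
        (hφ.differentiable (by simp) x).hasFDerivAt.smul_const e
      rw [divergence, hd.fderiv]
      conv_rhs => rw [eucl_eq_sum e, map_sum]
      simp [mul_comm]
    have h3 : ℓ ⟨_, hΦmem⟩ = -∫ x in Ω, w x * fderiv ℝ φ x e := by
      simp only [ℓ, LinearMap.coe_mk, AddHom.coe_mk, h2]
    have h4 : (⟪g, ι ⟨_, hΦmem⟩⟫ : ℝ) = ∫ x in Ω, (⟪g x, e⟫ : ℝ) * φ x := by
      rw [L2.inner_def]
      refine integral_congr_ae ?_
      filter_upwards [(memLp_testField hΦmem).coeFn_toLp] with x hx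
      have : (ι ⟨_, hΦmem⟩ : Eucl N → Eucl N) x = φ x • e := hx
      rw [this, inner_smul_right, mul_comm]
    rw [h3, h4] at h1
    linarith
  · rw [← real_inner_self_eq_norm_sq, L2.inner_def] at hgM
    simpa only [real_inner_self_eq_norm_sq] using hgM

end LowerBound

/-! ### Convergence of the energies of smooth functions -/

section Smooth

variable {N : ℕ}

/-- The weighted squared increment of `v` at `x`; pairs leaving `C` are counted twice. -/
def wIncr (C : Set (Eucl N)) (v : Eucl N → ℝ) (x z : Eucl N) : ℝ :=
  (v (x + z) - v x) ^ 2 * (1 + Cᶜ.indicator 1 (x + z))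

theorem interactionSet_eq (Ω : Set (Eucl N)) :
    interactionSet Ω = closure Ω ×ˢ univ ∪ (closure Ω)ᶜ ×ˢ closure Ω := by
  ext p
  simp only [interactionSet, mem_compl_iff, mem_prod, mem_union, mem_univ, and_true]
  tauto

/-- The pairs with first point outside the closure are swapped, by symmetry of G. All pairs then
start in the closure, and those ending outside it are counted twice. -/
theorem lintegral_interactionSet_eq {Ω : Set (Eucl N)} {G : Eucl N × Eucl N → ℝ≥0∞}
    (hG : Measurable G) (hsymm : ∀ p, G p.swap = G p) :
    ∫⁻ p in interactionSet Ω, G p = ∫⁻ x in closure Ω, ∫⁻ z,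
      G (x, x + z) * (1 + (closure Ω)ᶜ.indicator 1 (x + z)) := by
  set C := closure Ω with hC
  have hCm : MeasurableSet C := isClosed_closure.measurableSet
  have hdisj : Disjoint (C ×ˢ (univ : Set (Eucl N))) (Cᶜ ×ˢ C) := by
    rw [Set.disjoint_left]
    rintro p ⟨h1, -⟩ ⟨h2, -⟩
    exact h2 h1
  have hswap : ∫⁻ p in Cᶜ ×ˢ C, G p = ∫⁻ p in C ×ˢ Cᶜ, G p := by
    have hmp : MeasurePreserving (Prod.swap : Eucl N × Eucl N → Eucl N × Eucl N)
      (volume.prod volume) (volume.prod volume) := Measure.measurePreserving_swap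
    have := hmp.setLIntegral_comp_preimage (hCm.compl.prod hCm) hG
    have h2 : (Prod.swap : Eucl N × Eucl N → Eucl N × Eucl N) ⁻¹' (Cᶜ ×ˢ C) = C ×ˢ Cᶜ := by
      ext p; simp
    rw [h2] at this
    simp only [hsymm] at this
    exact this.symm
  have hind : Measurable (Cᶜ.indicator (1 : Eucl N → ℝ≥0∞)) :=
    measurable_one.indicator hCm.compl
  rw [interactionSet_eq, lintegral_union (hCm.compl.prod hCm) hdisj, hswap]
  have e1 : ∫⁻ p in C ×ˢ (univ : Set (Eucl N)), G p = ∫⁻ x in C, ∫⁻ y, G (x, y) := by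
    have : (volume : Measure (Eucl N × Eucl N)).restrict (C ×ˢ univ)
        = (volume.restrict C).prod volume := by
      rw [Measure.volume_eq_prod, ← Measure.prod_restrict, Measure.restrict_univ]
    rw [this, lintegral_prod _ hG.aemeasurable]
  have e2 : ∫⁻ p in C ×ˢ Cᶜ, G p = ∫⁻ x in C, ∫⁻ y, G (x, y) * Cᶜ.indicator 1 y := by
    have : (volume : Measure (Eucl N × Eucl N)).restrict (C ×ˢ Cᶜ)
        = (volume.restrict C).prod (volume.restrict Cᶜ) := by
      rw [Measure.volume_eq_prod, ← Measure.prod_restrict]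
    rw [this, lintegral_prod _ hG.aemeasurable]
    refine lintegral_congr fun x => ?_
    rw [← lintegral_indicator hCm.compl]
    refine lintegral_congr fun y => ?_
    by_cases hy : y ∈ Cᶜ <;> simp [hy]
  rw [e1, e2, ← lintegral_add_left hG.lintegral_prod_right']
  refine lintegral_congr fun x => ?_
  have hGx : Measurable fun y => G (x, y) := hG.comp measurable_prodMk_left
  rw [← lintegral_add_left hGx,
    ← lintegral_add_left_eq_self (fun y => G (x, y) + G (x, y) * Cᶜ.indicator 1 y) x]
  refine lintegral_congr fun z => ?_
  rw [mul_add, mul_one]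

theorem gagliardoSq_eq_lintegral_wIncr {Ω : Set (Eucl N)} (s : ℝ) {v : Eucl N → ℝ}
    (hv : Measurable v) :
    gagliardoSq Ω s v = ∫⁻ x in closure Ω, ∫⁻ z,
      ENNReal.ofReal (wIncr (closure Ω) v x z * kern s z) := by
  have h1 : Measurable fun p : Eucl N × Eucl N => v p.1 := hv.comp measurable_fst
  have h2 : Measurable fun p : Eucl N × Eucl N => v p.2 := hv.comp measurable_snd
  rw [gagliardoSq, lintegral_interactionSet_eq (by fun_prop) (fun p => by
    simp only [Prod.fst_swap, Prod.snd_swap]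
    rw [norm_sub_rev, ← neg_sub (v p.1), neg_sq])]
  refine lintegral_congr fun x => lintegral_congr fun z => ?_
  simp only [sub_add_cancel_left, norm_neg]
  have h3 : (1 + (closure Ω)ᶜ.indicator 1 (x + z) : ℝ≥0∞)
      = ENNReal.ofReal (1 + (closure Ω)ᶜ.indicator 1 (x + z)) := by
    by_cases h : x + z ∈ (closure Ω)ᶜ
    · rw [indicator_of_mem h, indicator_of_mem h, ENNReal.ofReal_add (by simp) (by simp)]
      simp
    · rw [indicator_of_notMem h, indicator_of_notMem h]; simp
  rw [h3, ← ENNReal.ofReal_mul (by positivity)]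
  congr 1
  rw [wIncr, kern, div_eq_mul_inv]
  ring

theorem wIncr_nonneg (C : Set (Eucl N)) (v : Eucl N → ℝ) (x z : Eucl N) : 0 ≤ wIncr C v x z := by
  unfold wIncr
  refine mul_nonneg (sq_nonneg _) (add_nonneg zero_le_one ?_)
  exact indicator_nonneg (fun _ _ => zero_le_one) _

theorem wIncr_le (C : Set (Eucl N)) (v : Eucl N → ℝ) (x z : Eucl N) :
    wIncr C v x z ≤ 2 * (v (x + z) - v x) ^ 2 := by
  unfold wIncr
  have : Cᶜ.indicator (1 : Eucl N → ℝ) (x + z) ≤ 1 :=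
    indicator_apply_le' (fun _ => le_rfl) (fun _ => zero_le_one)
  nlinarith [sq_nonneg (v (x + z) - v x)]

theorem measurable_wIncr {C : Set (Eucl N)} (hC : MeasurableSet C) {v : Eucl N → ℝ}
    (hv : Measurable v) : Measurable fun p : Eucl N × Eucl N => wIncr C v p.1 p.2 := by
  have h1 : Measurable fun p : Eucl N × Eucl N => v p.1 := hv.comp measurable_fst
  have h2 : Measurable fun p : Eucl N × Eucl N => v (p.1 + p.2) :=
    hv.comp (measurable_fst.add measurable_snd)
  have h3 : Measurable fun p : Eucl N × Eucl N => Cᶜ.indicator (1 : Eucl N → ℝ) (p.1 + p.2) :=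
    (measurable_one.indicator hC.compl).comp (measurable_fst.add measurable_snd)
  unfold wIncr
  fun_prop

/-- One constant serves near and far from the origin, uniformly in the base point; boundedness of v
controls large z and its Lipschitz constant small z. -/
theorem exists_wIncr_bound {v : Eucl N → ℝ} (hv : ContDiff ℝ ∞ v) (hc : HasCompactSupport v) :
    ∃ B : ℝ, ∀ (C : Set (Eucl N)) x z, |wIncr C v x z| ≤ B ∧ |wIncr C v x z| ≤ B * ‖z‖ ^ 2 := by
  obtain ⟨L, hL⟩ := hv.lipschitzWith_of_hasCompactSupport hc (by simp)
  obtain ⟨b, hb⟩ := hc.exists_bound_of_continuous hv.continuous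
  refine ⟨max (2 * (b + b) ^ 2) (2 * (L : ℝ) ^ 2), fun C x z => ?_⟩
  rw [abs_of_nonneg (wIncr_nonneg C v x z)]
  constructor
  · refine (wIncr_le C v x z).trans (le_trans ?_ (le_max_left _ _))
    have h1 := abs_le.mp (hb (x + z))
    have h2 := abs_le.mp (hb x)
    have : (v (x + z) - v x) ^ 2 ≤ (b + b) ^ 2 := sq_le_sq' (by linarith) (by linarith)
    linarith
  · have h1 := hL.dist_le_mul (x + z) x
    rw [Real.dist_eq, dist_self_add_left] at h1
    have h2 : (v (x + z) - v x) ^ 2 ≤ (L * ‖z‖) ^ 2 := by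
      rw [← sq_abs]; gcongr
    calc wIncr C v x z ≤ 2 * (v (x + z) - v x) ^ 2 := wIncr_le C v x z
      _ ≤ 2 * (L * ‖z‖) ^ 2 := by gcongr
      _ = 2 * (L : ℝ) ^ 2 * ‖z‖ ^ 2 := by ring
      _ ≤ _ := by gcongr; exact le_max_right _ _

theorem integrable_wIncr_mul_kern [NeZero N] {v : Eucl N → ℝ} (hv : ContDiff ℝ ∞ v)
    (hc : HasCompactSupport v) {C : Set (Eucl N)} (hC : MeasurableSet C) {s : ℝ} (hs0 : 0 < s)
    (hs : s < 1) (x : Eucl N) : Integrable fun z => wIncr C v x z * kern s z := by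
  obtain ⟨B, hB⟩ := exists_wIncr_bound hv hc
  exact integrable_mul_kern hs0 hs
    ((measurable_wIncr hC hv.continuous.measurable).comp measurable_prodMk_left).aestronglyMeasurable
    (fun z => (hB C x z).1) fun z => (hB C x z).2

theorem lintegral_wIncr_eq [NeZero N] {v : Eucl N → ℝ} (hv : ContDiff ℝ ∞ v)
    (hc : HasCompactSupport v) {C : Set (Eucl N)} (hC : MeasurableSet C) {s : ℝ} (hs0 : 0 < s)
    (hs : s < 1) (x : Eucl N) :
    ∫⁻ z, ENNReal.ofReal (wIncr C v x z * kern s z)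
      = ENNReal.ofReal (∫ z, wIncr C v x z * kern s z) :=
  (ofReal_integral_eq_lintegral_ofReal (integrable_wIncr_mul_kern hv hc hC hs0 hs x)
    (Eventually.of_forall fun z => mul_nonneg (wIncr_nonneg C v x z) (kern_nonneg s z))).symm

theorem memHs_of_contDiff [NeZero N] {Ω : Set (Eucl N)} (hΩ : Bornology.IsBounded Ω)
    {v : Eucl N → ℝ} (hv : ContDiff ℝ ∞ v) (hc : HasCompactSupport v) {s : ℝ} (hs0 : 0 < s)
    (hs : s < 1) : MemHs Ω s v := by
  refine ⟨hv.continuous.measurable.aemeasurable,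
    (hv.continuous.memLp_of_hasCompactSupport hc).restrict Ω, ?_⟩
  rw [gagliardoSq_eq_lintegral_wIncr s hv.continuous.measurable]
  obtain ⟨B, hB⟩ := exists_wIncr_bound hv hc
  have hCm : MeasurableSet (closure Ω) := isClosed_closure.measurableSet
  refine lt_of_le_of_lt (lintegral_mono (g := fun _ => ENNReal.ofReal
    (B * (sphereArea N * (1 ^ (2 - 2 * s) / (2 - 2 * s)))
      + B * (sphereArea N * (1 ^ (-(2 * s)) / (2 * s))))) fun x => ?_) ?_
  · rw [lintegral_wIncr_eq hv hc hCm hs0 hs]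
    refine ENNReal.ofReal_le_ofReal ((le_abs_self _).trans (abs_integral_mul_kern_le hs0 hs
      ?_ (fun z => (hB _ x z).1) fun z => (hB _ x z).2))
    exact ((measurable_wIncr hCm hv.continuous.measurable).comp
      measurable_prodMk_left).aestronglyMeasurable
  · rw [lintegral_const, Measure.restrict_apply MeasurableSet.univ, univ_inter]
    exact ENNReal.mul_lt_top ENNReal.ofReal_lt_top hΩ.closure.measure_lt_top

theorem toReal_gagliardoSq_eq [NeZero N] {Ω : Set (Eucl N)}
    {v : Eucl N → ℝ} (hv : ContDiff ℝ ∞ v) (hc : HasCompactSupport v) {s : ℝ} (hs0 : 0 < s)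
    (hs : s < 1) :
    (gagliardoSq Ω s v).toReal = ∫ x in closure Ω, ∫ z, wIncr (closure Ω) v x z * kern s z := by
  have hCm : MeasurableSet (closure Ω) := isClosed_closure.measurableSet
  rw [gagliardoSq_eq_lintegral_wIncr s hv.continuous.measurable]
  simp only [lintegral_wIncr_eq hv hc hCm hs0 hs]
  rw [integral_eq_lintegral_of_nonneg_ae]
  · exact Eventually.of_forall fun x => integral_nonneg fun z =>
      mul_nonneg (wIncr_nonneg _ v x z) (kern_nonneg s z)
  · have h1 : Measurable fun p : Eucl N × Eucl N => wIncr (closure Ω) v p.1 p.2 * kern s p.2 :=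
      (measurable_wIncr hCm hv.continuous.measurable).mul ((measurable_kern s).comp measurable_snd)
    exact (h1.stronglyMeasurable.integral_prod_right').aestronglyMeasurable

theorem inner_gradient (v : Eucl N → ℝ) (x z : Eucl N) : (⟪gradient v x, z⟫ : ℝ) = fderiv ℝ v x z := by
  rw [gradient, InnerProductSpace.toDual_symm_apply]

theorem norm_gradient (v : Eucl N → ℝ) (x : Eucl N) : ‖gradient v x‖ = ‖fderiv ℝ v x‖ := by
  rw [gradient, LinearIsometryEquiv.norm_map]

theorem exists_scalar_taylor_bound {v : Eucl N → ℝ} (hv : ContDiff ℝ ∞ v)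
    (hc : HasCompactSupport v) :
    ∃ L : ℝ≥0, LipschitzWith L v ∧ ∀ x z, |v (x + z) - v x - fderiv ℝ v x z| ≤ L * ‖z‖ ^ 2 := by
  obtain ⟨L₁, h₁⟩ := hv.lipschitzWith_of_hasCompactSupport hc (by simp)
  obtain ⟨L₂, h₂⟩ := (hv.fderiv_right (m := ∞) (by simp)).lipschitzWith_of_hasCompactSupport
    (hc.fderiv ℝ) (by simp)
  refine ⟨max L₁ L₂, h₁.weaken (le_max_left _ _), fun x z => ?_⟩
  have h3 : ‖v (x + z) - v x - fderiv ℝ v x (x + z - x)‖ ≤ (L₂ * ‖z‖) * ‖x + z - x‖ := by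
    refine (convex_closedBall x ‖z‖).norm_image_sub_le_of_norm_hasFDerivWithin_le'
      (f' := fderiv ℝ v) (fun y _ => (hv.differentiable (by simp) y).hasFDerivAt.hasFDerivWithinAt)
      (fun y hy => ?_) (Metric.mem_closedBall_self (norm_nonneg z)) (by simp)
    have := h₂.dist_le_mul y x
    rw [dist_eq_norm] at this
    refine this.trans ?_
    gcongr
    exact hy
  rw [add_sub_cancel_left] at h3
  refine h3.trans ?_
  have : (L₂ : ℝ) ≤ (max L₁ L₂ : ℝ≥0) := by exact_mod_cast le_max_right L₁ L₂
  calc (L₂ : ℝ) * ‖z‖ * ‖z‖ = L₂ * ‖z‖ ^ 2 := by ring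
    _ ≤ _ := by gcongr

/-- For x in the open set Ω and small z the point x + z stays in Ω, so the double weight is absent.
First-order Taylor expansion leaves an error O(‖z‖³), which is at most ε ‖z‖² on a small ball. -/
theorem wIncr_sub_inner_sq_le {Ω : Set (Eucl N)} (hΩ : IsOpen Ω) {v : Eucl N → ℝ}
    (hv : ContDiff ℝ ∞ v) (hc : HasCompactSupport v) {x : Eucl N} (hx : x ∈ Ω) {ε : ℝ}
    (hε : 0 < ε) : ∃ δ > 0, ∀ z ∈ Metric.ball (0 : Eucl N) δ,
      |wIncr (closure Ω) v x z - (⟪gradient v x, z⟫ : ℝ) ^ 2| ≤ ε * ‖z‖ ^ 2 := by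
  obtain ⟨L, hL, hT⟩ := exists_scalar_taylor_bound hv hc
  obtain ⟨δ, hδ, hball⟩ := Metric.isOpen_iff.mp hΩ x hx
  set a := ‖gradient v x‖ with ha
  have ha0 : 0 ≤ a := norm_nonneg _
  refine ⟨min δ (ε / (L * (L + a) + 1)), lt_min hδ (by positivity), fun z hz => ?_⟩
  have hz0 : ‖z‖ < min δ (ε / (L * (L + a) + 1)) := by simpa using hz
  have hzδ : ‖z‖ < δ := hz0.trans_le (min_le_left _ _)
  have hzε : ‖z‖ * (L * (L + a) + 1) < ε := by
    rw [← lt_div_iff₀ (by positivity)]; exact hz0.trans_le (min_le_right _ _)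
  have hmem : x + z ∉ (closure Ω)ᶜ := fun h => h (subset_closure (hball (by simpa using hzδ)))
  have hw : wIncr (closure Ω) v x z = (v (x + z) - v x) ^ 2 := by
    rw [wIncr, indicator_of_notMem hmem, add_zero, mul_one]
  rw [hw, inner_gradient, sq_sub_sq, abs_mul]
  have h1 : |v (x + z) - v x| ≤ L * ‖z‖ := by
    have := hL.dist_le_mul (x + z) x
    rwa [Real.dist_eq, dist_self_add_left] at this
  have h2 : |fderiv ℝ v x z| ≤ a * ‖z‖ := by
    rw [ha, norm_gradient]; exact (fderiv ℝ v x).le_opNorm z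
  calc |v (x + z) - v x + fderiv ℝ v x z| * |v (x + z) - v x - fderiv ℝ v x z|
      ≤ (L * ‖z‖ + a * ‖z‖) * (L * ‖z‖ ^ 2) := by
        gcongr
        · exact (abs_add_le _ _).trans (add_le_add h1 h2)
        · exact hT x z
    _ = (‖z‖ * (L * (L + a))) * ‖z‖ ^ 2 := by ring
    _ ≤ ε * ‖z‖ ^ 2 := by
        gcongr
        nlinarith [norm_nonneg z]

/-- The fractional energies of a smooth function converge to its Dirichlet energy on `Ω`. -/
theorem tendsto_energy_of_contDiff [NeZero N] {Ω : Set (Eucl N)} (hΩ : IsBoundedLipschitzDomain Ω)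
    {v : Eucl N → ℝ} (hv : ContDiff ℝ ∞ v) (hc : HasCompactSupport v) :
    Tendsto (fun s => fracConst N s / 2 * (gagliardoSq Ω s v).toReal) (𝓝[<] 1)
      (𝓝 (∫ x in Ω, ‖gradient v x‖ ^ 2)) := by
  have hCm : MeasurableSet (closure Ω) := isClosed_closure.measurableSet
  obtain ⟨B, hB⟩ := exists_wIncr_bound hv hc
  have hB0 : 0 ≤ B := (abs_nonneg _).trans (hB ∅ 0 0).1
  -- The limit is identified only at points of Ω; the boundary carries no volume, so almost every
  -- point of the closure is covered.
  have hae : (closure Ω : Set (Eucl N)) =ᵐ[volume] Ω := by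
    have h0 := volume_frontier_eq_zero hΩ
    rw [closure_eq_self_union_frontier]
    exact union_ae_eq_left_of_ae_eq_empty (ae_eq_empty.mpr h0)
  have hfin : IsFiniteMeasure (volume.restrict (closure Ω)) :=
    ⟨by simpa using hΩ.isBounded.closure.measure_lt_top⟩
  rw [← setIntegral_congr_set hae]
  -- The normalized moments tend to N and 0, which gives a dominating constant for the inner
  -- integrals, uniform in x and in s near 1.
  have hbound : ∀ᶠ s : ℝ in 𝓝[<] 1, fracConst N s / 2 *
      (B * (sphereArea N * (1 ^ (2 - 2 * s) / (2 - 2 * s)))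
      + B * (sphereArea N * (1 ^ (-(2 * s)) / (2 * s)))) ≤ B * N + 1 := by
    have h1 := ((tendsto_second_moment (N := N) one_pos).const_mul B).add
      ((tendsto_kernel_tail (N := N) one_pos).const_mul B)
    rw [mul_zero, add_zero] at h1
    filter_upwards [h1.eventually (gt_mem_nhds (lt_add_one _))] with s hs
    refine le_trans (le_of_eq ?_) hs.le
    ring
  have hlim : Tendsto (fun s => ∫ x in closure Ω, fracConst N s / 2 *
      ∫ z, wIncr (closure Ω) v x z * kern s z) (𝓝[<] 1)
      (𝓝 (∫ x in closure Ω, ‖gradient v x‖ ^ 2)) := by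
    refine tendsto_integral_filter_of_dominated_convergence (fun _ => B * N + 1) ?_ ?_
      (integrable_const _) ?_
    · refine Eventually.of_forall fun s => ?_
      have h1 : Measurable fun p : Eucl N × Eucl N => wIncr (closure Ω) v p.1 p.2 * kern s p.2 :=
        (measurable_wIncr hCm hv.continuous.measurable).mul ((measurable_kern s).comp measurable_snd)
      exact (h1.stronglyMeasurable.integral_prod_right').aestronglyMeasurable.const_mul _
    · filter_upwards [hbound, eventually_mem_Ioo_half, eventually_fracConst_pos (N := N)]
        with s hs hs1 hcs
      refine Eventually.of_forall fun x => le_trans ?_ hs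
      rw [norm_mul, Real.norm_eq_abs, Real.norm_eq_abs, abs_of_pos (by positivity)]
      gcongr
      refine abs_integral_mul_kern_le (by linarith [hs1.1]) hs1.2 ?_ (fun z => (hB _ x z).1)
        fun z => (hB _ x z).2
      exact ((measurable_wIncr hCm hv.continuous.measurable).comp
        measurable_prodMk_left).aestronglyMeasurable
    · have : ∀ᵐ x ∂(volume.restrict (closure Ω)), x ∈ Ω := by
        rw [Measure.restrict_congr_set hae]
        exact ae_restrict_mem hΩ.isOpen.measurableSet
      filter_upwards [this] with x hx
      exact tendsto_integral_mul_kern (gradient v x)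
        ((measurable_wIncr hCm hv.continuous.measurable).comp
          measurable_prodMk_left).aestronglyMeasurable (fun z => (hB _ x z).1)
        (fun z => (hB _ x z).2) fun ε hε => wIncr_sub_inner_sq_le hΩ.isOpen hv hc hx hε
  refine hlim.congr' ?_
  filter_upwards [eventually_mem_Ioo_half] with s hs
  rw [toReal_gagliardoSq_eq hv hc (by linarith [hs.1]) hs.2, integral_const_mul]

theorem continuous_gradient {v : Eucl N → ℝ} (hv : ContDiff ℝ ∞ v) : Continuous (gradient v) :=
  (InnerProductSpace.toDual ℝ (Eucl N)).symm.continuous.comp (hv.continuous_fderiv (by simp))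

theorem hasH1Gradient_of_contDiff {Ω : Set (Eucl N)} {v : Eucl N → ℝ} (hv : ContDiff ℝ ∞ v)
    (hc : HasCompactSupport v) : HasH1Gradient Ω v (gradient v) := by
  have hgc : HasCompactSupport (gradient v) := (hc.fderiv ℝ).comp_left (map_zero _)
  refine ⟨(hv.continuous.memLp_of_hasCompactSupport hc).restrict Ω,
    ((continuous_gradient hv).memLp_of_hasCompactSupport hgc).restrict Ω,
    fun φ hφ hφc hφΩ e => ?_⟩
  have hz : ∀ x ∉ Ω, φ x = 0 ∧ fderiv ℝ φ x = 0 := fun x hx => by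
    have h1 : x ∉ tsupport φ := fun h => hx (hφΩ h)
    exact ⟨image_eq_zero_of_notMem_tsupport h1,
      image_eq_zero_of_notMem_tsupport fun h => h1 (tsupport_fderiv_subset ℝ h)⟩
  rw [setIntegral_eq_integral_of_forall_compl_eq_zero (fun x hx => by simp [(hz x hx).2]),
    setIntegral_eq_integral_of_forall_compl_eq_zero (fun x hx => by simp [(hz x hx).1])]
  simp only [inner_gradient]
  have hvd : Continuous fun x => fderiv ℝ v x e := by
    have := hv.continuous_fderiv (by simp); fun_prop
  have hφd : Continuous fun x => fderiv ℝ φ x e := by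
    have := hφ.continuous_fderiv (by simp); fun_prop
  have := hv.continuous
  have := hφ.continuous
  exact integral_mul_fderiv_eq_neg_fderiv_mul_of_integrable
    ((by fun_prop : Continuous fun x => fderiv ℝ v x e * φ x).integrable_of_hasCompactSupport
      hφc.mul_left)
    ((by fun_prop : Continuous fun x => v x * fderiv ℝ φ x e).integrable_of_hasCompactSupport
      hc.mul_right)
    ((by fun_prop : Continuous fun x => v x * φ x).integrable_of_hasCompactSupport hc.mul_right)
    (fun x _ => hv.differentiable (by simp) x) (fun x _ => hφ.differentiable (by simp) x)

end Smooth

/-! ### Density of smooth functions in `H¹` -/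

section Density

variable {N : ℕ}

theorem tendsto_eLpNorm_translate_sub {v : Eucl N → ℝ} (hv : MemLp v 2 volume) :
    Tendsto (fun z => eLpNorm (fun x => v (x + z) - v x) 2 volume) (𝓝 0) (𝓝 0) := by
  let T : Eucl N → C(Eucl N, Eucl N) := fun z => ⟨fun x => x + z, by fun_prop⟩
  have hT : Continuous T := ContinuousMap.continuous_of_continuous_uncurry T (by
    change Continuous fun p : Eucl N × Eucl N => p.2 + p.1
    fun_prop)
  have hmp : ∀ z, MeasurePreserving (T z) volume volume := fun z =>
    measurePreserving_add_right volume z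
  have h := (Continuous.compMeasurePreservingLp (f := fun _ : Eucl N => hv.toLp v) (g := T)
    continuous_const hT hmp (by simp)).tendsto 0
  rw [Lp.tendsto_Lp_iff_tendsto_eLpNorm'] at h
  refine h.congr fun z => eLpNorm_congr_ae ?_
  have h1 := Lp.coeFn_compMeasurePreserving (hv.toLp v) (hmp z)
  have h0 := Lp.coeFn_compMeasurePreserving (hv.toLp v) (hmp 0)
  have h2 := (hmp z).quasiMeasurePreserving.ae_eq_comp hv.coeFn_toLp
  have h3 := (hmp 0).quasiMeasurePreserving.ae_eq_comp hv.coeFn_toLp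
  filter_upwards [h1, h0, h2, h3] with x e1 e0 e2 e3
  simp only [Pi.sub_apply, e1, e0, e2, e3]
  simp [T]

/-- The averaging kernels concentrated near `e / (k + 1)`. -/
def coneKernel (e : Eucl N) {κ : ℝ} (hκ : 0 < κ) (k : ℕ) : Eucl N → ℝ :=
  (coneBump e hκ (t := ((k : ℝ) + 1)⁻¹) (by positivity)).normed volume

theorem contDiff_coneKernel (e : Eucl N) {κ : ℝ} (hκ : 0 < κ) (k : ℕ) :
    ContDiff ℝ ∞ (coneKernel e hκ k) := ContDiffBump.contDiff_normed _

theorem hasCompactSupport_coneKernel (e : Eucl N) {κ : ℝ} (hκ : 0 < κ) (k : ℕ) :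
    HasCompactSupport (coneKernel e hκ k) := ContDiffBump.hasCompactSupport_normed _

theorem tsupport_coneKernel (e : Eucl N) {κ : ℝ} (hκ : 0 < κ) (k : ℕ) :
    tsupport (coneKernel e hκ k) =
      Metric.closedBall (((k : ℝ) + 1)⁻¹ • e) (((k : ℝ) + 1)⁻¹ * κ) :=
  ContDiffBump.tsupport_normed_eq _

/-- Jensen bounds the error by an average of translation errors over the kernel's support, where ‖z‖
≤ 2/(k+1); translations are continuous in L². -/
theorem tendsto_eLpNorm_mol_sub {v : Eucl N → ℝ} (hv : MemLp v 2 volume) {e : Eucl N}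
    (he : ‖e‖ = 1) {κ : ℝ} (hκ : 0 < κ) (hκ1 : κ ≤ 1 / 4) :
    Tendsto (fun k : ℕ => eLpNorm (fun x => mol (coneKernel e hκ k) v x - v x) 2 volume)
      atTop (𝓝 0) := by
  obtain ⟨v', hv'm, hvv'⟩ := hv.1.aemeasurable
  have hv' : MemLp v' 2 volume := hv.ae_eq hvv'
  have hred : ∀ k : ℕ, eLpNorm (fun x => mol (coneKernel e hκ k) v x - v x) 2 volume =
      eLpNorm (fun x => mol (coneKernel e hκ k) v' x - v' x) 2 volume := fun k => by
    refine eLpNorm_congr_ae ?_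
    filter_upwards [hvv'] with x hx
    rw [mol_congr hvv', hx]
  simp only [hred]
  rw [ENNReal.tendsto_nhds_zero]
  intro ε hε
  have h1 := (ENNReal.tendsto_nhds_zero.mp (tendsto_eLpNorm_translate_sub hv')) ε hε
  obtain ⟨δ, hδ, hball⟩ := Metric.eventually_nhds_iff.mp h1
  have ht : Tendsto (fun k : ℕ => ((k : ℝ) + 1)⁻¹ * 2) atTop (𝓝 0) := by
    have := (tendsto_one_div_add_atTop_nhds_zero_nat (𝕜 := ℝ)).mul_const 2
    simpa using this
  filter_upwards [ht.eventually_lt_const hδ] with k hk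
  set t := ((k : ℝ) + 1)⁻¹ with htdef
  have htpos : 0 < t := by positivity
  set η := coneKernel e hκ k with hη
  have hηc : Continuous η := (contDiff_coneKernel e hκ k).continuous
  have h0 : ∀ z, 0 ≤ η z := ContDiffBump.nonneg_normed _
  have hint : ∫ z, η z = 1 := ContDiffBump.integral_normed _
  have hηi : Integrable η := hηc.integrable_of_hasCompactSupport (hasCompactSupport_coneKernel e hκ k)
  have hint' : ∫⁻ z, ENNReal.ofReal (η z) = 1 := by
    rw [← ofReal_integral_eq_lintegral_ofReal hηi (Eventually.of_forall h0), hint, ENNReal.ofReal_one]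
  have hsq : eLpNorm (fun x => mol η v' x - v' x) 2 volume ^ 2 ≤ ε ^ 2 := by
    rw [eLpNorm_two_sq]
    have := lintegral_mol_sub_sq_le hηc (hasCompactSupport_coneKernel e hκ k) h0 hint hv' hv'm univ
    rw [Measure.restrict_univ] at this
    refine this.trans ?_
    calc _ ≤ ∫⁻ z, ENNReal.ofReal (η z) * ε ^ 2 := by
          refine lintegral_mono fun z => ?_
          by_cases hz : η z = 0
          · simp [hz]
          · gcongr
            rw [← eLpNorm_two_sq]
            gcongr
            refine hball ?_
            have hz' : z ∈ tsupport η := subset_tsupport _ hz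
            rw [hη, tsupport_coneKernel, Metric.mem_closedBall, dist_eq_norm, ← htdef] at hz'
            rw [dist_zero_right]
            calc ‖z‖ = ‖(z - t • e) + t • e‖ := by congr 1; abel
              _ ≤ t * κ + t := by
                  refine (norm_add_le _ _).trans (add_le_add hz' ?_)
                  rw [norm_smul, he, mul_one, Real.norm_of_nonneg htpos.le]
              _ ≤ t * 2 := by nlinarith
              _ < δ := hk
      _ = ε ^ 2 := by
          rw [lintegral_mul_const'' _ hηc.measurable.ennreal_ofReal.aemeasurable, hint', one_mul]
  exact (ENNReal.pow_le_pow_left_iff two_ne_zero).mp hsq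

theorem mol_eq_convolution (η v : Eucl N → ℝ) :
    mol η v = convolution v (fun w => η (-w)) (ContinuousLinearMap.mul ℝ ℝ) volume := by
  ext x
  rw [mol_eq_integral_sub, convolution_def]
  refine integral_congr_ae (Eventually.of_forall fun y => ?_)
  simp [mul_comm]

theorem contDiff_mol {η v : Eucl N → ℝ} (hη : ContDiff ℝ ∞ η) (hc : HasCompactSupport η)
    (hv : LocallyIntegrable v volume) : ContDiff ℝ ∞ (mol η v) := by
  rw [mol_eq_convolution]
  exact HasCompactSupport.contDiff_convolution_right _ (hc.comp_homeomorph (Homeomorph.neg _)) hv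
    (hη.comp contDiff_neg)

theorem fderiv_mol {η v : Eucl N → ℝ} (hη : ContDiff ℝ ∞ η) (hc : HasCompactSupport η)
    (hv : LocallyIntegrable v volume) (x e : Eucl N) :
    fderiv ℝ (mol η v) x e = -∫ y, v y * fderiv ℝ η (y - x) e := by
  have hg : ContDiff ℝ ∞ fun w => η (-w) := hη.comp contDiff_neg
  have hcg : HasCompactSupport fun w => η (-w) := hc.comp_homeomorph (Homeomorph.neg _)
  have hfd : ∀ w, fderiv ℝ (fun w => η (-w)) w = -fderiv ℝ η (-w) := fun w => by
    have h1 := ((hη.differentiable (by simp)) (-w)).hasFDerivAt.comp w (hasFDerivAt_id w).neg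
    rw [show (fun w => η (-w)) = η ∘ fun w => -w from rfl, h1.fderiv]
    ext z; simp
  have h := HasCompactSupport.hasFDerivAt_convolution_right (ContinuousLinearMap.mul ℝ ℝ) hcg hv
    (hg.of_le (by simp)) x
  rw [mol_eq_convolution, h.fderiv, convolution_precompR_apply _ hv (hcg.fderiv (𝕜 := ℝ))
    (hg.continuous_fderiv (by simp)), convolution_def, ← integral_neg]
  refine integral_congr_ae (Eventually.of_forall fun y => ?_)
  simp [hfd]

/-- Inside the domain, averaging over cones commutes with weak differentiation. -/
theorem HasInnerCone.fderiv_mol_eq {Ω S : Set (Eucl N)} {e : Eucl N} {κ r : ℝ}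
    (h : HasInnerCone Ω S e κ r) (hΩ : IsOpen Ω) {u : Eucl N → ℝ} {g : Eucl N → Eucl N}
    (hu : HasH1Gradient Ω u g) {k : ℕ} (hk : ((k : ℝ) + 1)⁻¹ < r) {x : Eucl N} (hx : x ∈ Ω)
    (hxS : x ∈ S) (d : Eucl N) :
    fderiv ℝ (mol (coneKernel e h.pos k) (Ω.indicator u)) x d =
      mol (coneKernel e h.pos k) (Ω.indicator fun y => (⟪g y, d⟫ : ℝ)) x := by
  set η := coneKernel e h.pos k with hη
  set t := ((k : ℝ) + 1)⁻¹ with htdef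
  have htpos : 0 < t := by positivity
  have hηs := contDiff_coneKernel e h.pos k
  have hηc := hasCompactSupport_coneKernel e h.pos k
  have hΩm := hΩ.measurableSet
  have hloc : LocallyIntegrable (Ω.indicator u) volume :=
    (memLp_indicator_of_restrict hΩm hu.memLp).locallyIntegrable (by simp)
  rw [fderiv_mol hηs hηc hloc, mol_eq_integral_sub]
  have hφ : ContDiff ℝ ∞ fun y => η (y - x) := hηs.comp (contDiff_id.sub contDiff_const)
  have hφc : HasCompactSupport fun y => η (y - x) :=
    hηc.comp_homeomorph (Homeomorph.subRight x)
  -- The cone condition makes the shifted kernel an admissible test function in Ω even when x is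
  -- close to the boundary. An average over a centred ball would lack this property.
  have hsub : tsupport (fun y => η (y - x)) ⊆ Ω := by
    intro y hy
    have h1 : y - x ∈ tsupport η :=
      tsupport_comp_subset_preimage η (f := fun y => y - x) (by fun_prop) hy
    rw [hη, tsupport_coneKernel, Metric.mem_closedBall, dist_eq_norm, ← htdef] at h1
    have h2 : y = x + t • (t⁻¹ • (y - x)) := by rw [smul_inv_smul₀ htpos.ne']; abel
    rw [h2]
    refine h.mem x hx hxS t ⟨htpos, hk⟩ _ ?_
    rw [Metric.mem_closedBall, dist_eq_norm]
    have h3 : t⁻¹ • (y - x) - e = t⁻¹ • (y - x - t • e) := by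
      rw [smul_sub _ (y - x), inv_smul_smul₀ htpos.ne']
    rw [h3, norm_smul, norm_inv, Real.norm_of_nonneg htpos.le, inv_mul_le_iff₀ htpos]
    exact h1
  have key := hu.weak_grad _ hφ hφc hsub d
  have hfd : ∀ y, fderiv ℝ (fun y => η (y - x)) y = fderiv ℝ η (y - x) := fun y =>
    fderiv_comp_sub x
  simp only [hfd] at key
  have e1 : ∫ y, Ω.indicator u y * fderiv ℝ η (y - x) d = ∫ y in Ω, u y * fderiv ℝ η (y - x) d := by
    rw [← integral_indicator hΩm]
    simp only [indicator_mul_left]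
  have e2 : ∫ y, η (y - x) * Ω.indicator (fun y => (⟪g y, d⟫ : ℝ)) y =
      ∫ y in Ω, (⟪g y, d⟫ : ℝ) * η (y - x) := by
    rw [← integral_indicator hΩm]
    refine integral_congr_ae (Eventually.of_forall fun y => ?_)
    by_cases hy : y ∈ Ω <;> simp [hy, mul_comm]
  rw [e1, e2, key, neg_neg]

theorem tendsto_eLpNorm_sum_mul {α ι : Type*} [MeasurableSpace α] {μ : Measure α} [Fintype ι]
    {a : ι → α → ℝ} {F : ℕ → ι → α → ℝ} (ha : ∀ i, AEStronglyMeasurable (a i) μ)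
    (hF : ∀ k i, AEStronglyMeasurable (F k i) μ) (hb : ∀ i, ∃ C, ∀ x, |a i x| ≤ C)
    (h : ∀ i, Tendsto (fun k => eLpNorm (F k i) 2 μ) atTop (𝓝 0)) :
    Tendsto (fun k => eLpNorm (fun x => ∑ i, a i x * F k i x) 2 μ) atTop (𝓝 0) := by
  choose C hC using hb
  have hlim : Tendsto (fun k => ∑ i, ENNReal.ofReal (C i) * eLpNorm (F k i) 2 μ) atTop (𝓝 0) := by
    have := tendsto_finsetSum Finset.univ fun i (_ : i ∈ Finset.univ) =>
      ENNReal.Tendsto.const_mul (a := ENNReal.ofReal (C i)) (h i) (Or.inr ENNReal.ofReal_ne_top)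
    simpa using this
  refine tendsto_of_tendsto_of_tendsto_of_le_of_le tendsto_const_nhds hlim (fun _ => zero_le)
    fun k => ?_
  have h1 : (fun x => ∑ i, a i x * F k i x) = ∑ i, fun x => a i x * F k i x := by
    ext x; simp
  simp only [h1]
  refine (eLpNorm_sum_le (fun i _ => (ha i).mul (hF k i)) (by simp)).trans
    (Finset.sum_le_sum fun i _ => ?_)
  refine eLpNorm_le_mul_eLpNorm_of_ae_le_mul (Eventually.of_forall fun x => ?_) 2
  rw [Pi.mul_apply, norm_mul]
  exact mul_le_mul_of_nonneg_right (hC i x) (norm_nonneg _)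

/-- Smooth functions on the whole space are dense in `H¹` of a bounded Lipschitz domain. -/
theorem exists_contDiff_tendsto_H1 [NeZero N] {Ω : Set (Eucl N)} (hΩ : IsBoundedLipschitzDomain Ω)
    {u : Eucl N → ℝ} {g : Eucl N → Eucl N} (hu : HasH1Gradient Ω u g) :
    ∃ v : ℕ → Eucl N → ℝ, (∀ k, ContDiff ℝ ∞ (v k) ∧ HasCompactSupport (v k)) ∧
      Tendsto (fun k => eLpNorm (fun x => v k x - u x) 2 (volume.restrict Ω)) atTop (𝓝 0) ∧
      Tendsto (fun k => eLpNorm (fun x => gradient (v k) x - g x) 2 (volume.restrict Ω)) atTop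
        (𝓝 0) := by
  obtain ⟨m, ψ, e, κ, r, hP, hsum⟩ := exists_conePartition hΩ
  have hΩm := hΩ.isOpen.measurableSet
  have hcone := fun i => (hP i).2.2.2
  have hubar := memLp_indicator_of_restrict hΩm hu.memLp
  have hdbar : ∀ d : Eucl N, MemLp (Ω.indicator fun y => (⟪g y, d⟫ : ℝ)) 2 volume := fun d =>
    memLp_indicator_of_restrict hΩm (hu.memLp_grad.inner_const d)
  let M : ℕ → Fin m → (Eucl N → ℝ) → Eucl N → ℝ := fun k i f => mol (coneKernel (e i) (hcone i).pos k) f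
  have hMs : ∀ k i {f : Eucl N → ℝ}, MemLp f 2 volume → ContDiff ℝ ∞ (M k i f) := fun k i f hf =>
    contDiff_mol (contDiff_coneKernel _ _ _) (hasCompactSupport_coneKernel _ _ _)
      (hf.locallyIntegrable (by simp))
  have hMlim : ∀ i {f : Eucl N → ℝ}, MemLp f 2 volume →
      Tendsto (fun k => eLpNorm (fun x => M k i f x - f x) 2 (volume.restrict Ω)) atTop (𝓝 0) :=
    fun i f hf => tendsto_of_tendsto_of_tendsto_of_le_of_le tendsto_const_nhds
      (tendsto_eLpNorm_mol_sub hf (hcone i).norm_eq (hcone i).pos (hcone i).le)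
      (fun _ => zero_le) fun k => eLpNorm_mono_measure _ Measure.restrict_le_self
  have hMm : ∀ k i {f : Eucl N → ℝ}, MemLp f 2 volume →
      AEStronglyMeasurable (fun x => M k i f x - f x) (volume.restrict Ω) := fun k i f hf =>
    ((hMs k i hf).continuous.aestronglyMeasurable.sub hf.1).mono_measure Measure.restrict_le_self
  have hψs := fun i => (hP i).1
  have hψd : ∀ i d, Continuous fun x => fderiv ℝ (ψ i) x d := fun i d =>
    ((hψs i).continuous_fderiv (by simp)).clm_apply continuous_const
  have hψdb : ∀ i d, ∃ C, ∀ x, |fderiv ℝ (ψ i) x d| ≤ C := fun i d =>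
    (hψd i d).bounded_above_of_compact_support
      (((hP i).2.1.fderiv (𝕜 := ℝ)).comp_left (g := fun L : Eucl N →L[ℝ] ℝ => L d) (by simp))
  have hψb : ∀ i, ∃ C, ∀ x, |ψ i x| ≤ C := fun i =>
    ⟨1, fun x => by rw [abs_of_nonneg ((hP i).2.2.1 x).1]; exact ((hP i).2.2.1 x).2⟩
  -- Each piece is smoothed along its own cone direction and multiplied by its cutoff afterwards, so
  -- the approximants are smooth and compactly supported on the whole space.
  let v : ℕ → Eucl N → ℝ := fun k x => ∑ i, ψ i x * M k i (Ω.indicator u) x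
  have hvs : ∀ k, ContDiff ℝ ∞ (v k) := fun k =>
    ContDiff.sum fun i _ => (hψs i).mul (hMs k i hubar)
  have hfd : ∀ k x d, fderiv ℝ (v k) x d =
      ∑ i, (fderiv ℝ (ψ i) x d * M k i (Ω.indicator u) x +
        ψ i x * fderiv ℝ (M k i (Ω.indicator u)) x d) := by
    intro k x d
    have h1 : ∀ i, HasFDerivAt (fun x => ψ i x * M k i (Ω.indicator u) x)
        (ψ i x • fderiv ℝ (M k i (Ω.indicator u)) x + M k i (Ω.indicator u) x • fderiv ℝ (ψ i) x) x :=
      fun i => ((hψs i).differentiable (by simp) x).hasFDerivAt.mul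
        ((hMs k i hubar).differentiable (by simp) x).hasFDerivAt
    have h2 := HasFDerivAt.fun_sum (u := Finset.univ) fun i _ => h1 i
    rw [h2.fderiv]
    simp only [_root_.sum_apply, _root_.add_apply,
      _root_.smul_apply, smul_eq_mul]
    exact Finset.sum_congr rfl fun i _ => by ring
  -- The derivatives of the cutoffs cancel on Ω, so in the product rule M u may be replaced by M u -
  -- u, which tends to 0.
  have hdsum : ∀ x ∈ Ω, ∀ d, ∑ i, fderiv ℝ (ψ i) x d = 0 := by
    intro x hx d
    have h1 : HasFDerivAt (fun x => ∑ i, ψ i x) (∑ i, fderiv ℝ (ψ i) x) x :=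
      HasFDerivAt.fun_sum fun i _ => ((hψs i).differentiable (by simp) x).hasFDerivAt
    have h2 : (fun x => ∑ i, ψ i x) =ᶠ[𝓝 x] fun _ => 1 := by
      filter_upwards [hΩ.isOpen.mem_nhds hx] with y hy using hsum y hy
    have h3 := h1.unique ((hasFDerivAt_const (1 : ℝ) x).congr_of_eventuallyEq h2)
    rw [← _root_.sum_apply, h3, _root_.zero_apply]
  have hcoord : ∀ d, Tendsto (fun k => eLpNorm (fun x => fderiv ℝ (v k) x d - (⟪g x, d⟫ : ℝ)) 2
      (volume.restrict Ω)) atTop (𝓝 0) := by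
    intro d
    have hA := tendsto_eLpNorm_sum_mul (μ := volume.restrict Ω)
      (fun i => (hψd i d).aestronglyMeasurable) (fun k i => hMm k i hubar) (fun i => hψdb i d)
      fun i => hMlim i hubar
    have hB := tendsto_eLpNorm_sum_mul (μ := volume.restrict Ω)
      (fun i => (hψs i).continuous.aestronglyMeasurable) (fun k i => hMm k i (hdbar d)) hψb
      fun i => hMlim i (hdbar d)
    have hAB := hA.add hB
    rw [add_zero] at hAB
    have hk : ∀ᶠ k : ℕ in atTop, ∀ i, ((k : ℝ) + 1)⁻¹ < r i := by
      rw [eventually_all]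
      intro i
      have := (tendsto_one_div_add_atTop_nhds_zero_nat (𝕜 := ℝ)).eventually_lt_const (hcone i).rpos
      simpa using this
    refine tendsto_of_tendsto_of_tendsto_of_le_of_le' tendsto_const_nhds hAB
      (Eventually.of_forall fun _ => zero_le) ?_
    filter_upwards [hk] with k hk
    refine le_trans (le_of_eq ?_) (eLpNorm_add_le ?_ ?_ (by simp))
    · refine eLpNorm_congr_ae ((ae_restrict_iff' hΩm).mpr (Eventually.of_forall fun x hx => ?_))
      -- Differentiation commutes with the average only on the support of ψ i; elsewhere both sides
      -- vanish.
      have e1 : ∀ i, ψ i x * fderiv ℝ (M k i (Ω.indicator u)) x d =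
          ψ i x * M k i (Ω.indicator fun y => (⟪g y, d⟫ : ℝ)) x := by
        intro i
        by_cases hi : ψ i x = 0
        · simp [hi]
        · rw [(hcone i).fderiv_mol_eq hΩ.isOpen hu (hk i) hx (subset_tsupport _ hi)]
      simp only [hfd, e1, Pi.add_apply, Finset.sum_add_distrib, mul_sub, Finset.sum_sub_distrib,
        ← Finset.sum_mul, hdsum x hx d, hsum x hx, indicator_of_mem hx]
      ring
    · exact Finset.aestronglyMeasurable_fun_sum _ fun i _ =>
        (hψd i d).aestronglyMeasurable.mul (hMm k i hubar)
    · exact Finset.aestronglyMeasurable_fun_sum _ fun i _ =>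
        (hψs i).continuous.aestronglyMeasurable.mul (hMm k i (hdbar d))
  refine ⟨v, fun k => ⟨hvs k, ?_⟩, ?_, ?_⟩
  · have : ∀ s : Finset (Fin m), HasCompactSupport fun x => ∑ i ∈ s, ψ i x * M k i (Ω.indicator u) x := by
      intro s
      induction s using Finset.induction_on with
      | empty => exact HasCompactSupport.zero
      | insert i s hi ih =>
        simp only [Finset.sum_insert hi]
        exact ((hP i).2.1.mul_right).add ih
    exact this Finset.univ
  · refine (tendsto_eLpNorm_sum_mul (μ := volume.restrict Ω)
      (fun i => (hψs i).continuous.aestronglyMeasurable) (fun k i => hMm k i hubar) hψb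
      fun i => hMlim i hubar).congr fun k => ?_
    refine eLpNorm_congr_ae ((ae_restrict_iff' hΩm).mpr (Eventually.of_forall fun x hx => ?_))
    simp only [v, mul_sub, Finset.sum_sub_distrib, ← Finset.sum_mul, hsum x hx, indicator_of_mem hx,
      one_mul]
  · have hlim := tendsto_finsetSum Finset.univ fun j (_ : j ∈ Finset.univ) =>
      hcoord (EuclideanSpace.single j (1 : ℝ))
    rw [Finset.sum_const_zero] at hlim
    refine tendsto_of_tendsto_of_tendsto_of_le_of_le tendsto_const_nhds hlim
      (fun _ => zero_le) fun k => ?_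
    have hmeas : ∀ j : Fin N, AEStronglyMeasurable (fun x => |fderiv ℝ (v k) x
        (EuclideanSpace.single j (1 : ℝ)) - (⟪g x, EuclideanSpace.single j (1 : ℝ)⟫ : ℝ)|)
        (volume.restrict Ω) := fun j =>
      ((((hvs k).continuous_fderiv (by simp)).clm_apply continuous_const).aestronglyMeasurable.sub
        (hu.memLp_grad.inner_const _).1).norm
    calc eLpNorm (fun x => gradient (v k) x - g x) 2 (volume.restrict Ω)
        ≤ eLpNorm (∑ j : Fin N, fun x => |fderiv ℝ (v k) x (EuclideanSpace.single j (1 : ℝ)) -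
            (⟪g x, EuclideanSpace.single j (1 : ℝ)⟫ : ℝ)|) 2 (volume.restrict Ω) := by
          refine eLpNorm_mono_real fun x => ?_
          rw [Finset.sum_apply]
          set y := gradient (v k) x - g x with hy
          have h1 : ∀ j, |fderiv ℝ (v k) x (EuclideanSpace.single j (1 : ℝ)) -
              (⟪g x, EuclideanSpace.single j (1 : ℝ)⟫ : ℝ)| = ‖y j‖ := fun j => by
            rw [← inner_gradient, ← inner_sub_left, EuclideanSpace.inner_single_right]
            simp [hy]
          simp only [h1]
          conv_lhs => rw [eucl_eq_sum y]
          refine (norm_sum_le _ _).trans (Finset.sum_le_sum fun j _ => ?_)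
          rw [norm_smul]
          simp
      _ ≤ _ := by
          refine (eLpNorm_sum_le (fun j _ => hmeas j) (by simp)).trans
            (Finset.sum_le_sum fun j _ => le_of_eq ?_)
          exact eLpNorm_congr_norm_ae (Eventually.of_forall fun x => abs_abs _)

end Density

/-! ### The variational characterization of the fractional eigenvalues -/

section FracSpectral

variable {N : ℕ}

theorem inner_toLp_eq_integral {α : Type*} [MeasurableSpace α] {μ : Measure α} {f g : α → ℝ}
    (hf : MemLp f 2 μ) (hg : MemLp g 2 μ) :
    (⟪hf.toLp f, hg.toLp g⟫ : ℝ) = ∫ x, f x * g x ∂μ := by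
  rw [L2.inner_def]
  refine integral_congr_ae ?_
  filter_upwards [hf.coeFn_toLp, hg.coeFn_toLp] with x h1 h2
  rw [h1, h2]
  simp [mul_comm]

/-- The weighted difference quotient whose square is the Gagliardo integrand. -/
def fracDiff (s : ℝ) (u : Eucl N → ℝ) (p : Eucl N × Eucl N) : ℝ :=
  (u p.1 - u p.2) / ‖p.1 - p.2‖ ^ (((N : ℝ) + 2 * s) / 2)

theorem fracDiff_mul (s : ℝ) (u v : Eucl N → ℝ) (p : Eucl N × Eucl N) :
    fracDiff s u p * fracDiff s v p =
      (u p.1 - u p.2) * (v p.1 - v p.2) / ‖p.1 - p.2‖ ^ ((N : ℝ) + 2 * s) := by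
  have h : ‖p.1 - p.2‖ ^ ((N : ℝ) + 2 * s) =
      ‖p.1 - p.2‖ ^ (((N : ℝ) + 2 * s) / 2) * ‖p.1 - p.2‖ ^ (((N : ℝ) + 2 * s) / 2) := by
    rw [← sq, ← Real.rpow_natCast, ← Real.rpow_mul (norm_nonneg _)]
    congr 1
    push_cast
    ring
  rw [h, fracDiff, fracDiff, div_mul_div_comm]

theorem fracDiff_add (s : ℝ) (u v : Eucl N → ℝ) :
    fracDiff s (u + v) = fracDiff s u + fracDiff s v := by
  ext p; simp only [fracDiff, Pi.add_apply]; ring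

theorem fracDiff_smul (s c : ℝ) (u : Eucl N → ℝ) :
    fracDiff s (c • u) = c • fracDiff s u := by
  ext p; simp only [fracDiff, Pi.smul_apply, smul_eq_mul]; ring

theorem aestronglyMeasurable_fracDiff (s : ℝ) {u : Eucl N → ℝ} (hu : AEMeasurable u volume)
    (I : Set (Eucl N × Eucl N)) : AEStronglyMeasurable (fracDiff s u) (volume.restrict I) := by
  have h1 : AEMeasurable (fun p : Eucl N × Eucl N => u p.1) (volume.prod volume) :=
    hu.comp_quasiMeasurePreserving Measure.quasiMeasurePreserving_fst
  have h2 : AEMeasurable (fun p : Eucl N × Eucl N => u p.2) (volume.prod volume) :=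
    hu.comp_quasiMeasurePreserving Measure.quasiMeasurePreserving_snd
  have h3 : Measurable fun p : Eucl N × Eucl N => ‖p.1 - p.2‖ ^ (((N : ℝ) + 2 * s) / 2) := by
    fun_prop
  exact ((h1.sub h2).div h3.aemeasurable).aestronglyMeasurable.mono_measure
    Measure.restrict_le_self

theorem eLpNorm_fracDiff_sq (Ω : Set (Eucl N)) (s : ℝ) (u : Eucl N → ℝ) :
    eLpNorm (fracDiff s u) 2 (volume.restrict (interactionSet Ω)) ^ 2 = gagliardoSq Ω s u := by
  rw [eLpNorm_two_sq, gagliardoSq]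
  refine lintegral_congr fun p => ?_
  rw [sq, fracDiff_mul, ← sq]

theorem memHs_iff {Ω : Set (Eucl N)} {s : ℝ} {u : Eucl N → ℝ} :
    MemHs Ω s u ↔ AEMeasurable u volume ∧ MemLp u 2 (volume.restrict Ω) ∧
      MemLp (fracDiff s u) 2 (volume.restrict (interactionSet Ω)) := by
  have key : gagliardoSq Ω s u < ⊤ ↔
      eLpNorm (fracDiff s u) 2 (volume.restrict (interactionSet Ω)) < ⊤ := by
    rw [← eLpNorm_fracDiff_sq, ENNReal.pow_lt_top_iff]
    simp
  exact ⟨fun h => ⟨h.1, h.2, aestronglyMeasurable_fracDiff s h.1 _, key.mp h.3⟩,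
    fun h => ⟨h.1, h.2.1, key.mpr h.2.2.2⟩⟩

theorem MemHs.memLp_fracDiff {Ω : Set (Eucl N)} {s : ℝ} {u : Eucl N → ℝ} (h : MemHs Ω s u) :
    MemLp (fracDiff s u) 2 (volume.restrict (interactionSet Ω)) := (memHs_iff.mp h).2.2

theorem MemHs.add {Ω : Set (Eucl N)} {s : ℝ} {u v : Eucl N → ℝ} (hu : MemHs Ω s u)
    (hv : MemHs Ω s v) : MemHs Ω s (u + v) :=
  memHs_iff.mpr ⟨hu.1.add hv.1, hu.2.add hv.2, by
    rw [fracDiff_add]; exact hu.memLp_fracDiff.add hv.memLp_fracDiff⟩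

theorem MemHs.const_smul {Ω : Set (Eucl N)} {s : ℝ} {u : Eucl N → ℝ} (hu : MemHs Ω s u) (c : ℝ) :
    MemHs Ω s (c • u) :=
  memHs_iff.mpr ⟨hu.1.const_smul c, hu.2.const_smul c, by
    rw [fracDiff_smul]; exact hu.memLp_fracDiff.const_smul c⟩

theorem memHs_zero (Ω : Set (Eucl N)) (s : ℝ) : MemHs Ω s (0 : Eucl N → ℝ) :=
  memHs_iff.mpr ⟨aemeasurable_const, MemLp.zero, by
    have : fracDiff s (0 : Eucl N → ℝ) = 0 := by ext p; simp [fracDiff]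
    rw [this]; exact MemLp.zero⟩

/-- The space `H^s_{Ω,0}`. -/
def hsSpace (Ω : Set (Eucl N)) (s : ℝ) : Submodule ℝ (Eucl N → ℝ) where
  carrier := {u | MemHs Ω s u}
  add_mem' := fun h h' => MemHs.add h h'
  zero_mem' := memHs_zero Ω s
  smul_mem' := fun c _ h => MemHs.const_smul h c

theorem fracConst_nonneg [NeZero N] (s : ℝ) : 0 ≤ fracConst N s := by
  refine inv_nonneg.mpr (integral_nonneg fun ζ => ?_)
  exact div_nonneg (sub_nonneg.mpr (Real.cos_le_one _)) (by positivity)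

/-- The normalized weighted difference, as a map into `L²`. -/
def hsDiff [NeZero N] (Ω : Set (Eucl N)) (s : ℝ) :
    hsSpace Ω s →ₗ[ℝ] Lp ℝ 2 (volume.restrict (interactionSet Ω)) where
  toFun u := √(fracConst N s / 2) • (MemHs.memLp_fracDiff u.2).toLp (fracDiff s u.1)
  map_add' u v := by
    rw [← smul_add]
    congr 1
    rw [← MemLp.toLp_add]
    exact MemLp.toLp_congr _ _ (by rw [← fracDiff_add]; rfl)
  map_smul' c u := by
    rw [RingHom.id_apply, smul_comm]
    congr 1
    rw [← MemLp.toLp_const_smul]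
    exact MemLp.toLp_congr _ _ (by rw [← fracDiff_smul]; rfl)

/-- Restriction to `Ω`, as a map into `L²`. -/
def hsRestr (Ω : Set (Eucl N)) (s : ℝ) : hsSpace Ω s →ₗ[ℝ] Lp ℝ 2 (volume.restrict Ω) where
  toFun u := (MemHs.memLp u.2).toLp u.1
  map_add' _ _ := rfl
  map_smul' _ _ := rfl

theorem inner_hsRestr {Ω : Set (Eucl N)} {s : ℝ} (u v : hsSpace Ω s) :
    (⟪hsRestr Ω s u, hsRestr Ω s v⟫ : ℝ) = ∫ x in Ω, u.1 x * v.1 x :=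
  inner_toLp_eq_integral (MemHs.memLp u.2) (MemHs.memLp v.2)

theorem inner_hsDiff [NeZero N] {Ω : Set (Eucl N)} {s : ℝ} (u v : hsSpace Ω s) :
    (⟪hsDiff Ω s u, hsDiff Ω s v⟫ : ℝ) = fracForm Ω s u.1 v.1 := by
  change (⟪√(fracConst N s / 2) • (MemHs.memLp_fracDiff u.2).toLp (fracDiff s u.1),
    √(fracConst N s / 2) • (MemHs.memLp_fracDiff v.2).toLp (fracDiff s v.1)⟫ : ℝ) = _
  rw [real_inner_smul_left, real_inner_smul_right, inner_toLp_eq_integral, ← mul_assoc,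
    Real.mul_self_sqrt (div_nonneg (fracConst_nonneg s) two_pos.le), fracForm]
  simp only [fracDiff_mul]

theorem fracForm_self [NeZero N] {Ω : Set (Eucl N)} {s : ℝ} {u : Eucl N → ℝ} (hu : MemHs Ω s u) :
    fracForm Ω s u u = fracConst N s / 2 * (gagliardoSq Ω s u).toReal := by
  rw [fracForm]
  congr 1
  rw [← eLpNorm_fracDiff_sq, eLpNorm_two_sq, lintegral_sq_eq_ofReal_integral hu.memLp_fracDiff,
    ENNReal.toReal_ofReal (integral_nonneg fun p => sq_nonneg _)]
  refine integral_congr_ae (Eventually.of_forall fun p => ?_)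
  simp only [sq, fracDiff_mul]

/-- Closedness of the pair (difference, restriction). The L² limits control values only on Ω and
differences on the interaction set; the limit function on the exterior has to be rebuilt from these.
-/
theorem exists_limit_hsSpace [NeZero N] {Ω : Set (Eucl N)} (hΩ : IsBoundedLipschitzDomain Ω) {s : ℝ}
    (hc : 0 < fracConst N s) (u : ℕ → hsSpace Ω s)
    (d : Lp ℝ 2 (volume.restrict (interactionSet Ω))) (r : Lp ℝ 2 (volume.restrict Ω))
    (hd : Tendsto (fun k => hsDiff Ω s (u k)) atTop (𝓝 d))
    (hr : Tendsto (fun k => hsRestr Ω s (u k)) atTop (𝓝 r)) :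
    ∃ x, hsDiff Ω s x = d ∧ hsRestr Ω s x = r := by
  have hc' : 0 < √(fracConst N s / 2) := Real.sqrt_pos.mpr (half_pos hc)
  set a := √(fracConst N s / 2) with ha
  have hΩm := hΩ.isOpen.measurableSet
  obtain ⟨φ, hφ, hφd⟩ := (tendstoInMeasure_of_tendsto_Lp hd).exists_seq_tendsto_ae
  obtain ⟨θ, hθ, hθr⟩ := (tendstoInMeasure_of_tendsto_Lp
    (hr.comp hφ.tendsto_atTop)).exists_seq_tendsto_ae
  set w : ℕ → Eucl N → ℝ := fun k => (u (φ (θ k))).1 with hw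
  have hmem : ∀ k, MemHs Ω s (w k) := fun k => (u (φ (θ k))).2
  have hwd : ∀ᵐ p ∂(volume.restrict (interactionSet Ω)),
      Tendsto (fun k => a * fracDiff s (w k) p) atTop (𝓝 (d p)) := by
    have hall : ∀ᵐ p ∂(volume.restrict (interactionSet Ω)), ∀ k,
        hsDiff Ω s (u (φ (θ k))) p = a * fracDiff s (w k) p := by
      rw [ae_all_iff]
      intro k
      filter_upwards [Lp.coeFn_smul a ((hmem k).memLp_fracDiff.toLp (fracDiff s (w k))),
        (hmem k).memLp_fracDiff.coeFn_toLp] with p h1 h2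
      refine h1.trans ?_
      rw [Pi.smul_apply, h2, smul_eq_mul]
    filter_upwards [hφd, hall] with p h1 h2
    exact (h1.comp hθ.tendsto_atTop).congr h2
  have hwr : ∀ᵐ x ∂(volume.restrict Ω), Tendsto (fun k => w k x) atTop (𝓝 (r x)) := by
    have hall : ∀ᵐ x ∂(volume.restrict Ω), ∀ k, hsRestr Ω s (u (φ (θ k))) x = w k x := by
      rw [ae_all_iff]
      exact fun k => (hmem k).memLp.coeFn_toLp
    filter_upwards [hθr, hall] with x h1 h2
    exact h1.congr h2
  -- One good x ∈ Ω is fixed, where w k x converges and the quotients at (x, y) converge for almost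
  -- every y. Then w k y is w k x minus a multiple of the quotient, hence converges for almost every
  -- y in the whole space.
  have hconv : ∀ᵐ y : Eucl N, ∃ l, Tendsto (fun k => w k y) atTop (𝓝 l) := by
    have h1 : ∀ᵐ p ∂((volume.restrict Ω).prod (volume : Measure (Eucl N))),
        Tendsto (fun k => a * fracDiff s (w k) p) atTop (𝓝 (d p)) := by
      have h2 : (volume.restrict Ω).prod (volume : Measure (Eucl N)) =
          (volume.prod volume).restrict (Ω ×ˢ univ) := by
        rw [← Measure.prod_restrict, Measure.restrict_univ]
      rw [h2]
      refine ae_mono (Measure.restrict_mono ?_ le_rfl) hwd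
      rintro p ⟨hp, -⟩ ⟨h3, -⟩
      exact h3 (subset_closure hp)
    have h3 := (Measure.ae_ae_of_ae_prod h1).and hwr
    have hne : volume.restrict Ω ≠ 0 := by
      rw [Ne, Measure.restrict_eq_zero]
      exact (hΩ.isOpen.measure_pos volume hΩ.isConnected.nonempty).ne'
    have : (ae (volume.restrict Ω)).NeBot := ae_neBot.mpr hne
    obtain ⟨x, hx1, hx2⟩ := h3.exists
    have hne_x : ∀ᵐ y : Eucl N, y ≠ x := by
      rw [ae_iff]
      simp
    filter_upwards [hx1, hne_x] with y hy hyx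
    have hpos : 0 < ‖x - y‖ ^ (((N : ℝ) + 2 * s) / 2) :=
      Real.rpow_pos_of_pos (norm_pos_iff.mpr (sub_ne_zero.mpr hyx.symm)) _
    refine ⟨_, (hx2.sub (hy.mul_const (‖x - y‖ ^ (((N : ℝ) + 2 * s) / 2) / a))).congr fun k => ?_⟩
    simp only [fracDiff]
    field_simp
    ring
  obtain ⟨v, hvm, hv⟩ := measurable_limit_of_tendsto_metrizable_ae (fun k => (hmem k).1) hconv
  have hvr : v =ᵐ[volume.restrict Ω] r := by
    filter_upwards [ae_restrict_of_ae hv, hwr] with x h1 h2 using tendsto_nhds_unique h1 h2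
  have hvd : (fun p => a * fracDiff s v p) =ᵐ[volume.restrict (interactionSet Ω)] d := by
    have h1 : ∀ᵐ p : Eucl N × Eucl N, Tendsto (fun k => w k p.1) atTop (𝓝 (v p.1)) :=
      Measure.quasiMeasurePreserving_fst.ae hv
    have h2 : ∀ᵐ p : Eucl N × Eucl N, Tendsto (fun k => w k p.2) atTop (𝓝 (v p.2)) :=
      Measure.quasiMeasurePreserving_snd.ae hv
    filter_upwards [ae_restrict_of_ae h1, ae_restrict_of_ae h2, hwd] with p h1 h2 h3
    exact tendsto_nhds_unique (((h1.sub h2).div_const _).const_mul a) h3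
  have hvLp : MemLp (fracDiff s v) 2 (volume.restrict (interactionSet Ω)) := by
    have h1 : MemLp (fun p => a * fracDiff s v p) 2 (volume.restrict (interactionSet Ω)) :=
      (Lp.memLp d).ae_eq hvd.symm
    have h2 := h1.const_mul a⁻¹
    refine h2.ae_eq (Eventually.of_forall fun p => ?_)
    exact inv_mul_cancel_left₀ hc'.ne' _
  have hvHs : MemHs Ω s v :=
    memHs_iff.mpr ⟨hvm.aemeasurable, (Lp.memLp r).ae_eq hvr.symm, hvLp⟩
  refine ⟨⟨v, hvHs⟩, ?_, ?_⟩
  · refine Lp.ext ?_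
    refine EventuallyEq.trans ?_ hvd
    refine (Lp.coeFn_smul a (hvLp.toLp (fracDiff s v))).trans ?_
    filter_upwards [hvLp.coeFn_toLp] with p h2
    rw [Pi.smul_apply, h2, smul_eq_mul]
  · exact Lp.ext (hvHs.memLp.coeFn_toLp.trans hvr)

/-- The compactness uniform in s, used with a constant sequence of exponents; the factor 1 - s is
simply bounded by 1. -/
theorem exists_subseq_hsRestr [NeZero N] {Ω : Set (Eucl N)} (hΩ : IsBoundedLipschitzDomain Ω)
    {s : ℝ} (hs : s ∈ Ioo (1 / 2 : ℝ) 1) (hc : 0 < fracConst N s) (u : ℕ → hsSpace Ω s) (C : ℝ)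
    (hD : ∀ k, ‖hsDiff Ω s (u k)‖ ≤ C) (hR : ∀ k, ‖hsRestr Ω s (u k)‖ ≤ C) :
    ∃ φ : ℕ → ℕ, StrictMono φ ∧ ∃ r, Tendsto (fun k => hsRestr Ω s (u (φ k))) atTop (𝓝 r) := by
  have hmem : ∀ k, MemHs Ω s (u k).1 := fun k => (u k).2
  refine exists_L2_convergent_subseq hΩ (s := fun _ => s) (M := max (2 * C ^ 2 / fracConst N s) C)
    (fun _ => hs) (fun k => (hmem k).1) (fun k => (hmem k).memLp) (fun k => ?_) fun k => ?_
  · have h1 : fracConst N s / 2 * (gagliardoSq Ω s (u k).1).toReal ≤ C ^ 2 := by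
      rw [← fracForm_self (hmem k), ← inner_hsDiff, real_inner_self_eq_norm_sq]
      exact pow_le_pow_left₀ (norm_nonneg _) (hD k) 2
    have h2 : (gagliardoSq Ω s (u k).1).toReal ≤ 2 * C ^ 2 / fracConst N s := by
      rw [le_div_iff₀ hc]
      linarith
    calc ENNReal.ofReal (1 - s) * gagliardoSq Ω s (u k).1
        ≤ 1 * gagliardoSq Ω s (u k).1 := by
          gcongr
          exact ENNReal.ofReal_le_one.mpr (by linarith [hs.1])
      _ = ENNReal.ofReal (gagliardoSq Ω s (u k).1).toReal := by
          rw [one_mul, ENNReal.ofReal_toReal (hmem k).gagliardo_lt_top.ne]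
      _ ≤ _ := ENNReal.ofReal_le_ofReal (h2.trans (le_max_left _ _))
  · have h1 := (hR k).trans (le_max_right (2 * C ^ 2 / fracConst N s) C)
    have h2 : ‖hsRestr Ω s (u k)‖ = (eLpNorm (u k).1 2 (volume.restrict Ω)).toReal :=
      Lp.norm_toLp _ (hmem k).memLp
    rw [h2] at h1
    rw [← ENNReal.ofReal_toReal (hmem k).memLp.eLpNorm_ne_top]
    exact ENNReal.ofReal_le_ofReal h1

theorem norm_sq_map_sum {X H : Type*} [AddCommGroup X] [Module ℝ X] [NormedAddCommGroup H]
    [InnerProductSpace ℝ H] {n : ℕ} (T : X →ₗ[ℝ] H) (v : Fin n → X) (c : Fin n → ℝ) :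
    ‖T (∑ i, c i • v i)‖ ^ 2 = ∑ i, ∑ j, c i * c j * (⟪T (v i), T (v j)⟫ : ℝ) := by
  rw [← real_inner_self_eq_norm_sq, map_sum, sum_inner]
  refine Finset.sum_congr rfl fun i _ => ?_
  rw [inner_sum]
  refine Finset.sum_congr rfl fun j _ => ?_
  rw [map_smul, map_smul, real_inner_smul_left, real_inner_smul_right, mul_assoc]

/-- The existence half of the min-max principle for the fractional Neumann Laplacian. -/
theorem exists_frac_eigenfunctions [NeZero N] {Ω : Set (Eucl N)} (hΩ : IsBoundedLipschitzDomain Ω)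
    {s : ℝ} (hs : s ∈ Ioo (1 / 2 : ℝ) 1) (hc : 0 < fracConst N s) {n : ℕ} (v : Fin n → Eucl N → ℝ)
    (hv : ∀ i, MemHs Ω s (v i)) (lam : ℝ)
    (hA : ∀ c : Fin n → ℝ, ∑ i, ∑ j, c i * c j * fracForm Ω s (v i) (v j) ≤
      lam * ∑ i, ∑ j, c i * c j * ∫ x in Ω, v i x * v j x)
    (hB : ∀ c : Fin n → ℝ, ∑ i, ∑ j, c i * c j * ∫ x in Ω, v i x * v j x = 0 → c = 0) :
    ∃ (μ : Fin n → ℝ) (w : Fin n → Eucl N → ℝ),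
      (∀ i, μ i ≤ lam ∧ IsFracEigenfunction Ω s (μ i) (w i)) ∧
      ∀ i j, ∫ x in Ω, w i x * w j x = if i = j then 1 else 0 := by
  let V : Fin n → hsSpace Ω s := fun i => ⟨v i, hv i⟩
  have hRsq : ∀ c : Fin n → ℝ, ‖hsRestr Ω s (∑ i, c i • V i)‖ ^ 2 =
      ∑ i, ∑ j, c i * c j * ∫ x in Ω, v i x * v j x := fun c => by
    rw [norm_sq_map_sum]
    simp only [inner_hsRestr, V]
  obtain ⟨μ, w, hw, ho⟩ := exists_orthonormal_eigenvectors (hsDiff Ω s) (hsRestr Ω s)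
    (exists_subseq_hsRestr hΩ hs hc) (exists_limit_hsSpace hΩ hc) V lam
    (fun c => by
      rw [hRsq, norm_sq_map_sum]
      simp only [inner_hsDiff]
      exact hA c)
    (by
      rw [Fintype.linearIndependent_iff]
      intro c h0
      have h1 : hsRestr Ω s (∑ i, c i • V i) = 0 := by
        rw [← h0, map_sum]
        simp only [map_smul]
      have h2 := hRsq c
      rw [h1, norm_zero, zero_pow two_ne_zero] at h2
      exact fun i => congrFun (hB c h2.symm) i) n le_rfl
  simp only [inner_hsRestr, inner_hsDiff] at hw ho
  refine ⟨μ, fun i => (w i).1, fun i => ⟨(hw i).1, (w i).2, fun h0 => ?_, fun x hx =>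
    (hw i).2 ⟨x, hx⟩⟩, ho⟩
  have h1 := ho i i
  rw [if_pos rfl] at h1
  have h2 : ∫ x in Ω, (w i).1 x * (w i).1 x = ∫ x in Ω, (0 : ℝ) :=
    integral_congr_ae (by filter_upwards [h0] with x hx; simp [hx])
  rw [h2, integral_zero] at h1
  exact zero_ne_one h1

theorem IsFracEigenfunction.energy_eq [NeZero N] {Ω : Set (Eucl N)} {s lam : ℝ} {u : Eucl N → ℝ}
    (h : IsFracEigenfunction Ω s lam u) :
    fracConst N s / 2 * (gagliardoSq Ω s u).toReal = lam * ∫ x in Ω, u x * u x := by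
  rw [← fracForm_self h.memHs, h.weak_eq u h.memHs]

theorem integral_mul_self_pos {Ω : Set (Eucl N)} {u : Eucl N → ℝ}
    (hu : MemLp u 2 (volume.restrict Ω)) (h0 : ¬ u =ᵐ[volume.restrict Ω] 0) :
    0 < ∫ x in Ω, u x * u x := by
  refine lt_of_le_of_ne (integral_nonneg fun x => mul_self_nonneg _) fun h => h0 ?_
  have h1 := (integral_eq_zero_iff_of_nonneg (fun x => mul_self_nonneg (u x))
    (MemLp.integrable_mul (p := 2) (q := 2) hu hu)).mp h.symm
  filter_upwards [h1] with x hx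
  exact mul_self_eq_zero.mp hx

theorem IsFracEigenfunction.nonneg [NeZero N] {Ω : Set (Eucl N)} {s lam : ℝ} {u : Eucl N → ℝ}
    (h : IsFracEigenfunction Ω s lam u) : 0 ≤ lam := by
  have h1 := h.energy_eq
  have h2 := integral_mul_self_pos h.memHs.memLp h.ne_zero
  have h3 : 0 ≤ lam * ∫ x in Ω, u x * u x := by
    rw [← h1]
    exact mul_nonneg (div_nonneg (fracConst_nonneg s) two_pos.le) ENNReal.toReal_nonneg
  exact nonneg_of_mul_nonneg_left h3 h2

end FracSpectral

/-! ### Limits of fractional eigenfunctions -/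

section Limits

variable {N : ℕ}

theorem tendsto_integral_inner {α E : Type*} [MeasurableSpace α] {μ : Measure α}
    [NormedAddCommGroup E] [InnerProductSpace ℝ E] {f g : ℕ → α → E} {f₀ g₀ : α → E}
    (hf : ∀ k, MemLp (f k) 2 μ) (hg : ∀ k, MemLp (g k) 2 μ) (hf₀ : MemLp f₀ 2 μ)
    (hg₀ : MemLp g₀ 2 μ)
    (hfl : Tendsto (fun k => eLpNorm (fun x => f k x - f₀ x) 2 μ) atTop (𝓝 0))
    (hgl : Tendsto (fun k => eLpNorm (fun x => g k x - g₀ x) 2 μ) atTop (𝓝 0)) :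
    Tendsto (fun k => ∫ x, (⟪f k x, g k x⟫ : ℝ) ∂μ) atTop (𝓝 (∫ x, (⟪f₀ x, g₀ x⟫ : ℝ) ∂μ)) := by
  have h1 := (Lp.tendsto_Lp_iff_tendsto_eLpNorm'' f hf f₀ hf₀).mpr hfl
  have h2 := (Lp.tendsto_Lp_iff_tendsto_eLpNorm'' g hg g₀ hg₀).mpr hgl
  have key : ∀ {a b : α → E} (ha : MemLp a 2 μ) (hb : MemLp b 2 μ),
      (⟪ha.toLp a, hb.toLp b⟫ : ℝ) = ∫ x, (⟪a x, b x⟫ : ℝ) ∂μ := by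
    intro a b ha hb
    rw [L2.inner_def]
    refine integral_congr_ae ?_
    filter_upwards [ha.coeFn_toLp, hb.coeFn_toLp] with x e1 e2
    rw [e1, e2]
  have h3 := Filter.Tendsto.inner (𝕜 := ℝ) h1 h2
  simp only [key] at h3
  exact h3

theorem tendsto_integral_mul {α : Type*} [MeasurableSpace α] {μ : Measure α}
    {f g : ℕ → α → ℝ} {f₀ g₀ : α → ℝ}
    (hf : ∀ k, MemLp (f k) 2 μ) (hg : ∀ k, MemLp (g k) 2 μ) (hf₀ : MemLp f₀ 2 μ)
    (hg₀ : MemLp g₀ 2 μ)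
    (hfl : Tendsto (fun k => eLpNorm (fun x => f k x - f₀ x) 2 μ) atTop (𝓝 0))
    (hgl : Tendsto (fun k => eLpNorm (fun x => g k x - g₀ x) 2 μ) atTop (𝓝 0)) :
    Tendsto (fun k => ∫ x, f k x * g k x ∂μ) atTop (𝓝 (∫ x, f₀ x * g₀ x ∂μ)) := by
  have h := tendsto_integral_inner hg hf hg₀ hf₀ hgl hfl
  simpa only [real_inner_eq_re_inner, RCLike.inner_apply, conj_trivial, RCLike.re_to_real] using h

theorem integrable_inner_of_memLp {α E : Type*} [MeasurableSpace α] {μ : Measure α}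
    [NormedAddCommGroup E] [InnerProductSpace ℝ E] {f g : α → E} (hf : MemLp f 2 μ)
    (hg : MemLp g 2 μ) : Integrable (fun x => (⟪f x, g x⟫ : ℝ)) μ := by
  refine (MemLp.integrable_mul (p := 2) (q := 2) hf.norm hg.norm).mono' (hf.1.inner hg.1)
    (Eventually.of_forall fun x => ?_)
  exact norm_inner_le_norm _ _

theorem HasH1Gradient.add_smul {Ω : Set (Eucl N)} {u v : Eucl N → ℝ} {g h : Eucl N → Eucl N}
    (hu : HasH1Gradient Ω u g) (hv : HasH1Gradient Ω v h) (t : ℝ) :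
    HasH1Gradient Ω (u + t • v) (g + t • h) where
  memLp := hu.memLp.add (hv.memLp.const_smul t)
  memLp_grad := hu.memLp_grad.add (hv.memLp_grad.const_smul t)
  weak_grad φ hφ hc hsub e := by
    have hφ2 : MemLp φ 2 (volume.restrict Ω) :=
      (hφ.continuous.memLp_of_hasCompactSupport hc).restrict Ω
    have hdφ2 : MemLp (fun x => fderiv ℝ φ x e) 2 (volume.restrict Ω) :=
      ((((hφ.continuous_fderiv (by simp)).clm_apply continuous_const)).memLp_of_hasCompactSupport
        ((hc.fderiv (𝕜 := ℝ)).comp_left (g := fun L : Eucl N →L[ℝ] ℝ => L e) (by simp))).restrict Ω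
    have i1 : ∀ {w : Eucl N → ℝ}, MemLp w 2 (volume.restrict Ω) →
        Integrable (fun x => w x * fderiv ℝ φ x e) (volume.restrict Ω) := fun hw =>
      MemLp.integrable_mul (p := 2) (q := 2) hw hdφ2
    have i2 : ∀ {w : Eucl N → Eucl N}, MemLp w 2 (volume.restrict Ω) →
        Integrable (fun x => (⟪w x, e⟫ : ℝ) * φ x) (volume.restrict Ω) := fun hw =>
      MemLp.integrable_mul (p := 2) (q := 2) (hw.inner_const e) hφ2
    have e1 : ∀ x, (u + t • v) x * fderiv ℝ φ x e =
        u x * fderiv ℝ φ x e + t * (v x * fderiv ℝ φ x e) := fun x => by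
      simp only [Pi.add_apply, Pi.smul_apply, smul_eq_mul]; ring
    have e2 : ∀ x, (⟪(g + t • h) x, e⟫ : ℝ) * φ x =
        (⟪g x, e⟫ : ℝ) * φ x + t * ((⟪h x, e⟫ : ℝ) * φ x) := fun x => by
      simp only [Pi.add_apply, Pi.smul_apply, inner_add_left, real_inner_smul_left]; ring
    simp only [e1, e2]
    rw [integral_add (i1 hu.memLp) ((i1 hv.memLp).const_mul t),
      integral_add (i2 hu.memLp_grad) ((i2 hv.memLp_grad).const_mul t), integral_const_mul,
      integral_const_mul, hu.weak_grad φ hφ hc hsub e, hv.weak_grad φ hφ hc hsub e]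
    ring

theorem HasH1Gradient.unique {Ω : Set (Eucl N)} (hΩ : IsOpen Ω) {u : Eucl N → ℝ}
    {g h : Eucl N → Eucl N} (hg : HasH1Gradient Ω u g) (hh : HasH1Gradient Ω u h) :
    g =ᵐ[volume.restrict Ω] h := by
  have hΩm := hΩ.measurableSet
  have key : ∀ j : Fin N, ∀ᵐ x : Eucl N, x ∈ Ω → g x j = h x j := by
    intro j
    set e : Eucl N := EuclideanSpace.single j 1 with he
    have hd : MemLp (fun x => (⟪g x, e⟫ : ℝ) - ⟪h x, e⟫) 2 (volume.restrict Ω) :=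
      (hg.memLp_grad.inner_const e).sub (hh.memLp_grad.inner_const e)
    have hloc : LocallyIntegrableOn (Ω.indicator fun x => (⟪g x, e⟫ : ℝ) - ⟪h x, e⟫) Ω volume :=
      ((memLp_indicator_of_restrict hΩm hd).locallyIntegrable (by simp)).locallyIntegrableOn _
    have hz := hΩ.ae_eq_zero_of_integral_contDiff_smul_eq_zero hloc fun φ hφ hc hsub => by
      have hφ2 : MemLp φ 2 (volume.restrict Ω) :=
        (hφ.continuous.memLp_of_hasCompactSupport hc).restrict Ω
      have e1 : ∫ x, φ x • Ω.indicator (fun x => (⟪g x, e⟫ : ℝ) - ⟪h x, e⟫) x =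
          ∫ x in Ω, ((⟪g x, e⟫ : ℝ) * φ x - (⟪h x, e⟫ : ℝ) * φ x) := by
        rw [← integral_indicator hΩm]
        refine integral_congr_ae (Eventually.of_forall fun x => ?_)
        by_cases hx : x ∈ Ω
        · simp only [indicator_of_mem hx, smul_eq_mul]; ring
        · simp [hx]
      have h1 := hg.weak_grad φ hφ hc hsub e
      have h2 := hh.weak_grad φ hφ hc hsub e
      have i1 : Integrable (fun x => (⟪g x, e⟫ : ℝ) * φ x) (volume.restrict Ω) :=
        MemLp.integrable_mul (p := 2) (q := 2) (hg.memLp_grad.inner_const e) hφ2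
      have i2 : Integrable (fun x => (⟪h x, e⟫ : ℝ) * φ x) (volume.restrict Ω) :=
        MemLp.integrable_mul (p := 2) (q := 2) (hh.memLp_grad.inner_const e) hφ2
      rw [e1, integral_sub i1 i2]
      linarith
    filter_upwards [hz] with x hx hxΩ
    have h1 := hx hxΩ
    rw [indicator_of_mem hxΩ, he, EuclideanSpace.inner_single_right,
      EuclideanSpace.inner_single_right] at h1
    simpa [sub_eq_zero] using h1
  rw [EventuallyEq, ae_restrict_iff' hΩm]
  filter_upwards [ae_all_iff.mpr key] with x hx hxΩ
  ext j
  exact hx j hxΩ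

theorem fracForm_add_smul_self [NeZero N] {Ω : Set (Eucl N)} {s : ℝ} {u v : Eucl N → ℝ} (hu : MemHs Ω s u)
    (hv : MemHs Ω s v) (t : ℝ) :
    fracForm Ω s (u + t • v) (u + t • v) =
      fracForm Ω s u u + 2 * t * fracForm Ω s u v + t ^ 2 * fracForm Ω s v v := by
  have h := @inner_hsDiff N _ Ω s
  have e : (⟨u + t • v, hu.add (hv.const_smul t)⟩ : hsSpace Ω s) =
    ⟨u, hu⟩ + t • ⟨v, hv⟩ := rfl
  have h0 := h ⟨u + t • v, hu.add (hv.const_smul t)⟩ ⟨u + t • v, hu.add (hv.const_smul t)⟩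
  rw [e, map_add, map_smul, real_inner_add_add_self, real_inner_smul_right, real_inner_smul_left,
    real_inner_smul_right, h, h, h] at h0
  refine h0.symm.trans ?_
  ring

theorem gradient_add_smul {u v : Eucl N → ℝ} (hu : ContDiff ℝ ∞ u) (hv : ContDiff ℝ ∞ v) (t : ℝ)
    (x : Eucl N) : gradient (u + t • v) x = gradient u x + t • gradient v x := by
  refine ext_inner_right ℝ fun z => ?_
  have h1 := ((hu.differentiable (by simp) x).hasFDerivAt).add
    (((hv.differentiable (by simp) x).hasFDerivAt).const_smul t)
  rw [inner_gradient, inner_add_left, real_inner_smul_left, inner_gradient, inner_gradient, h1.fderiv]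
  simp

theorem memLp_gradient {v : Eucl N → ℝ} (hv : ContDiff ℝ ∞ v) (hc : HasCompactSupport v)
    (Ω : Set (Eucl N)) : MemLp (gradient v) 2 (volume.restrict Ω) :=
  (hasH1Gradient_of_contDiff hv hc).memLp_grad

theorem integral_norm_add_smul_sq {μ : Measure (Eucl N)} {g h : Eucl N → Eucl N}
    (hg : MemLp g 2 μ) (hh : MemLp h 2 μ) (t : ℝ) :
    ∫ x, ‖g x + t • h x‖ ^ 2 ∂μ = ∫ x, ‖g x‖ ^ 2 ∂μ + 2 * t * ∫ x, (⟪g x, h x⟫ : ℝ) ∂μ +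
      t ^ 2 * ∫ x, ‖h x‖ ^ 2 ∂μ := by
  have e : ∀ x, ‖g x + t • h x‖ ^ 2 = (⟪g x, g x⟫ : ℝ) + (2 * t) * ⟪g x, h x⟫ +
      t ^ 2 * (⟪h x, h x⟫ : ℝ) := fun x => by
    rw [norm_add_sq_real, real_inner_smul_right, norm_smul, real_inner_self_eq_norm_sq,
      real_inner_self_eq_norm_sq, mul_pow, Real.norm_eq_abs, sq_abs]
    ring
  have i1 := integrable_inner_of_memLp hg hg
  have i2 := (integrable_inner_of_memLp hg hh).const_mul (2 * t)
  have i3 := (integrable_inner_of_memLp hh hh).const_mul (t ^ 2)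
  simp only [e]
  have i12 : Integrable (fun x => (⟪g x, g x⟫ : ℝ) + (2 * t) * ⟪g x, h x⟫) μ := i1.add i2
  rw [integral_add i12 i3, integral_add i1 i2, integral_const_mul, integral_const_mul]
  simp only [real_inner_self_eq_norm_sq]

theorem tendsto_fracForm_of_contDiff [NeZero N] {Ω : Set (Eucl N)} (hΩ : IsBoundedLipschitzDomain Ω)
    {u v : Eucl N → ℝ} (hu : ContDiff ℝ ∞ u) (huc : HasCompactSupport u) (hv : ContDiff ℝ ∞ v)
    (hvc : HasCompactSupport v) :
    Tendsto (fun s => fracForm Ω s u v) (𝓝[<] 1) (𝓝 (∫ x in Ω, (⟪gradient u x, gradient v x⟫ : ℝ))) := by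
  have hE : ∀ {w : Eucl N → ℝ}, ContDiff ℝ ∞ w → HasCompactSupport w →
      Tendsto (fun s => fracForm Ω s w w) (𝓝[<] 1) (𝓝 (∫ x in Ω, ‖gradient w x‖ ^ 2)) := by
    intro w hw hwc
    refine (tendsto_energy_of_contDiff hΩ hw hwc).congr' ?_
    filter_upwards [eventually_mem_Ioo_half] with s hs
    exact (fracForm_self (memHs_of_contDiff hΩ.isBounded hw hwc (by linarith [hs.1]) hs.2)).symm
  -- Polarization: the mixed form is recovered from the energies of u + v, u and v.
  have h1 := hE (w := u + (1 : ℝ) • v) (hu.add (hv.const_smul (1 : ℝ)))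
    (huc.add (hvc.smul_left (f := fun _ => (1 : ℝ))))
  simp only [gradient_add_smul hu hv] at h1
  rw [integral_norm_add_smul_sq (memLp_gradient hu huc Ω) (memLp_gradient hv hvc Ω)] at h1
  have h2 := ((h1.sub (hE hu huc)).sub (hE hv hvc)).div_const 2
  have e2 : ∀ a b c : ℝ, (a + 2 * 1 * b + 1 ^ 2 * c - a - c) / 2 = b := fun a b c => by ring
  rw [e2] at h2
  refine h2.congr' ?_
  filter_upwards [eventually_mem_Ioo_half] with s hs
  have hs0 : 0 < s := by linarith [hs.1]
  rw [fracForm_add_smul_self (memHs_of_contDiff hΩ.isBounded hu huc hs0 hs.2)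
    (memHs_of_contDiff hΩ.isBounded hv hvc hs0 hs.2), e2]

theorem eq_zero_of_forall_affine_nonneg {a b : ℝ} (h : ∀ t : ℝ, 0 ≤ a + 2 * t * b) : b = 0 := by
  by_contra hb
  have h1 := h (-(a + 1) / (2 * b))
  have h2 : 2 * (-(a + 1) / (2 * b)) * b = -(a + 1) := by field_simp
  linarith

/-- An `L²` limit of fractional eigenfunctions, as `s → 1`, is an eigenfunction of the local
Neumann Laplacian. -/
theorem isLocalEigenfunction_of_tendsto [NeZero N] {Ω : Set (Eucl N)}
    (hΩ : IsBoundedLipschitzDomain Ω) {s lam : ℕ → ℝ} {l : ℝ} {u : ℕ → Eucl N → ℝ} {w : Eucl N → ℝ}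
    (hs : Tendsto s atTop (𝓝[<] 1)) (hs' : ∀ k, s k ∈ Ioo (1 / 2 : ℝ) 1)
    (hu : ∀ k, IsFracEigenfunction Ω (s k) (lam k) (u k))
    (hl : Tendsto lam atTop (𝓝 l)) (hw : MemLp w 2 (volume.restrict Ω))
    (hw0 : ¬ w =ᵐ[volume.restrict Ω] 0)
    (huw : Tendsto (fun k => eLpNorm (fun x => u k x - w x) 2 (volume.restrict Ω)) atTop (𝓝 0)) :
    IsLocalEigenfunction Ω l w := by
  have hΩo := hΩ.isOpen
  have hs0 : ∀ k, 0 < s k := fun k => by linarith [(hs' k).1]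
  have hmem : ∀ k, MemHs Ω (s k) (u k) := fun k => (hu k).memHs
  have hconst : ∀ v : Eucl N → ℝ,
      Tendsto (fun _ : ℕ => eLpNorm (fun x => v x - v x) 2 (volume.restrict Ω)) atTop (𝓝 0) :=
    fun v => by simp
  have huu : Tendsto (fun k => lam k * ∫ x in Ω, u k x * u k x) atTop
      (𝓝 (l * ∫ x in Ω, w x * w x)) :=
    hl.mul (tendsto_integral_mul (fun k => (hmem k).memLp) (fun k => (hmem k).memLp) hw hw huw huw)
  obtain ⟨g, hg, -⟩ := exists_H1Gradient_of_tendsto hΩo (volume_ne_top hΩ) hs hmem hw huw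
    (fun k => (hu k).energy_eq.le) huu
  have hsmooth : ∀ v : Eucl N → ℝ, ContDiff ℝ ∞ v → HasCompactSupport v →
      ∫ x in Ω, (⟪g x, gradient v x⟫ : ℝ) = l * ∫ x in Ω, w x * v x := by
    intro v hv hvc
    have hvH : ∀ k, MemHs Ω (s k) v := fun k =>
      memHs_of_contDiff hΩ.isBounded hv hvc (hs0 k) (hs' k).2
    have hv2 : MemLp v 2 (volume.restrict Ω) := (hvH 0).memLp
    have huv : Tendsto (fun k => lam k * ∫ x in Ω, u k x * v x) atTop
        (𝓝 (l * ∫ x in Ω, w x * v x)) :=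
      hl.mul (tendsto_integral_mul (fun k => (hmem k).memLp) (fun _ => hv2) hw hv2 huw (hconst v))
    have hvv : Tendsto (fun k => fracForm Ω (s k) v v) atTop
        (𝓝 (∫ x in Ω, ‖gradient v x‖ ^ 2)) := by
      have := (tendsto_fracForm_of_contDiff hΩ hv hvc hv hvc).comp hs
      simp only [real_inner_self_eq_norm_sq] at this
      exact this
    -- The fractional equation expands the energy of u k + t v exactly, and its limit dominates the
    -- Dirichlet energy of w + t v by lower semicontinuity. The energies of the smooth v converge,
    -- so the t² terms cancel. An affine function of t that is nonnegative everywhere has zero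
    -- slope.
    have hineq : ∀ t : ℝ, 0 ≤ (l * ∫ x in Ω, w x * w x) - (∫ x in Ω, ‖g x‖ ^ 2) +
        2 * t * ((l * ∫ x in Ω, w x * v x) - ∫ x in Ω, (⟪g x, gradient v x⟫ : ℝ)) := by
      intro t
      have hm : ∀ k, fracConst N (s k) / 2 * (gagliardoSq Ω (s k) (u k + t • v)).toReal ≤
          (lam k * ∫ x in Ω, u k x * u k x) + 2 * t * (lam k * ∫ x in Ω, u k x * v x) +
            t ^ 2 * fracForm Ω (s k) v v := fun k => by
        rw [← fracForm_self ((hmem k).add ((hvH k).const_smul t)),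
          fracForm_add_smul_self (hmem k) (hvH k), (hu k).weak_eq _ (hmem k),
          (hu k).weak_eq _ (hvH k)]
      obtain ⟨gt, hgt, hle⟩ := exists_H1Gradient_of_tendsto hΩo (volume_ne_top hΩ) hs
        (fun k => (hmem k).add ((hvH k).const_smul t)) (hw.add (hv2.const_smul t))
        (huw.congr fun k => by
          congr 1
          ext x
          simp) hm ((huu.add (huv.const_mul (2 * t))).add (hvv.const_mul (t ^ 2)))
      have heq := hgt.unique hΩo (hg.add_smul (hasH1Gradient_of_contDiff hv hvc) t)
      have e1 : ∫ x in Ω, ‖gt x‖ ^ 2 = ∫ x in Ω, ‖g x + t • gradient v x‖ ^ 2 := by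
        refine integral_congr_ae ?_
        filter_upwards [heq] with x hx
        rw [hx]
        rfl
      rw [e1, integral_norm_add_smul_sq hg.memLp_grad (memLp_gradient hv hvc Ω)] at hle
      linarith
    have := eq_zero_of_forall_affine_nonneg hineq
    linarith
  refine ⟨hw0, g, hg, fun v h hv => ?_⟩
  obtain ⟨vk, hvk, hv1, hv2⟩ := exists_contDiff_tendsto_H1 hΩ hv
  have hvkm : ∀ k, MemLp (vk k) 2 (volume.restrict Ω) := fun k =>
    (hasH1Gradient_of_contDiff (hvk k).1 (hvk k).2).memLp
  have t1 := tendsto_integral_inner (fun _ : ℕ => hg.memLp_grad)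
    (fun k => memLp_gradient (hvk k).1 (hvk k).2 Ω) hg.memLp_grad hv.memLp_grad (by simp) hv2
  have t2 := (tendsto_integral_mul (fun _ : ℕ => hw) hvkm hw hv.memLp (hconst w) hv1).const_mul l
  exact tendsto_nhds_unique (t1.congr fun k => hsmooth _ (hvk k).1 (hvk k).2) t2

end Limits

/-! ### Convergence of the eigenvalues -/

section Main

variable {N : ℕ}

theorem IsLocalEigenfunction.nonneg {Ω : Set (Eucl N)} {lam : ℝ} {u : Eucl N → ℝ}
    (h : IsLocalEigenfunction Ω lam u) : 0 ≤ lam := by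
  obtain ⟨g, hg, he⟩ := h.weak_eq
  have h1 := he u g hg
  have h2 := integral_mul_self_pos hg.memLp h.ne_zero
  refine nonneg_of_mul_nonneg_left (h1 ▸ integral_nonneg fun x => ?_) h2
  exact real_inner_self_nonneg

theorem bddBelow_of_nonneg {Ω : Set (Eucl N)} {P : ℝ → (Eucl N → ℝ) → Prop}
    (hP : ∀ l u, P l u → 0 ≤ l) (n : ℕ) :
    BddBelow {t : ℝ | ∃ (lam : Fin (n + 1) → ℝ) (u : Fin (n + 1) → Eucl N → ℝ),
      (∀ i, lam i ≤ t ∧ P (lam i) (u i)) ∧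
        ∀ i j, ∫ x in Ω, u i x * u j x = if i = j then 1 else 0} := by
  refine ⟨0, ?_⟩
  rintro t ⟨lam, u, h, -⟩
  exact (hP _ _ (h 0).2).trans (h 0).1

variable [NeZero N]

/-- Bumps with disjoint supports at n distinct points of Ω have a diagonal Gram matrix with positive
entries. -/
theorem exists_orthogonal_test_functions {Ω : Set (Eucl N)} (hΩ : IsBoundedLipschitzDomain Ω)
    (n : ℕ) : ∃ (v : Fin n → Eucl N → ℝ) (b : ℝ), 0 < b ∧
      (∀ i, ContDiff ℝ ∞ (v i) ∧ HasCompactSupport (v i)) ∧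
      ∀ c : Fin n → ℝ, b * ∑ i, c i ^ 2 ≤ ∑ i, ∑ j, c i * c j * ∫ x in Ω, v i x * v j x := by
  have hinf : Ω.Infinite := fun hfin =>
    (hΩ.isOpen.measure_pos volume hΩ.isConnected.nonempty).ne' (hfin.measure_zero volume)
  have : Infinite Ω := hinf.to_subtype
  let p : Fin n → Eucl N := fun i => (Infinite.natEmbedding Ω i : Eucl N)
  have hpinj : Function.Injective p := fun i j h =>
    Fin.ext ((Infinite.natEmbedding Ω).injective (Subtype.ext h))
  have hpΩ : ∀ i, p i ∈ Ω := fun i => (Infinite.natEmbedding Ω i).2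
  obtain ⟨U, hU, hdisj⟩ := (Set.finite_range p).t2_separation
  choose v hv using fun i => exists_contDiff_tsupport_subset (n := ⊤) ((hU (p i)).2.mem_nhds (hU (p i)).1)
  have hcont : ∀ i, Continuous (v i) := fun i => (hv i).2.2.1.continuous
  have hpos : ∀ i, 0 < ∫ x in Ω, v i x * v i x := by
    intro i
    refine integral_mul_self_pos
      (((hcont i).memLp_of_hasCompactSupport (hv i).2.1).restrict Ω) fun h0 => ?_
    have h1 : EqOn (v i) 0 Ω :=
      Measure.eqOn_open_of_ae_eq h0 hΩ.isOpen (hcont i).continuousOn continuousOn_const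
    have h2 := h1 (hpΩ i)
    rw [(hv i).2.2.2.2] at h2
    exact one_ne_zero h2
  have hoff : ∀ i j, i ≠ j → ∫ x in Ω, v i x * v j x = 0 := by
    intro i j hij
    refine integral_eq_zero_of_ae (Eventually.of_forall fun x => ?_)
    by_contra hx
    have h1 : v i x ≠ 0 ∧ v j x ≠ 0 := mul_ne_zero_iff.mp hx
    have h2 := hdisj (mem_range_self i) (mem_range_self j) (hpinj.ne hij)
    exact Set.disjoint_left.mp h2 ((hv i).1 (subset_tsupport _ h1.1))
      ((hv j).1 (subset_tsupport _ h1.2))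
  obtain ⟨b, hb0, hb⟩ : ∃ b > 0, ∀ i, b ≤ ∫ x in Ω, v i x * v i x := by
    rcases isEmpty_or_nonempty (Fin n) with h | h
    · exact ⟨1, one_pos, fun i => h.elim i⟩
    · obtain ⟨i, hi⟩ := Finite.exists_min fun i => ∫ x in Ω, v i x * v i x
      exact ⟨_, hpos i, hi⟩
  refine ⟨v, b, hb0, fun i => ⟨(hv i).2.2.1, (hv i).2.1⟩, fun c => ?_⟩
  rw [Finset.mul_sum]
  refine Finset.sum_le_sum fun i _ => ?_
  rw [Finset.sum_eq_single i (fun j _ hj => by rw [hoff i j hj.symm, mul_zero]) (by simp)]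
  nlinarith [hb i, sq_nonneg (c i)]

/-- The margin η in the local inequality absorbs the difference between the fractional and Dirichlet
form matrices once s is near 1. The Rayleigh quotient is then at most T on the span, and min-max
applies. -/
theorem eventually_exists_frac_eigenfunctions {Ω : Set (Eucl N)} (hΩ : IsBoundedLipschitzDomain Ω)
    {n : ℕ} {v : Fin n → Eucl N → ℝ} (hv : ∀ i, ContDiff ℝ ∞ (v i) ∧ HasCompactSupport (v i))
    {b η T : ℝ} (hb : 0 < b) (hη : 0 < η)
    (hB : ∀ c : Fin n → ℝ, b * ∑ i, c i ^ 2 ≤ ∑ i, ∑ j, c i * c j * ∫ x in Ω, v i x * v j x)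
    (hT : ∀ c : Fin n → ℝ, η * ∑ i, c i ^ 2 ≤ ∑ i, ∑ j, c i * c j *
      (T * (∫ x in Ω, v i x * v j x) - ∫ x in Ω, (⟪gradient (v i) x, gradient (v j) x⟫ : ℝ))) :
    ∀ᶠ s in 𝓝[<] (1 : ℝ), ∃ (μ : Fin n → ℝ) (w : Fin n → Eucl N → ℝ),
      (∀ i, μ i ≤ T ∧ IsFracEigenfunction Ω s (μ i) (w i)) ∧
      ∀ i j, ∫ x in Ω, w i x * w j x = if i = j then 1 else 0 := by
  have hlim := eventually_quadForm_ge (l := 𝓝[<] (1 : ℝ)) hη (fun i j =>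
    (tendsto_fracForm_of_contDiff hΩ (hv i).1 (hv i).2 (hv j).1 (hv j).2).const_sub
      (T * ∫ x in Ω, v i x * v j x)) hT
  filter_upwards [hlim, eventually_mem_Ioo_half, eventually_fracConst_pos (N := N)] with s hA hs hc
  refine exists_frac_eigenfunctions hΩ hs hc v (fun i => memHs_of_contDiff hΩ.isBounded (hv i).1
    (hv i).2 (by linarith [hs.1]) hs.2) T (fun c => ?_) fun c h0 => ?_
  · have h1 : 0 ≤ η / 2 * ∑ i, c i ^ 2 :=
      mul_nonneg (half_pos hη).le (Finset.sum_nonneg fun i _ => sq_nonneg _)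
    have h2 := h1.trans (hA c)
    have e : ∑ i, ∑ j, c i * c j * (T * (∫ x in Ω, v i x * v j x) - fracForm Ω s (v i) (v j)) =
        T * ∑ i, ∑ j, c i * c j * (∫ x in Ω, v i x * v j x) -
          ∑ i, ∑ j, c i * c j * fracForm Ω s (v i) (v j) := by
      simp only [Finset.mul_sum, ← Finset.sum_sub_distrib]
      exact Finset.sum_congr rfl fun i _ => Finset.sum_congr rfl fun j _ => by ring
    linarith
  · have h1 := hB c
    rw [h0] at h1
    have h2 : ∑ i, c i ^ 2 ≤ 0 := nonpos_of_mul_nonpos_right h1 hb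
    have h3 := (Finset.sum_eq_zero_iff_of_nonneg fun i _ => sq_nonneg (c i)).mp
      (le_antisymm h2 (Finset.sum_nonneg fun i _ => sq_nonneg _))
    ext i
    exact pow_eq_zero_iff two_ne_zero |>.mp (h3 i (Finset.mem_univ i))

theorem exists_subseq_eigenpair {Ω : Set (Eucl N)} (hΩ : IsBoundedLipschitzDomain Ω)
    {s lam : ℕ → ℝ} {u : ℕ → Eucl N → ℝ} {T : ℝ} (hs : Tendsto s atTop (𝓝[<] 1))
    (hu : ∀ k, IsFracEigenfunction Ω (s k) (lam k) (u k)) (hT : ∀ k, lam k ≤ T)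
    (hn : ∀ k, ∫ x in Ω, u k x * u k x = 1) :
    ∃ φ : ℕ → ℕ, StrictMono φ ∧ ∃ (l : ℝ) (w : Lp ℝ 2 (volume.restrict Ω)),
      Tendsto (fun k => (lam (φ k), (hu (φ k)).memHs.memLp.toLp (u (φ k)))) atTop (𝓝 (l, w)) := by
  obtain ⟨c, hc, hlow⟩ := exists_fracConst_lower_bound (N := N)
  obtain ⟨k₀, hk₀⟩ := eventually_atTop.mp (hs.eventually (hlow.and eventually_mem_Ioo_half))
  have hT0 : 0 ≤ T := (hu 0).nonneg.trans (hT 0)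
  -- The lower bound on c_{N,s} holds only from index k₀ on, hence the shift. Normalized
  -- eigenfunctions have energy at most T, so (1-s)[u]² ≤ 2T/c; the entry 1 in the maximum bounds
  -- the L² norms.
  obtain ⟨φ, hφ, w, hw⟩ := exists_L2_convergent_subseq hΩ (s := fun k => s (k + k₀))
    (u := fun k => u (k + k₀)) (M := max (2 * T / c) 1) (fun k => (hk₀ (k + k₀) (by omega)).2)
    (fun k => (hu (k + k₀)).memHs.1) (fun k => (hu (k + k₀)).memHs.memLp)
    (fun k => by
      have h1 := (hu (k + k₀)).energy_eq
      have h2 := (hk₀ (k + k₀) (by omega)).1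
      rw [hn, mul_one] at h1
      have hs1 := (hk₀ (k + k₀) (by omega)).2.2
      rw [← ENNReal.ofReal_toReal (hu (k + k₀)).memHs.gagliardo_lt_top.ne,
        ← ENNReal.ofReal_mul (by linarith)]
      refine ENNReal.ofReal_le_ofReal (le_trans ?_ (le_max_left _ _))
      rw [le_div_iff₀ hc]
      have h3 := mul_le_mul_of_nonneg_right h2
        (ENNReal.toReal_nonneg (a := gagliardoSq Ω (s (k + k₀)) (u (k + k₀))))
      have h4 := hT (k + k₀)
      linarith)
    (fun k => by
      refine le_trans (le_of_eq ?_) (ENNReal.ofReal_le_ofReal (le_max_right _ _))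
      rw [ENNReal.ofReal_one]
      have h1 := eLpNorm_two_sq (μ := volume.restrict Ω) (u (k + k₀))
      rw [lintegral_sq_eq_ofReal_integral (hu (k + k₀)).memHs.memLp] at h1
      simp only [sq (u _ _)] at h1
      rw [hn, ENNReal.ofReal_one] at h1
      exact (ENNReal.pow_right_strictMono two_ne_zero).injective (by simpa using h1))
  obtain ⟨l, -, ψ, hψ, hl⟩ := (isCompact_Icc (a := (0 : ℝ)) (b := T)).tendsto_subseq
    (x := fun k => lam (φ k + k₀)) fun k => ⟨(hu _).nonneg, hT _⟩
  refine ⟨fun k => φ (ψ k) + k₀, fun i j hij => by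
    have := hφ (hψ hij); simpa using this, l, w, ?_⟩
  exact hl.prodMk_nhds (hw.comp hψ.tendsto_atTop)

theorem exists_common_subseq {ι X : Type*} [Finite ι] [TopologicalSpace X] (x : ι → ℕ → X)
    (h : ∀ i (φ : ℕ → ℕ), StrictMono φ →
      ∃ ψ : ℕ → ℕ, StrictMono ψ ∧ ∃ a, Tendsto (fun k => x i (φ (ψ k))) atTop (𝓝 a)) :
    ∃ φ : ℕ → ℕ, StrictMono φ ∧ ∀ i, ∃ a, Tendsto (fun k => x i (φ k)) atTop (𝓝 a) := by
  classical
  cases nonempty_fintype ι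
  suffices H : ∀ t : Finset ι, ∃ φ : ℕ → ℕ, StrictMono φ ∧
      ∀ i ∈ t, ∃ a, Tendsto (fun k => x i (φ k)) atTop (𝓝 a) by
    obtain ⟨φ, hφ, h⟩ := H Finset.univ
    exact ⟨φ, hφ, fun i => h i (Finset.mem_univ i)⟩
  intro t
  induction t using Finset.induction_on with
  | empty => exact ⟨id, strictMono_id, by simp⟩
  | insert i t _ ih =>
    obtain ⟨φ, hφ, ht⟩ := ih
    obtain ⟨ψ, hψ, a, ha⟩ := h i φ hφ
    refine ⟨φ ∘ ψ, hφ.comp hψ, fun j hj => ?_⟩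
    rcases Finset.mem_insert.mp hj with rfl | hj
    · exact ⟨a, ha⟩
    · obtain ⟨b, hb⟩ := ht j hj
      exact ⟨b, hb.comp hψ.tendsto_atTop⟩

/-- A common subsequence makes all n eigenpairs converge; strong L² convergence preserves
orthonormality, which also keeps the limits nonzero. Besides the lower bound on eigenvalues, this
supplies the existence of local eigenfunctions. -/
theorem exists_local_eigenfunctions_of_frequently {Ω : Set (Eucl N)}
    (hΩ : IsBoundedLipschitzDomain Ω) {n : ℕ} {T : ℝ}
    (h : ∃ᶠ s in 𝓝[<] (1 : ℝ), ∃ (μ : Fin n → ℝ) (w : Fin n → Eucl N → ℝ),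
      (∀ i, μ i ≤ T ∧ IsFracEigenfunction Ω s (μ i) (w i)) ∧
      ∀ i j, ∫ x in Ω, w i x * w j x = if i = j then 1 else 0) :
    ∃ (μ : Fin n → ℝ) (w : Fin n → Eucl N → ℝ),
      (∀ i, μ i ≤ T ∧ IsLocalEigenfunction Ω (μ i) (w i)) ∧
      ∀ i j, ∫ x in Ω, w i x * w j x = if i = j then 1 else 0 := by
  obtain ⟨s, hs, hsk⟩ := exists_seq_forall_of_frequently
    (h.and_eventually eventually_mem_Ioo_half)
  choose μ u hu ho using fun k => (hsk k).1
  have hs' := fun k => (hsk k).2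
  have hmem : ∀ k i, MemLp (u k i) 2 (volume.restrict Ω) := fun k i => (hu k i).2.memHs.memLp
  obtain ⟨φ, hφ, hlim⟩ := exists_common_subseq
    (fun (i : Fin n) k => (μ k i, (hmem k i).toLp (u k i))) fun i φ hφ => by
      obtain ⟨ψ, hψ, l, w, h⟩ := exists_subseq_eigenpair hΩ (hs.comp hφ.tendsto_atTop)
        (fun k => (hu (φ k) i).2) (fun k => (hu (φ k) i).1) fun k => by simpa using ho (φ k) i i
      exact ⟨ψ, hψ, _, h⟩
  choose a ha using hlim
  have hμ : ∀ i, Tendsto (fun k => μ (φ k) i) atTop (𝓝 (a i).1) := fun i =>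
    (continuous_fst.tendsto _).comp (ha i)
  have hw : ∀ i, MemLp (a i).2 2 (volume.restrict Ω) := fun i => Lp.memLp _
  have huw : ∀ i, Tendsto (fun k => eLpNorm (fun x => u (φ k) i x - (a i).2 x) 2
      (volume.restrict Ω)) atTop (𝓝 0) := fun i => by
    have h1 : Tendsto (fun k => (hmem (φ k) i).toLp (u (φ k) i)) atTop (𝓝 (a i).2) :=
      (continuous_snd.tendsto _).comp (ha i)
    rw [← Lp.toLp_coeFn (a i).2 (hw i)] at h1
    exact (Lp.tendsto_Lp_iff_tendsto_eLpNorm'' _ (fun k => hmem (φ k) i) _ (hw i)).mp h1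
  have horth : ∀ i j, ∫ x in Ω, (a i).2 x * (a j).2 x = if i = j then 1 else 0 := fun i j => by
    refine tendsto_nhds_unique (tendsto_integral_mul (fun k => hmem (φ k) i)
      (fun k => hmem (φ k) j) (hw i) (hw j) (huw i) (huw j)) ?_
    simp only [ho]
    exact tendsto_const_nhds
  refine ⟨fun i => (a i).1, fun i => (a i).2, fun i => ⟨le_of_tendsto' (hμ i) fun k =>
    (hu (φ k) i).1, ?_⟩, horth⟩
  refine isLocalEigenfunction_of_tendsto hΩ (hs.comp hφ.tendsto_atTop) (fun k => hs' (φ k))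
    (fun k => (hu (φ k) i).2) (hμ i) (hw i) (fun h0 => ?_) (huw i)
  have h1 := horth i i
  rw [if_pos rfl, integral_eq_zero_of_ae (by filter_upwards [h0] with x hx; simp [hx])] at h1
  exact zero_ne_one h1

/-- Local eigenfunctions persist as fractional ones, with nearly the same eigenvalues. -/
theorem eventually_frac_eigenfunctions_of_local {Ω : Set (Eucl N)}
    (hΩ : IsBoundedLipschitzDomain Ω) {n : ℕ} {lam : Fin n → ℝ} {u : Fin n → Eucl N → ℝ} {t T : ℝ}
    (htT : t < T) (hu : ∀ i, lam i ≤ t ∧ IsLocalEigenfunction Ω (lam i) (u i))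
    (ho : ∀ i j, ∫ x in Ω, u i x * u j x = if i = j then 1 else 0) :
    ∀ᶠ s in 𝓝[<] (1 : ℝ), ∃ (μ : Fin n → ℝ) (w : Fin n → Eucl N → ℝ),
      (∀ i, μ i ≤ T ∧ IsFracEigenfunction Ω s (μ i) (w i)) ∧
      ∀ i j, ∫ x in Ω, w i x * w j x = if i = j then 1 else 0 := by
  choose g hg hge using fun i => (hu i).2.weak_eq
  choose v hv hv1 hv2 using fun i => exists_contDiff_tendsto_H1 hΩ (hg i)
  have hvm : ∀ i k, MemLp (v i k) 2 (volume.restrict Ω) := fun i k =>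
    (hasH1Gradient_of_contDiff (hv i k).1 (hv i k).2).memLp
  have hBlim : ∀ i j, Tendsto (fun k => ∫ x in Ω, v i k x * v j k x) atTop
      (𝓝 (∫ x in Ω, u i x * u j x)) := fun i j =>
    tendsto_integral_mul (hvm i) (hvm j) (hg i).memLp (hg j).memLp (hv1 i) (hv1 j)
  have hAlim : ∀ i j, Tendsto (fun k => ∫ x in Ω, (⟪gradient (v i k) x, gradient (v j k) x⟫ : ℝ))
      atTop (𝓝 (∫ x in Ω, (⟪g i x, g j x⟫ : ℝ))) := fun i j =>
    tendsto_integral_inner (fun k => memLp_gradient (hv i k).1 (hv i k).2 Ω)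
      (fun k => memLp_gradient (hv j k).1 (hv j k).2 Ω) (hg i).memLp_grad (hg j).memLp_grad
      (hv2 i) (hv2 j)
  have hdiag : ∀ (c : Fin n → ℝ) (d : Fin n → ℝ),
      ∑ i, ∑ j, c i * c j * (d i * if i = j then 1 else 0) = ∑ i, d i * c i ^ 2 := by
    intro c d
    refine Finset.sum_congr rfl fun i _ => ?_
    rw [Finset.sum_eq_single i (fun j _ hj => by rw [if_neg hj.symm]; ring) (by simp), if_pos rfl]
    ring
  have h1 := eventually_quadForm_ge (l := atTop) one_pos hBlim fun c => by
    have := hdiag c fun _ => 1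
    simp only [one_mul] at this
    simp only [ho, this, one_mul, le_refl]
  -- For the exact eigenfunctions the weak equation makes the form diagonal with entries T - lam i ≥
  -- T - t, a positive margin that smooth approximants keep up to a factor 1/2.
  have h2 := eventually_quadForm_ge (l := atTop) (sub_pos.mpr htT)
    (fun i j => ((hBlim i j).const_mul T).sub (hAlim i j)) fun c => by
      have := hdiag c fun i => T - lam i
      simp only [hge _ _ _ (hg _), ho, ← sub_mul, this, Finset.mul_sum]
      refine Finset.sum_le_sum fun i _ => mul_le_mul_of_nonneg_right ?_ (sq_nonneg _)
      linarith [(hu i).1]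
  obtain ⟨k, hk1, hk2⟩ := (h1.and h2).exists
  exact eventually_exists_frac_eigenfunctions hΩ (fun i => hv i k) (half_pos one_pos)
    (half_pos (sub_pos.mpr htT)) hk1 hk2

/-- A crude bound from fixed bump functions: T = (S+1)/b leaves margin 1. It guarantees that the
sets whose infimum defines the eigenvalues are nonempty for s near 1, and through the limit also for
the local problem, so no infimum of an empty set enters. -/
theorem exists_eventually_frac_eigenfunctions {Ω : Set (Eucl N)}
    (hΩ : IsBoundedLipschitzDomain Ω) (n : ℕ) :
    ∃ T : ℝ, ∀ᶠ s in 𝓝[<] (1 : ℝ), ∃ (μ : Fin n → ℝ) (w : Fin n → Eucl N → ℝ),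
      (∀ i, μ i ≤ T ∧ IsFracEigenfunction Ω s (μ i) (w i)) ∧
      ∀ i j, ∫ x in Ω, w i x * w j x = if i = j then 1 else 0 := by
  obtain ⟨v, b, hb, hv, hB⟩ := exists_orthogonal_test_functions hΩ n
  set A : Fin n → Fin n → ℝ := fun i j => ∫ x in Ω, (⟪gradient (v i) x, gradient (v j) x⟫ : ℝ)
    with hA
  set S := ∑ i, ∑ j, |A i j| with hS
  have hAle : ∀ c : Fin n → ℝ, ∑ i, ∑ j, c i * c j * A i j ≤ S * ∑ i, c i ^ 2 := by
    intro c
    rw [hS, Finset.sum_mul]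
    refine Finset.sum_le_sum fun i _ => ?_
    rw [Finset.sum_mul]
    refine Finset.sum_le_sum fun j _ => ?_
    have hi := Finset.single_le_sum (f := fun i => c i ^ 2) (fun i _ => sq_nonneg _)
      (Finset.mem_univ i)
    have hj := Finset.single_le_sum (f := fun i => c i ^ 2) (fun i _ => sq_nonneg _)
      (Finset.mem_univ j)
    have hij : |c i * c j| ≤ ∑ i, c i ^ 2 := by
      rw [abs_mul]
      nlinarith [sq_nonneg (|c i| - |c j|), sq_abs (c i), sq_abs (c j)]
    calc c i * c j * A i j ≤ |c i * c j * A i j| := le_abs_self _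
      _ = |A i j| * |c i * c j| := by rw [abs_mul, mul_comm]
      _ ≤ _ := mul_le_mul_of_nonneg_left hij (abs_nonneg _)
  have hS0 : 0 ≤ S := Finset.sum_nonneg fun i _ => Finset.sum_nonneg fun j _ => abs_nonneg _
  refine ⟨(S + 1) / b, eventually_exists_frac_eigenfunctions hΩ hv hb one_pos hB fun c => ?_⟩
  have e : ∑ i, ∑ j, c i * c j * ((S + 1) / b * (∫ x in Ω, v i x * v j x) - A i j) =
      (S + 1) / b * ∑ i, ∑ j, c i * c j * (∫ x in Ω, v i x * v j x) -
        ∑ i, ∑ j, c i * c j * A i j := by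
    simp only [Finset.mul_sum, ← Finset.sum_sub_distrib]
    exact Finset.sum_congr rfl fun i _ => Finset.sum_congr rfl fun j _ => by ring
  refine le_trans ?_ e.ge
  have h1 := mul_le_mul_of_nonneg_left (hB c) (div_nonneg (by linarith : 0 ≤ S + 1) hb.le)
  have h2 : (S + 1) / b * (b * ∑ i, c i ^ 2) = (S + 1) * ∑ i, c i ^ 2 := by field_simp
  linarith [hAle c]

/-- The eigenvalues of the fractional Neumann Laplacian converge to those of the local one. -/
theorem tendsto_fracEigenvalue {Ω : Set (Eucl N)} (hΩ : IsBoundedLipschitzDomain Ω) (n : ℕ) :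
    Tendsto (fun s : ℝ => fracEigenvalue Ω s n) (𝓝[<] 1) (𝓝 (localEigenvalue Ω n)) := by
  obtain ⟨T, hT⟩ := exists_eventually_frac_eigenfunctions hΩ (n + 1)
  rw [tendsto_order]
  constructor
  -- If the fractional eigenvalues were at most a for some s arbitrarily close to 1, families with
  -- eigenvalues below a' would exist there, and their limits would put the local eigenvalue at or
  -- below a'.
  · intro a ha
    obtain ⟨a', haa', ha'⟩ := exists_between ha
    by_contra hcon
    rw [not_eventually] at hcon
    refine ha'.not_ge ?_
    refine csInf_le (bddBelow_of_nonneg (P := IsLocalEigenfunction Ω) (fun _ _ h => h.nonneg) n)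
      (exists_local_eigenfunctions_of_frequently hΩ ((hcon.and_eventually hT).mono ?_))
    rintro s ⟨h1, h2⟩
    obtain ⟨t, ⟨lam, u, hu, ho⟩, hta⟩ := exists_lt_of_csInf_lt ⟨T, h2⟩
      ((not_lt.mp h1).trans_lt haa')
    exact ⟨lam, u, fun i => ⟨(hu i).1.trans hta.le, (hu i).2⟩, ho⟩
  · intro a ha
    obtain ⟨a', haa', ha'⟩ := exists_between ha
    obtain ⟨t, ⟨lam, u, hu, ho⟩, hta⟩ := exists_lt_of_csInf_lt
      ⟨T, exists_local_eigenfunctions_of_frequently hΩ hT.frequently⟩ haa'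
    filter_upwards [eventually_frac_eigenfunctions_of_local hΩ hta hu ho] with s hs
    exact (csInf_le (bddBelow_of_nonneg (P := IsFracEigenfunction Ω s) (fun _ _ h => h.nonneg) n)
      hs).trans_lt ha'

theorem exists_strictMono_tendsto_one :
    ∃ σ : ℕ → ℝ, StrictMono σ ∧ (∀ k, σ k ∈ Ioo (1 / 2 : ℝ) 1) ∧ Tendsto σ atTop (𝓝[<] 1) := by
  obtain ⟨σ, hmono, hmem, hlim⟩ := exists_seq_strictMono_tendsto' (show (1 / 2 : ℝ) < 1 by norm_num)
  exact ⟨σ, hmono, hmem, tendsto_nhdsWithin_of_tendsto_nhds_of_eventually_within _ hlim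
    (Eventually.of_forall fun k => (hmem k).2)⟩

/-- Normalized eigenfunctions converge along a subsequence. -/
theorem exists_seq_tendsto_eigenfunction {Ω : Set (Eucl N)} (hΩ : IsBoundedLipschitzDomain Ω)
    (n : ℕ) {u : ℝ → Eucl N → ℝ}
    (hu : ∀ s ∈ Ioo (0 : ℝ) 1, IsFracEigenfunction Ω s (fracEigenvalue Ω s n) (u s) ∧
      eLpNorm (u s) 2 (volume.restrict Ω) = 1) :
    ∃ (σ : ℕ → ℝ) (w : Eucl N → ℝ), StrictMono σ ∧ (∀ k, σ k ∈ Ioo (0 : ℝ) 1) ∧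
      Tendsto σ atTop (𝓝 1) ∧ IsLocalEigenfunction Ω (localEigenvalue Ω n) w ∧
      Tendsto (fun k => eLpNorm (fun x => u (σ k) x - w x) 2 (volume.restrict Ω)) atTop (𝓝 0) := by
  obtain ⟨s, hsmono, hs', hs⟩ := exists_strictMono_tendsto_one
  have hs0 : ∀ k, s k ∈ Ioo (0 : ℝ) 1 := fun k => ⟨by linarith [(hs' k).1], (hs' k).2⟩
  have hu' := fun k => hu (s k) (hs0 k)
  have hmem : ∀ k, MemLp (u (s k)) 2 (volume.restrict Ω) := fun k => (hu' k).1.memHs.memLp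
  have hnorm : ∀ k, ∫ x in Ω, u (s k) x * u (s k) x = 1 := fun k => by
    have h1 := eLpNorm_two_sq (μ := volume.restrict Ω) (u (s k))
    rw [lintegral_sq_eq_ofReal_integral (hmem k), (hu' k).2, one_pow] at h1
    simp only [sq (u _ _)] at h1
    exact ENNReal.ofReal_eq_one.mp h1.symm
  have hev := (tendsto_fracEigenvalue hΩ n).comp hs
  obtain ⟨T, hT⟩ := hev.bddAbove_range
  obtain ⟨φ, hφ, l, w, hlw⟩ := exists_subseq_eigenpair hΩ hs (fun k => (hu' k).1)
    (fun k => hT (mem_range_self k)) hnorm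
  have hw := Lp.memLp w
  have huw : Tendsto (fun k => eLpNorm (fun x => u (s (φ k)) x - w x) 2 (volume.restrict Ω)) atTop
      (𝓝 0) := by
    have h1 : Tendsto (fun k => (hmem (φ k)).toLp (u (s (φ k)))) atTop (𝓝 w) :=
      (continuous_snd.tendsto _).comp hlw
    rw [← Lp.toLp_coeFn w hw] at h1
    exact (Lp.tendsto_Lp_iff_tendsto_eLpNorm'' _ (fun k => hmem (φ k)) _ hw).mp h1
  -- The limit eigenvalue is taken from the convergence of the whole family rather than from l,
  -- which identifies it as the n-th local eigenvalue.
  have hsφ := hs.comp hφ.tendsto_atTop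
  refine ⟨s ∘ φ, w, hsmono.comp hφ, fun k => hs0 _, tendsto_nhds_of_tendsto_nhdsWithin hsφ,
    isLocalEigenfunction_of_tendsto hΩ hsφ (fun k => hs' _) (fun k => (hu' (φ k)).1)
      (hev.comp hφ.tendsto_atTop) hw (fun h0 => ?_) huw, huw⟩
  have h1 := tendsto_integral_mul (fun k => hmem (φ k)) (fun k => hmem (φ k)) hw hw huw huw
  simp only [hnorm] at h1
  rw [integral_eq_zero_of_ae (f := fun x => w x * w x)
    (by filter_upwards [h0] with x hx; simp [hx])] at h1
  exact one_ne_zero (tendsto_nhds_unique tendsto_const_nhds h1)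

end Main

end NeumannStability

end

theorem theorem3p1 {N : ℕ} [NeZero N] (hN : 2 ≤ N)
    (Ω : Set (NeumannStability.Eucl N)) (hΩ : NeumannStability.IsBoundedLipschitzDomain Ω)
    (n : ℕ) :
    Tendsto (fun s : ℝ => NeumannStability.fracEigenvalue Ω s n) (𝓝[<] 1)
      (𝓝 (NeumannStability.localEigenvalue Ω n)) ∧
    ∀ u : ℝ → NeumannStability.Eucl N → ℝ,
      (∀ s ∈ Ioo (0 : ℝ) 1,
        NeumannStability.IsFracEigenfunction Ω s (NeumannStability.fracEigenvalue Ω s n) (u s) ∧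
          eLpNorm (u s) 2 (volume.restrict Ω) = 1) →
      ∃ (σ : ℕ → ℝ) (w : NeumannStability.Eucl N → ℝ),
        StrictMono σ ∧ (∀ k, σ k ∈ Ioo (0 : ℝ) 1) ∧ Tendsto σ atTop (𝓝 1) ∧
        NeumannStability.IsLocalEigenfunction Ω (NeumannStability.localEigenvalue Ω n) w ∧
        Tendsto (fun k => eLpNorm (fun x => u (σ k) x - w x) 2 (volume.restrict Ω)) atTop
          (𝓝 0) := by
  exact ⟨NeumannStability.tendsto_fracEigenvalue hΩ n, fun _ hu =>
    NeumannStability.exists_seq_tendsto_eigenfunction hΩ n hu⟩
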